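/- Let $\mathcal K$ be an algebraically closed field of characteristic zero. A nonsingular $\mathcal K$-variety is an integral separated scheme of finite type over $\mathcal K$ with regular local rings; in particular, every irreducible nonsingular quasi-projective variety is one. A reduced divisor $D=\sum D_i$ on a nonsingular variety $X$ of dimension $d$ is SNC if at every closed point $p$ there are regular parameters $x_1,\dots,x_d$ of $\mathcal O_{X,p}$ and $a_1,\dots,a_d\in\mathbb N$ with $\mathcal I_{D,p}=x_1^{a_1}\cdots x_d^{a_d}\mathcal O_{X,p}$, where $\mathcal I_D$ is the ideal sheaf of $\operatorname{Supp}D$. A closed point $p$ is an $n$-point for $D$ if it lies on exactly $n$ irreducible components of $D$. Permissible parameters for $D$ at an $n$-point $p$ are regular parameters $x_1,\dots,x_d$ of $\hat{\mathcal O}_{X,p}$ with $\mathcal I_D\hat{\mathcal O}_{X,p}=(x_1\cdots x_n)$. An affine toric variety is $X_\sigma=\operatorname{Spec}\mathcal K[\sigma^\vee\cap M]$, for a strongly convex rational polyhedral cone $\sigma\subset N_{\mathbb R}$, where $N\cong\mathbb Z^d$ and $M$ is the dual lattice; its torus is $T=\operatorname{Spec}\mathcal K[M]$. A morphism of affine toric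 varieties is toric if it maps torus into torus and restricts to a homomorphism of algebraic groups on the tori. A local model of $(X,D)$ at a closed point $p$ consists of an affine toric variety $X_\sigma$ of dimension $d=\dim X$, a closed point $p'\in X_\sigma$ and an isomorphism of $\mathcal K$-algebras $\hat{\mathcal O}_{X,p}\cong\hat{\mathcal O}_{X_\sigma,p'}$ that takes $\mathcal I_D\hat{\mathcal O}_{X,p}$ to $\mathcal I_{X_\sigma\setminus T}\hat{\mathcal O}_{X_\sigma,p'}$. Let $\varphi:X\to Y$ be a dominant morphism over $\mathcal K$ of nonsingular $\mathcal K$-varieties, $\dim X=d$, $\dim Y=m$. Let $D_Y$ be an SNC divisor on $Y$ such that the reduced divisor $D_X=\varphi^{-1}(D_Y)$ is an SNC divisor on $X$ and contains every point at which $\varphi$ is not smooth. One says that $\varphi$ is toroidal (with respect to $D_X$ and $D_Y$) if for every closed point $p\in X$, with $q=\varphi(p)$, there are local models $(X_\sigma,p')$ of $(X,D_X)$ at $p$ and $(Y_\tau,q')$ of $(Y,D_Y)$ at $q$, and a toric morphism $\psi:X_\sigma\to Y_\tau$ with $\psi(p')=q'$, such that the isomorphisms of the local models identify $\hat\varphi^*:\hat{\mathcal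 O}_{Y,q}\to\hat{\mathcal O}_{X,p}$ with $\hat\psi^*:\hat{\mathcal O}_{Y_\tau,q'}\to\hat{\mathcal O}_{X_\sigma,p'}$. Theorem. The morphism $\varphi$ is toroidal if and only if for every closed point $p\in D_X$, where $p$ is an $n$-point for $D_X$ and $q=\varphi(p)$ is an $\ell$-point for $D_Y$, there exist permissible parameters $x_1,\dots,x_d$ for $D_X$ at $p$, permissible parameters $y_1,\dots,y_m$ for $D_Y$ at $q$, a matrix $(a_{ij})\in\mathbb N^{\ell\times n}$ with $$r:=\operatorname{rank}(a_{ij})_{1\le i\le\ell,\,1\le j\le n}=\operatorname{rank}(a_{ij})_{1\le i\le r,\,1\le j\le r}$$ and $n+m-r\le d$, and constants $\alpha_{n+1},\dots,\alpha_{n+\ell-r}\in\mathcal K^\times$, such that $$\hat\varphi^*(y_i)=\begin{cases}x_1^{a_{i1}}\cdots x_n^{a_{in}},&1\le i\le r,\\ x_1^{a_{i1}}\cdots x_n^{a_{in}}\,(x_{n-r+i}+\alpha_{n-r+i}),&r<i\le\ell,\\ x_{n-r+i},&\ell<i\le m,\end{cases}$$ and moreover $\sum_{i=1}^{\ell}a_{ij}>0$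 for all $1\le j\le n$ and $\sum_{j=1}^{n}a_{ij}>0$ for all $1\le i\le\ell$. -/

import Mathlib

universe u

open CategoryTheory AlgebraicGeometry TopologicalSpace IsLocalRing

noncomputable section

namespace Toroidal

/-! ### Completed local rings -/

/-- The completion of a local ring with respect to its maximal ideal. -/
abbrev Completion (R : Type u) [CommRing R] [IsLocalRing R] : Type u :=
  AdicCompletion (maximalIdeal R) R

theorem maximalIdeal_pow_le_comap {R S : Type u} [CommRing R] [IsLocalRing R] [CommRing S]
    [IsLocalRing S] (f : R →+* S) [IsLocalHom f] (n : ℕ) :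
    maximalIdeal R ^ n ≤ (maximalIdeal S ^ n).comap f :=
  (Ideal.pow_right_mono (fun _ hx => ((map_mem_nonunits_iff f _).mpr hx)) n).trans
    (Ideal.le_comap_pow f n)

/-- The map `R̂ → R / m_R ^ n → S / m_S ^ n` induced by a local homomorphism `f : R → S`. -/
def completionMapMod {R S : Type u} [CommRing R] [IsLocalRing R] [CommRing S] [IsLocalRing S]
    (f : R →+* S) [IsLocalHom f] (n : ℕ) : Completion R →+* S ⧸ maximalIdeal S ^ n :=
  (Ideal.quotientMap (maximalIdeal S ^ n) f (maximalIdeal_pow_le_comap f n)).comp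
    (AdicCompletion.evalₐ (maximalIdeal R) n : Completion R →+* R ⧸ maximalIdeal R ^ n)

theorem completionMapMod_compat {R S : Type u} [CommRing R] [IsLocalRing R] [CommRing S]
    [IsLocalRing S] (f : R →+* S) [IsLocalHom f] {a b : ℕ} (hle : a ≤ b) :
    (Ideal.Quotient.factorPow (maximalIdeal S) hle).comp (completionMapMod f b) =
      completionMapMod f a := by
  ext x
  obtain ⟨r, rfl⟩ := AdicCompletion.mk_surjective (maximalIdeal R) R x
  simp only [completionMapMod, RingHom.comp_apply, RingHom.coe_coe, AdicCompletion.evalₐ_mk,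
    Ideal.quotientMap_mk]
  have h := Ideal.Quotient.eq.mp (AdicCompletion.Ideal.mk_eq_mk (maximalIdeal R) hle r)
  refine Ideal.Quotient.eq.mpr ?_
  rw [← map_sub]
  exact maximalIdeal_pow_le_comap f a h

/-- The ring homomorphism of completions induced by a local homomorphism `f : R → S`: it is the
inverse limit of the maps `R / m_R ^ n → S / m_S ^ n`. -/
def completionMap {R S : Type u} [CommRing R] [IsLocalRing R] [CommRing S] [IsLocalRing S]
    (f : R →+* S) [IsLocalHom f] : Completion R →+* Completion S :=
  AdicCompletion.liftRingHom (maximalIdeal S) (completionMapMod f) (completionMapMod_compat f)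

/-- `Ô_{X,p}`. -/
abbrev completedStalk (X : Scheme.{u}) (p : X) : Type u :=
  Completion (X.presheaf.stalk p)

/-- `φ̂^* : Ô_{Y,φ(p)} → Ô_{X,p}`. -/
def completedStalkMap {X Y : Scheme.{u}} (φ : X ⟶ Y) (p : X) :
    completedStalk Y (φ p) →+* completedStalk X p :=
  completionMap (φ.stalkMap p).hom

/-- The structure map `K → Ô_{X,p}` of a `K`-scheme. -/
def const {K : Type u} [Field K] {X : Scheme.{u}} (sX : X ⟶ Spec (CommRingCat.of K)) (p : X) :
    K →+* completedStalk X p :=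
  (algebraMap (X.presheaf.stalk p) (completedStalk X p)).comp
    ((Scheme.ΓSpecIso (CommRingCat.of K)).inv ≫ sX.appTop ≫
      X.presheaf.germ ⊤ p trivial).hom

/-- For a closed subset `Z` of `X`, the stalk at `p` of the (radical) ideal sheaf of `Z`: the germs
which vanish at all points of `Spec O_{X,p}` lying over `Z`. -/
def stalkIdeal (X : Scheme.{u}) (Z : Set X) (p : X) : Ideal (X.presheaf.stalk p) :=
  PrimeSpectrum.vanishingIdeal ((X.fromSpecStalk p) ⁻¹' Z)

/-- The ideal `I_Z Ô_{X,p}`. -/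
def completedIdeal (X : Scheme.{u}) (Z : Set X) (p : X) : Ideal (completedStalk X p) :=
  (stalkIdeal X Z p).map (algebraMap (X.presheaf.stalk p) (completedStalk X p))

/-! ### Nonsingular varieties and SNC divisors -/

/-- A nonsingular `K`-variety of dimension `d`: an integral separated scheme of finite type over
`K`, all of whose local rings are regular. -/
structure IsNonsingularVariety {K : Type u} [Field K] {X : Scheme.{u}}
    (sX : X ⟶ Spec (CommRingCat.of K)) (d : ℕ) : Prop where
  isIntegral : IsIntegral X
  isSeparated : IsSeparated sX
  locallyOfFiniteType : LocallyOfFiniteType sX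
  quasiCompact : QuasiCompact sX
  regular : ∀ p : X, IsRegularLocalRing (X.presheaf.stalk p)
  dim : topologicalKrullDim X = d

/-- A reduced divisor `D = ∑ D_i`: a finite set of irreducible closed subsets of codimension one. -/
structure ReducedDivisor (X : Scheme.{u}) where
  components : Finset (IrreducibleCloseds X)
  codim_one : ∀ W ∈ components, Order.coheight W = 1

namespace ReducedDivisor

variable {X : Scheme.{u}}

/-- `Supp D = ⋃ D_i`. -/
def support (D : ReducedDivisor X) : Set X := ⋃ W ∈ D.components, (W : Set X)

/-- `D` is a simple normal crossings divisor on the nonsingular `d`-dimensional variety `X`: at each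
closed point `p` there are regular parameters `x_1, …, x_d` of `O_{X,p}` and exponents `a_i` with
`I_{D,p} = (x_1 ^ a_1 ⋯ x_d ^ a_d)`, where `I_D` is the ideal sheaf of `Supp D`. -/
def IsSNC (D : ReducedDivisor X) (d : ℕ) : Prop :=
  ∀ p : X, IsClosed ({p} : Set X) →
    ∃ (x : Fin d → X.presheaf.stalk p) (a : Fin d → ℕ),
      Ideal.span (Set.range x) = maximalIdeal (X.presheaf.stalk p) ∧
      stalkIdeal X D.support p = Ideal.span {∏ i, x i ^ a i}

/-- `p` lies in exactly `n` irreducible components of `D`. -/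
def IsNPoint (D : ReducedDivisor X) (n : ℕ) (p : X) : Prop :=
  {W : IrreducibleCloseds X | W ∈ D.components ∧ p ∈ W}.ncard = n

/-- `x_1, …, x_d` are formal permissible parameters for `D` at the `n`-point `p`: they are regular
parameters of `Ô_{X,p}` (they generate its maximal ideal `m_p Ô_{X,p}`) and
`I_D Ô_{X,p} = (x_1 ⋯ x_n)`. -/
structure IsPermissible (D : ReducedDivisor X) {d n : ℕ} (hn : n ≤ d) (p : X)
    (x : Fin d → completedStalk X p) : Prop where
  span_eq : Ideal.span (Set.range x) = (maximalIdeal (X.presheaf.stalk p)).map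
    (algebraMap (X.presheaf.stalk p) (completedStalk X p))
  local_equation :
    completedIdeal X D.support p = Ideal.span {∏ j : Fin n, x (Fin.castLE hn j)}

end ReducedDivisor

/-- `φ` is smooth at `p`. -/
def IsSmoothAt {X Y : Scheme.{u}} (φ : X ⟶ Y) (p : X) : Prop :=
  ∃ U : X.Opens, p ∈ U ∧ Smooth (U.ι ≫ φ)

/-! ### Affine toric varieties and toric morphisms -/

/-- A strongly convex rational polyhedral cone `σ` in `N_ℝ`, for the lattice `N = ℤ^d`. -/
structure ToricCone (d : ℕ) where
  cone : PointedCone ℝ (Fin d → ℝ)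
  rational : ∃ S : Finset (Fin d → ℤ),
    cone = PointedCone.hull ℝ ((fun (v : Fin d → ℤ) (i : Fin d) => (v i : ℝ)) '' S)
  strongly_convex : ∀ v ∈ cone, -v ∈ cone → v = 0

/-- The semigroup `S_σ = σ^∨ ∩ M`, with `M = ℤ^d` dual to `N` by the standard pairing. -/
def ToricCone.semigroup {d : ℕ} (σ : ToricCone d) : AddSubmonoid (Fin d → ℤ) where
  carrier := {a | ∀ v ∈ σ.cone, 0 ≤ ∑ i, (a i : ℝ) * v i}
  zero_mem' := by intro v _; simp
  add_mem' := by
    intro a b ha hb v hv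
    simpa [add_mul, Finset.sum_add_distrib] using add_nonneg (ha v hv) (hb v hv)

section Toric

variable (K : Type u) [Field K]

/-- The semigroup algebra `K[S_σ]`. -/
abbrev SemigroupAlgebra {d : ℕ} (σ : ToricCone d) : Type u := AddMonoidAlgebra K σ.semigroup

/-- The Laurent polynomial ring `K[M]`, `M = ℤ^d`. -/
abbrev TorusAlgebra (d : ℕ) : Type u := AddMonoidAlgebra K (Fin d → ℤ)

/-- The affine toric variety `X_σ = Spec K[S_σ]`. -/
abbrev toricVariety {d : ℕ} (σ : ToricCone d) : Scheme.{u} :=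
  Spec (CommRingCat.of (SemigroupAlgebra K σ))

/-- The structure morphism `X_σ → Spec K`. -/
def toricStructure {d : ℕ} (σ : ToricCone d) : toricVariety K σ ⟶ Spec (CommRingCat.of K) :=
  Spec.map (CommRingCat.ofHom (algebraMap K (SemigroupAlgebra K σ)))

/-- The algebraic torus `T = Spec K[M]`. -/
abbrev torus (d : ℕ) : Scheme.{u} := Spec (CommRingCat.of (TorusAlgebra K d))

/-- The inclusion `T → X_σ` of the torus, given by `K[S_σ] ⊆ K[M]`. -/
def torusInclusion {d : ℕ} (σ : ToricCone d) : torus K d ⟶ toricVariety K σ :=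
  Spec.map (CommRingCat.ofHom
    (AddMonoidAlgebra.mapDomainAlgHom K K σ.semigroup.subtype).toRingHom)

/-- `X_σ ∖ T`. -/
def toricBoundary {d : ℕ} (σ : ToricCone d) : Set (toricVariety K σ) :=
  (Set.range (torusInclusion K σ))ᶜ

variable {K}

/-- `ψ : X_σ → Y_τ` is toric: it maps the torus `T_1` into `T_2`, and the restriction `T_1 → T_2` is
a homomorphism of algebraic groups over `K`, i.e. it is given by a homomorphism of bialgebras
`K[M_2] → K[M_1]`. -/
def IsToric {d m : ℕ} {σ : ToricCone d} {τ : ToricCone m}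
    (ψ : toricVariety K σ ⟶ toricVariety K τ) : Prop :=
  ∃ g : TorusAlgebra K m →ₐc[K] TorusAlgebra K d,
    torusInclusion K σ ≫ ψ =
      Spec.map (CommRingCat.ofHom (g : TorusAlgebra K m →+* TorusAlgebra K d)) ≫
        torusInclusion K τ

/-- `ι` exhibits `(X_σ, p')` as a local model of `(X, D)` at `p`: `p'` is a closed point of `X_σ`,
`ι : Ô_{X,p} ≃ Ô_{X_σ,p'}` is an isomorphism of `K`-algebras, and it takes `I_D Ô_{X,p}` to
`I_{X_σ ∖ T} Ô_{X_σ,p'}`. -/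
structure IsLocalModel {X : Scheme.{u}} (sX : X ⟶ Spec (CommRingCat.of K)) (D : ReducedDivisor X)
    (p : X) {d : ℕ} (σ : ToricCone d) (p' : toricVariety K σ)
    (ι : completedStalk X p ≃+* completedStalk (toricVariety K σ) p') : Prop where
  isClosed : IsClosed ({p'} : Set (toricVariety K σ))
  map_const : ∀ c : K, ι (const sX p c) = const (toricStructure K σ) p' c
  map_ideal : (completedIdeal X D.support p).map (ι : completedStalk X p →+* _) =
    completedIdeal (toricVariety K σ) (toricBoundary K σ) p'

/-- The morphism `φ : X → Y`, `dim X = d`, `dim Y = m`, is toroidal with respect to `D_X` and `D_Y`: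
at every closed point it is formally isomorphic, through local models, to a toric morphism. -/
def IsToroidal {X Y : Scheme.{u}} (sX : X ⟶ Spec (CommRingCat.of K))
    (sY : Y ⟶ Spec (CommRingCat.of K)) (φ : X ⟶ Y) (d m : ℕ) (DX : ReducedDivisor X)
    (DY : ReducedDivisor Y) : Prop :=
  ∀ p : X, IsClosed ({p} : Set X) →
    ∃ (σ : ToricCone d) (τ : ToricCone m) (p' : toricVariety K σ)
      (ψ : toricVariety K σ ⟶ toricVariety K τ)
      (ιp : completedStalk X p ≃+* completedStalk (toricVariety K σ) p')
      (ιq : completedStalk Y (φ p) ≃+* completedStalk (toricVariety K τ) (ψ p')),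
      IsToric ψ ∧ IsLocalModel sX DX p σ p' ιp ∧ IsLocalModel sY DY (φ p) τ (ψ p') ιq ∧
      ∀ f : completedStalk Y (φ p),
        ιp (completedStalkMap φ p f) = completedStalkMap ψ p' (ιq f)

end Toric

/-! ### The monomial normal form -/

/-- At the `n`-point `p` over the `ℓ`-point `φ(p)`, there are permissible parameters `x`, `y`, an
exponent matrix `a` with its rank `r`, and constants `α` such that, with indices starting at `1`,
`y_i = x^{a_i}` for `i ≤ r`, `y_i = x^{a_i} (x_{n-r+i} + α_{n-r+i})` for `r < i ≤ ℓ`, and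
`y_i = x_{n-r+i}` for `ℓ < i ≤ m`. The inequality `n + m ≤ d + r` says that all the variables
`x_{n-r+i}` with `r < i ≤ m` exist. -/
def HasToroidalForm {K : Type u} [Field K] {X Y : Scheme.{u}} (sX : X ⟶ Spec (CommRingCat.of K))
    (φ : X ⟶ Y) (d m : ℕ) (DX : ReducedDivisor X) (DY : ReducedDivisor Y) (p : X) (n l : ℕ) :
    Prop :=
  ∃ (hn : n ≤ d) (hl : l ≤ m) (x : Fin d → completedStalk X p)
    (y : Fin m → completedStalk Y (φ p)) (a : Matrix (Fin l) (Fin n) ℕ) (r : ℕ) (hrl : r ≤ l)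
    (hrn : r ≤ n) (_ : n + m ≤ d + r) (α : Fin d → K),
    DX.IsPermissible hn p x ∧
    DY.IsPermissible hl (φ p) y ∧
    (∀ i : Fin r, completedStalkMap φ p (y (Fin.castLE (hrl.trans hl) i)) =
      ∏ j : Fin n, x (Fin.castLE hn j) ^ a (Fin.castLE hrl i) j) ∧
    (∀ (i : Fin l) (_ : r ≤ (i : ℕ)), completedStalkMap φ p (y (Fin.castLE hl i)) =
      (∏ j : Fin n, x (Fin.castLE hn j) ^ a i j) *
        (x ⟨n - r + i, by omega⟩ + const sX p (α ⟨n - r + i, by omega⟩))) ∧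
    (∀ (i : Fin m) (_ : l ≤ (i : ℕ)),
      completedStalkMap φ p (y i) = x ⟨n - r + i, by omega⟩) ∧
    (∀ k : Fin d, n ≤ (k : ℕ) → (k : ℕ) < n + (l - r) → α k ≠ 0) ∧
    (a.map (Nat.cast : ℕ → ℚ)).rank = r ∧
    ((a.map (Nat.cast : ℕ → ℚ)).submatrix (Fin.castLE hrl) (Fin.castLE hrn)).rank = r ∧
    (∀ j : Fin n, 0 < ∑ i : Fin l, a i j) ∧
    (∀ i : Fin l, 0 < ∑ j : Fin n, a i j)

end Toroidal

end

/-! The argument takes place in completed local rings at closed points. Any `d` generators of the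
maximal ideal of such a ring are coordinates: evaluation at them identifies it with a power series
ring over `K` (`exists_ringEquiv_mvPowerSeries`). For this one needs that the local rings at closed
points have dimension `d` (`le_ringKrullDim_stalk`), which holds because regular parameters form a
transcendence basis of the function field. At an `n`-point the SNC condition yields coordinates with
local equation `x_1 ⋯ x_n` (`ReducedDivisor.IsSNC.exists_isCoord`): the components through the point
correspond to the parameters that occur in the equation.

From toroidal to normal form. A local model carries the characters of the torus into the completed
ring of `X`. A character from the interior of the dual cone cuts out the boundary, so every
character in the semigroup divides a power of `x_1 ⋯ x_n` and is a unit times a monomial in `x_1, …,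
x_n`. Exponents and units extend to homomorphisms on the whole character lattice. Recording the `n`
exponents together with the logarithmic linear part of the unit in the other `d - n` directions
gives a map from the lattice to `K ^ d` (`Chart.logVec`). Since the characters generate the maximal
ideal up to constants, a dimension count shows that this map preserves linear independence
(`exists_chart`). The same holds for `Y`.

A toric morphism is a homomorphism `γ` of character lattices, because bialgebra maps preserve
group-like elements (`IsToric.exists_addMonoidHom`). It is injective: as `φ` is dominant and the
characteristic is zero, the Jacobian has generic rank `m`, and two characters with the same pullback
then have equal logarithmic vectors (`injective_of_algebraicIndependent`).

The normal form is now linear algebra (`exists_normal_form`). Choose `l` characters on `Y` that are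
units times single parameters and complete them by characters that are units. After a permutation
the leading minor of the exponent matrix, of size its rank `r`, is nonzero. Units have roots, so the
units in the first `r` rows can be absorbed into `x_1, …, x_r`. The units left in the other rows
have independent linear parts modulo `x_1, …, x_n`, by injectivity of `γ` and independence of the
logarithmic vectors; minus their residues they serve as further parameters.

From normal form to toroidal. The normal form is the completion of a toric morphism from `𝔸^n ×
𝔾_m^(d-n)` to `𝔸^l × 𝔾_m^(m-l)`, taken at a point whose first `n` coordinates vanish and whose torus
coordinates are the constants `α`, or `1` (`HasToroidalForm.exists_toric`). Outside of the divisor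
`φ` is smooth, so parameters of `Y` pull back to part of a system of parameters of `X`
(`hasToroidalForm_of_isSmoothAt`), which is the normal form with `n = l = 0`. -/

noncomputable section

namespace Toroidal

/-! ### Regular systems of parameters and power series -/

section Coordinates

open MvPolynomial (idealOfVars)

/-- `x_1, …, x_d` generate the maximal ideal of the local ring `A`, the field `K` maps onto the
residue field, and `x` satisfies no algebraic relation over `K` modulo a power of the maximal ideal
except the obvious ones. -/
structure IsCoord {K A : Type*} [Field K] [CommRing A] [IsLocalRing A] {d : ℕ} (k : K →+* A)
    (x : Fin d → A) : Prop where
  span : Ideal.span (Set.range x) = maximalIdeal A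
  residue : ∀ a : A, ∃ c : K, a - k c ∈ maximalIdeal A
  indep : ∀ (n : ℕ) (F : MvPolynomial (Fin d) K),
    F.eval₂Hom k x ∈ maximalIdeal A ^ n → F ∈ idealOfVars (Fin d) K ^ n

/-- The kernels of the iterates of `f` become stationary, say at `N`. If `f a = 0` and `a = f^N b`,
then `b` lies in the kernel of `f^(N+1)`, hence in that of `f^N`, so `a = 0`. -/
theorem injective_of_surjective_of_isNoetherianRing {R : Type*} [CommRing R] [IsNoetherianRing R]
    (f : R →+* R) (hf : Function.Surjective f) : Function.Injective f := by
  let c : ℕ →o Ideal R := ⟨fun n => RingHom.ker (f ^ n), monotone_nat_of_le_succ fun n a ha => by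
    rw [RingHom.mem_ker] at ha ⊢
    rw [pow_succ', RingHom.mul_def, RingHom.comp_apply, ha, map_zero]⟩
  obtain ⟨N, hN⟩ := monotone_stabilizes_iff_noetherian.mpr ‹_› c
  rw [injective_iff_map_eq_zero]
  intro a ha
  have hfN : Function.Surjective (f ^ N) := by
    rw [RingHom.coe_pow]
    exact hf.iterate N
  obtain ⟨b, rfl⟩ := hfN a
  have hb : b ∈ c (N + 1) := by
    change b ∈ RingHom.ker (f ^ (N + 1))
    rwa [RingHom.mem_ker, pow_succ', RingHom.mul_def, RingHom.comp_apply]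
  rw [← hN (N + 1) (Nat.le_succ N)] at hb
  exact hb

theorem map_idealOfVars {K A : Type*} [Field K] [CommRing A] {d : ℕ} (k : K →+* A) (x : Fin d → A) :
    (idealOfVars (Fin d) K).map (MvPolynomial.eval₂Hom k x) = Ideal.span (Set.range x) := by
  rw [idealOfVars, Ideal.map_span, ← Set.range_comp]
  congr 2
  ext i
  simp

section Local

variable {K A : Type*} [Field K] [CommRing A] [IsLocalRing A] {d : ℕ} {k : K →+* A}
  {x : Fin d → A}

theorem eval_mem_pow (hx : ∀ i, x i ∈ maximalIdeal A) {n : ℕ} {F : MvPolynomial (Fin d) K}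
    (hF : F ∈ idealOfVars (Fin d) K ^ n) : F.eval₂Hom k x ∈ maximalIdeal A ^ n := by
  have h := Ideal.mem_map_of_mem (MvPolynomial.eval₂Hom k x) hF
  rw [Ideal.map_pow, map_idealOfVars] at h
  exact Ideal.pow_right_mono (Ideal.span_le.mpr (Set.range_subset_iff.mpr hx)) n h

/-- An element of `m ^ n` is a combination of values of polynomials in `(X) ^ n`; replacing each
coefficient by its residue costs only an element of `m ^ (n + 1)`. -/
theorem exists_eval_sub_mem_pow_succ (hs : Ideal.span (Set.range x) = maximalIdeal A)
    (hr : ∀ a : A, ∃ c : K, a - k c ∈ maximalIdeal A) (n : ℕ) {a : A}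
    (ha : a ∈ maximalIdeal A ^ n) :
    ∃ F : MvPolynomial (Fin d) K, a - F.eval₂Hom k x ∈ maximalIdeal A ^ (n + 1) := by
  have hx : ∀ i, x i ∈ maximalIdeal A := fun i => hs ▸ Ideal.subset_span ⟨i, rfl⟩
  have hmem : a ∈ (idealOfVars (Fin d) K ^ n).map (MvPolynomial.eval₂Hom k x) := by
    rwa [Ideal.map_pow, map_idealOfVars, hs]
  -- Membership in `m ^ n` is carried through the induction because the error `(r - k c) * a` of the
  -- scalar step must land in `m * m ^ n`.
  suffices H : a ∈ maximalIdeal A ^ n ∧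
      ∃ F : MvPolynomial (Fin d) K, a - F.eval₂Hom k x ∈ maximalIdeal A ^ (n + 1) from H.2
  refine Submodule.span_induction ?_ ?_ ?_ ?_ hmem
  · rintro _ ⟨F, hF, rfl⟩
    exact ⟨eval_mem_pow hx hF, F, by simp⟩
  · exact ⟨zero_mem _, 0, by simp⟩
  · rintro a b _ _ ⟨ha, F, hF⟩ ⟨hb, G, hG⟩
    refine ⟨add_mem ha hb, F + G, ?_⟩
    rw [map_add, add_sub_add_comm]
    exact add_mem hF hG
  · rintro r a _ ⟨ha, F, hF⟩
    obtain ⟨c, hc⟩ := hr r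
    refine ⟨Ideal.mul_mem_left _ _ ha, MvPolynomial.C c * F, ?_⟩
    have : r • a - MvPolynomial.eval₂Hom k x (MvPolynomial.C c * F) =
        (r - k c) * a + k c * (a - F.eval₂Hom k x) := by
      simp only [smul_eq_mul, map_mul, MvPolynomial.coe_eval₂Hom, MvPolynomial.eval₂_C]
      ring
    rw [this]
    refine add_mem ?_ (Ideal.mul_mem_left _ _ hF)
    rw [pow_succ']
    exact Ideal.mul_mem_mul hc ha

theorem exists_eval_sub_mem_pow (hs : Ideal.span (Set.range x) = maximalIdeal A)
    (hr : ∀ a : A, ∃ c : K, a - k c ∈ maximalIdeal A) (n : ℕ) (a : A) :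
    ∃ F : MvPolynomial (Fin d) K, a - F.eval₂Hom k x ∈ maximalIdeal A ^ n := by
  induction n with
  | zero => exact ⟨0, by simp⟩
  | succ n ih =>
    obtain ⟨F, hF⟩ := ih
    obtain ⟨G, hG⟩ := exists_eval_sub_mem_pow_succ hs hr n hF
    exact ⟨F + G, by rwa [map_add, ← sub_sub]⟩

theorem IsCoord.mem (h : IsCoord k x) (i : Fin d) : x i ∈ maximalIdeal A :=
  h.span ▸ Ideal.subset_span ⟨i, rfl⟩

/-- The map `K[X]/(X)^n → A/m^n` induced by parameters. -/
def coordQuot (h : IsCoord k x) (n : ℕ) :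
    MvPolynomial (Fin d) K ⧸ idealOfVars (Fin d) K ^ n →+* A ⧸ maximalIdeal A ^ n :=
  Ideal.quotientMap _ (MvPolynomial.eval₂Hom k x) fun _ hF => eval_mem_pow h.mem hF

@[simp]
theorem coordQuot_mk (h : IsCoord k x) (n : ℕ) (F : MvPolynomial (Fin d) K) :
    coordQuot h n (Ideal.Quotient.mk _ F) = Ideal.Quotient.mk _ (F.eval₂Hom k x) :=
  rfl

theorem coordQuot_injective (h : IsCoord k x) (n : ℕ) : Function.Injective (coordQuot h n) :=
  Ideal.quotientMap_injective' fun F hF => h.indep n F hF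

/-- The Cohen structure theorem with a given coefficient field: evaluation at `x` is bijective from
`K[X]/(X)^n` to `A/m^n` for every `n`, injective by `indep` and surjective by successive
approximation, and one passes to the limit. -/
theorem exists_ringEquiv_mvPowerSeries [IsAdicComplete (maximalIdeal A) A] (h : IsCoord k x) :
    ∃ Θ : MvPowerSeries (Fin d) K ≃+* A,
      (∀ c, Θ (MvPowerSeries.C c) = k c) ∧ ∀ i, Θ (MvPowerSeries.X i) = x i := by
  let g (n : ℕ) : AdicCompletion (idealOfVars (Fin d) K) (MvPolynomial (Fin d) K) →+* A ⧸ maximalIdeal A ^ n :=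
    (coordQuot h n).comp (AdicCompletion.evalₐ (idealOfVars (Fin d) K) n : _ →+* _)
  have hg : ∀ {a b : ℕ} (hab : a ≤ b),
      (Ideal.Quotient.factorPow (maximalIdeal A) hab).comp (g b) = g a := by
    intro a b hab
    ext z
    obtain ⟨r, rfl⟩ := AdicCompletion.mk_surjective (idealOfVars (Fin d) K) _ z
    simp only [g, RingHom.comp_apply, RingHom.coe_coe, AdicCompletion.evalₐ_mk, coordQuot_mk]
    have h1 := Ideal.Quotient.eq.mp (AdicCompletion.Ideal.mk_eq_mk (idealOfVars (Fin d) K) hab r)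
    refine Ideal.Quotient.eq.mpr ?_
    rw [← map_sub]
    exact eval_mem_pow h.mem h1
  let Ψ := IsAdicComplete.liftRingHom (maximalIdeal A) g hg
  have hΨ : ∀ n z, Ideal.Quotient.mk (maximalIdeal A ^ n) (Ψ z) = g n z :=
    fun n z => IsAdicComplete.mk_liftRingHom _ _ _ n z
  have hof : ∀ F : MvPolynomial (Fin d) K,
      Ψ (AdicCompletion.of (idealOfVars (Fin d) K) _ F) = MvPolynomial.eval₂Hom k x F := by
    intro F
    refine IsHausdorff.eq_iff_smodEq (I := maximalIdeal A) |>.mpr fun n => ?_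
    rw [SModEq.sub_mem, smul_eq_mul, Ideal.mul_top, ← Ideal.Quotient.eq, hΨ]
    simp only [g, RingHom.comp_apply, RingHom.coe_coe, AdicCompletion.evalₐ_of, coordQuot_mk]
  have hinj : Function.Injective Ψ := by
    rw [injective_iff_map_eq_zero]
    intro z hz
    refine AdicCompletion.ext_evalₐ fun n => coordQuot_injective h n ?_
    have := hΨ n z
    rw [hz, map_zero] at this
    simpa [g] using this.symm
  have hsurj : Function.Surjective Ψ := by
    intro a
    choose F hF using fun n => exists_eval_sub_mem_pow h.span h.residue n a
    have hc : ∀ n, F n ≡ F (n + 1) 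
        [SMOD (idealOfVars (Fin d) K ^ n • ⊤ : Submodule (MvPolynomial (Fin d) K) _)] := by
      intro n
      rw [SModEq.sub_mem, smul_eq_mul, Ideal.mul_top]
      -- Closeness of the values `F n (x)` implies closeness of the polynomials, so the
      -- approximations form a Cauchy sequence.
      refine h.indep n _ ?_
      rw [map_sub]
      have := sub_mem (Ideal.pow_le_pow_right (Nat.le_succ n) (hF (n + 1))) (hF n)
      rwa [sub_sub_sub_cancel_left] at this
    refine ⟨AdicCompletion.mk (idealOfVars (Fin d) K) _
      (AdicCompletion.AdicCauchySequence.mk (idealOfVars (Fin d) K) _ F hc), ?_⟩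
    refine IsHausdorff.eq_iff_smodEq (I := maximalIdeal A) |>.mpr fun n => ?_
    rw [SModEq.sub_mem, smul_eq_mul, Ideal.mul_top, ← Ideal.Quotient.eq, hΨ]
    simp only [g, RingHom.comp_apply, RingHom.coe_coe, AdicCompletion.evalₐ_mk, coordQuot_mk]
    refine Ideal.Quotient.eq.mpr ?_
    rw [← neg_sub]
    exact neg_mem (hF n)
  refine ⟨(MvPowerSeries.toAdicCompletionAlgEquiv (Fin d) K).toRingEquiv.trans
    (RingEquiv.ofBijective Ψ ⟨hinj, hsurj⟩), fun c => ?_, fun i => ?_⟩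
  · have := hof (MvPolynomial.C c)
    rw [← MvPowerSeries.toAdicCompletion_coe] at this
    simp only [MvPolynomial.coe_C, MvPolynomial.coe_eval₂Hom, MvPolynomial.eval₂_C] at this
    exact this
  · have := hof (MvPolynomial.X i)
    rw [← MvPowerSeries.toAdicCompletion_coe] at this
    simp only [MvPolynomial.coe_X, MvPolynomial.coe_eval₂Hom, MvPolynomial.eval₂_X] at this
    exact this

/-- Local homomorphisms to a separated local ring which agree on constants and parameters are
equal. -/
theorem ringHom_ext_of_coord (hs : Ideal.span (Set.range x) = maximalIdeal A)
    (hr : ∀ a : A, ∃ c : K, a - k c ∈ maximalIdeal A) {B : Type*} [CommRing B] [IsLocalRing B]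
    [IsHausdorff (maximalIdeal B) B] (f g : A →+* B) [IsLocalHom f] [IsLocalHom g]
    (hk : ∀ c, f (k c) = g (k c)) (hx : ∀ i, f (x i) = g (x i)) : f = g := by
  ext a
  refine IsHausdorff.eq_iff_smodEq (I := maximalIdeal B) |>.mpr fun n => ?_
  rw [SModEq.sub_mem, smul_eq_mul, Ideal.mul_top]
  obtain ⟨F, hF⟩ := exists_eval_sub_mem_pow hs hr n a
  have hmap : ∀ (φ : A →+* B) [IsLocalHom φ], φ (a - F.eval₂Hom k x) ∈ maximalIdeal B ^ n := by
    intro φ _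
    have := Ideal.mem_map_of_mem φ hF
    rw [Ideal.map_pow] at this
    exact Ideal.pow_right_mono (((local_hom_TFAE φ).out 0 2).mp ‹_›) n this
  have he : f (F.eval₂Hom k x) = g (F.eval₂Hom k x) := by
    have : f.comp (MvPolynomial.eval₂Hom k x) = g.comp (MvPolynomial.eval₂Hom k x) :=
      MvPolynomial.ringHom_ext (by simpa using hk) (by simpa using hx)
    exact congrArg (fun φ => φ F) this
  have := sub_mem (hmap f) (hmap g)
  rwa [map_sub, map_sub, he, sub_sub_sub_cancel_right] at this

/-- A second set of `d` generators of the maximal ideal is again a coordinate system. -/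
theorem IsCoord.of_span (h : IsCoord k x) {z : Fin d → A}
    (hz : Ideal.span (Set.range z) = maximalIdeal A) : IsCoord k z where
  span := hz
  residue := h.residue
  indep := by
    intro n
    have hzm : ∀ i, z i ∈ maximalIdeal A := fun i => hz ▸ Ideal.subset_span ⟨i, rfl⟩
    set I := idealOfVars (Fin d) K
    let qx := coordQuot h n
    have hqx : Function.Bijective qx := ⟨coordQuot_injective h n, by
      intro a
      obtain ⟨a, rfl⟩ := Ideal.Quotient.mk_surjective a
      obtain ⟨F, hF⟩ := exists_eval_sub_mem_pow h.span h.residue n a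
      refine ⟨Ideal.Quotient.mk _ F, ?_⟩
      simp only [qx, coordQuot_mk]
      exact (Ideal.Quotient.eq.mpr hF).symm⟩
    let qz : MvPolynomial (Fin d) K ⧸ I ^ n →+* A ⧸ maximalIdeal A ^ n :=
      Ideal.quotientMap _ (MvPolynomial.eval₂Hom k z) fun _ hF => eval_mem_pow hzm hF
    have hqz : Function.Surjective qz := by
      intro a
      obtain ⟨a, rfl⟩ := Ideal.Quotient.mk_surjective a
      obtain ⟨F, hF⟩ := exists_eval_sub_mem_pow hz h.residue n a
      refine ⟨Ideal.Quotient.mk _ F, ?_⟩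
      exact (Ideal.Quotient.eq.mpr hF).symm
    let e := RingEquiv.ofBijective qx hqx
    -- Comparing the two evaluations gives a surjective endomorphism of the noetherian ring
    -- `K[X]/(X)^n`, which must be injective.
    have hinj : Function.Injective (e.symm.toRingHom.comp qz) :=
      injective_of_surjective_of_isNoetherianRing _ (e.symm.surjective.comp hqz)
    intro F hF
    rw [← Ideal.Quotient.eq_zero_iff_mem]
    refine hinj ?_
    rw [map_zero, RingHom.comp_apply]
    have : qz (Ideal.Quotient.mk _ F) = 0 := Ideal.Quotient.eq_zero_iff_mem.mpr hF
    rw [this, map_zero]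

/-! #### Linear parts -/

/-- The value at the closed point and the linear part, in terms of the parameters `x`, of the
elements of `A`. -/
structure Jet {K A : Type*} [Field K] [CommRing A] [IsLocalRing A] {d : ℕ} (k : K →+* A)
    (x : Fin d → A) where
  res : A →+* K
  lin : A →+ (Fin d → K)
  res_const : ∀ c, res (k c) = c
  lin_const : ∀ c, lin (k c) = 0
  lin_coord : ∀ i, lin (x i) = Pi.single i 1
  lin_mul : ∀ a b, lin (a * b) = res a • lin b + res b • lin a
  mem_iff : ∀ a, a ∈ maximalIdeal A ↔ res a = 0

theorem isUnit_iff_constantCoeff_ne_zero {σ : Type*} (f : MvPowerSeries σ K) :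
    IsUnit f ↔ MvPowerSeries.constantCoeff f ≠ 0 := by
  rw [MvPowerSeries.isUnit_iff_constantCoeff, isUnit_iff_ne_zero]

/-- In power series coordinates these are the constant coefficients of the element and of its
partial derivatives. -/
theorem IsCoord.nonempty_jet [IsAdicComplete (maximalIdeal A) A] (h : IsCoord k x) :
    Nonempty (Jet k x) := by
  obtain ⟨Θ, hc, hX⟩ := exists_ringEquiv_mvPowerSeries h
  have hc' : ∀ c, Θ.symm (k c) = MvPowerSeries.C c := fun c => by rw [← hc, Θ.symm_apply_apply]
  have hX' : ∀ i, Θ.symm (x i) = MvPowerSeries.X i := fun i => by rw [← hX, Θ.symm_apply_apply]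
  refine ⟨⟨MvPowerSeries.constantCoeff.comp Θ.symm.toRingHom,
    AddMonoidHom.comp
      { toFun := fun f i => MvPowerSeries.constantCoeff (MvPowerSeries.pderiv K i f)
        map_zero' := by ext; simp
        map_add' := by intros; ext; simp } Θ.symm.toRingHom.toAddMonoidHom,
      ?_, ?_, ?_, ?_, ?_⟩⟩
  · intro c
    simp [hc']
  · intro c
    ext i
    simp [hc']
  · intro i
    ext j
    simp only [AddMonoidHom.comp_apply, RingHom.toAddMonoidHom_eq_coe, AddMonoidHom.coe_coe,
      RingEquiv.toRingHom_eq_coe, RingHom.coe_coe, hX', AddMonoidHom.coe_mk, ZeroHom.coe_mk,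
      MvPowerSeries.pderiv_X, Pi.single_apply]
    split_ifs <;> simp_all
  · intro a b
    ext i
    simp
  · intro a
    rw [mem_maximalIdeal, mem_nonunits_iff, ← MulEquiv.isUnit_map Θ.symm,
      isUnit_iff_constantCoeff_ne_zero, not_not]
    rfl

namespace Jet

variable (J : Jet k x)
include J

theorem isUnit_iff (a : A) : IsUnit a ↔ J.res a ≠ 0 := by
  rw [ne_eq, ← J.mem_iff, mem_maximalIdeal, mem_nonunits_iff, not_not]

theorem sub_const_mem (a : A) : a - k (J.res a) ∈ maximalIdeal A := by
  rw [J.mem_iff, map_sub, J.res_const, sub_self]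

theorem lin_const_mul (c : K) (a : A) : J.lin (k c * a) = c • J.lin a := by
  rw [J.lin_mul, J.lin_const, smul_zero, add_zero, J.res_const]

theorem lin_sub_const (c : K) (a : A) : J.lin (a - k c) = J.lin a := by
  rw [map_sub, J.lin_const, sub_zero]

/-- If `a = ∑ c_i x_i`, the `i`-th entry of the linear part is the residue of `c_i`; its vanishing
puts `c_i` in `m`. -/
theorem mem_sq_of_lin_eq_zero (h : IsCoord k x) {a : A} (ha : a ∈ maximalIdeal A)
    (hl : J.lin a = 0) : a ∈ maximalIdeal A ^ 2 := by
  rw [← h.span, Ideal.mem_span_range_iff_exists_fun] at ha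
  obtain ⟨c, rfl⟩ := ha
  refine sum_mem fun i _ => ?_
  rw [pow_two]
  refine Ideal.mul_mem_mul ((J.mem_iff _).mpr ?_) (h.mem i)
  rw [map_sum] at hl
  have h1 := congrFun hl i
  simp only [Finset.sum_apply, J.lin_mul, J.lin_coord, (J.mem_iff _).mp (h.mem _), zero_smul,
    add_zero, Pi.smul_apply, Pi.single_apply, smul_eq_mul, mul_ite, mul_one, mul_zero,
    Finset.sum_ite_eq, Finset.mem_univ, if_true, Pi.zero_apply] at h1
  exact h1

/-- Formal inverse function theorem: `d` elements of the maximal ideal with independent linear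
parts generate it. -/
theorem span_eq (h : IsCoord k x) {z : Fin d → A} (hz : ∀ i, z i ∈ maximalIdeal A)
    (hl : LinearIndependent K fun i => J.lin (z i)) :
    Ideal.span (Set.range z) = maximalIdeal A := by
  refine le_antisymm (Ideal.span_le.mpr (Set.range_subset_iff.mpr hz)) ?_
  have hfg : (maximalIdeal A).FG := by
    rw [← h.span]
    exact Submodule.fg_span (Set.finite_range x)
  -- Nakayama: it is enough that `m` is contained in `(z) + m ^ 2`, and this holds because `d`
  -- independent linear parts span `K ^ d`.
  refine Submodule.le_of_le_smul_of_le_jacobson_bot hfg (jacobson_eq_maximalIdeal ⊥ bot_ne_top).ge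
    fun a ha => ?_
  have htop : Submodule.span K (Set.range fun i => J.lin (z i)) = ⊤ :=
    hl.span_eq_top_of_card_eq_finrank' (by simp)
  have hmem : J.lin a ∈ Submodule.span K (Set.range fun i => J.lin (z i)) := htop ▸ trivial
  obtain ⟨c, hc⟩ := (Submodule.mem_span_range_iff_exists_fun K).mp hmem
  have hz' : ∑ i, k (c i) * z i ∈ Ideal.span (Set.range z) :=
    sum_mem fun i _ => Ideal.mul_mem_left _ _ (Ideal.subset_span ⟨i, rfl⟩)
  rw [← add_sub_cancel (∑ i, k (c i) * z i) a]
  refine Submodule.add_mem_sup hz' ?_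
  rw [smul_eq_mul, ← pow_two]
  refine J.mem_sq_of_lin_eq_zero h (sub_mem ha ?_) ?_
  · exact Ideal.span_le.mpr (Set.range_subset_iff.mpr hz) hz'
  · rw [map_sub, map_sum, ← hc, sub_eq_zero]
    exact Finset.sum_congr rfl fun i _ => (J.lin_const_mul _ _).symm

theorem lin_eq_zero_of_mem_sq {a : A} (ha : a ∈ maximalIdeal A ^ 2) : J.lin a = 0 := by
  rw [pow_two] at ha
  refine Submodule.mul_induction_on ha (fun a ha b hb => ?_) fun a b ha hb => ?_
  · rw [J.lin_mul, (J.mem_iff _).mp ha, (J.mem_iff _).mp hb, zero_smul, zero_smul, add_zero]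
  · rw [map_add, ha, hb, add_zero]

/-- The logarithmic linear part of units, a homomorphism. -/
def dlog : Additive Aˣ →+ (Fin d → K) where
  toFun u := (J.res (Additive.toMul u : Aˣ))⁻¹ • J.lin (Additive.toMul u : Aˣ)
  map_zero' := by
    have := J.lin_const 1
    rw [map_one] at this
    simp [this]
  map_add' u v := by
    have hu := (J.isUnit_iff _).mp (Additive.toMul u).isUnit
    have hv := (J.isUnit_iff _).mp (Additive.toMul v).isUnit
    ext i
    simp only [toMul_add, Units.val_mul, J.lin_mul, map_mul, Pi.smul_apply, Pi.add_apply,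
      smul_eq_mul]
    field_simp
    ring

theorem lin_unit (u : Aˣ) : J.lin u = J.res u • J.dlog (Additive.ofMul u) := by
  simp only [dlog, AddMonoidHom.coe_mk, ZeroHom.coe_mk, toMul_ofMul]
  rw [smul_smul, mul_inv_cancel₀ ((J.isUnit_iff _).mp u.isUnit), one_smul]

end Jet

/-! #### Divisibility by monomials -/

theorem IsCoord.isDomain [IsAdicComplete (maximalIdeal A) A] (h : IsCoord k x) : IsDomain A := by
  obtain ⟨Θ, -, -⟩ := exists_ringEquiv_mvPowerSeries h
  have := NoZeroDivisors.to_isDomain (MvPowerSeries (Fin d) K)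
  exact Θ.symm.toMulEquiv.isDomain _

/-- Give `X i` weight one and the other variables weight zero. Divisibility by `X i` means positive
weighted order, and the weighted order is additive on products. -/
theorem MvPowerSeries.prime_X {σ : Type*} [DecidableEq σ] (i : σ) :
    Prime (MvPowerSeries.X i : MvPowerSeries σ K) := by
  have hdvd : ∀ f : MvPowerSeries σ K, MvPowerSeries.X i ∣ f ↔
      f.weightedOrder (Pi.single i 1) ≠ 0 := by
    intro f
    have hw : ∀ m : σ →₀ ℕ, Finsupp.weight (Pi.single i 1 : σ → ℕ) m = m i := by
      intro m
      rw [Finsupp.weight_apply, Finsupp.sum]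
      simp only [Pi.single_apply, smul_eq_mul, mul_ite, mul_one, mul_zero, Finset.sum_ite_eq',
        Finsupp.mem_support_iff]
      split_ifs with h0 <;> simp_all
    rw [MvPowerSeries.X_dvd_iff, ← Order.one_le_iff_ne_zero]
    constructor
    · intro H
      refine MvPowerSeries.le_weightedOrder (n := 1) _ fun m hm => H m ?_
      rw [hw] at hm
      exact Nat.lt_one_iff.mp (by exact_mod_cast hm)
    · intro H m hm
      refine MvPowerSeries.coeff_eq_zero_of_lt_weightedOrder (w := Pi.single i 1) ?_
      rw [hw, hm]
      exact lt_of_lt_of_le (by norm_num) H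
  refine ⟨fun h0 => ?_, fun hu => ?_, fun a b hab => ?_⟩
  · have := congrArg (MvPowerSeries.coeff (Finsupp.single i 1)) h0
    simp [MvPowerSeries.coeff_X] at this
  · rw [MvPowerSeries.isUnit_iff_constantCoeff] at hu
    simp at hu
  · rw [hdvd, MvPowerSeries.weightedOrder_mul] at hab
    rw [hdvd, hdvd]
    by_contra! H
    exact hab (by rw [H.1, H.2, add_zero])

theorem IsCoord.prime [IsAdicComplete (maximalIdeal A) A] (h : IsCoord k x) (i : Fin d) :
    Prime (x i) := by
  obtain ⟨Θ, -, hX⟩ := exists_ringEquiv_mvPowerSeries h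
  rw [← hX]
  exact (MulEquiv.prime_iff Θ.toMulEquiv).mpr (MvPowerSeries.prime_X i)

/-- The linear part of `x i * a` is a multiple of the `i`-th unit vector, since `x i` has residue
zero. -/
theorem IsCoord.not_dvd [IsAdicComplete (maximalIdeal A) A] (h : IsCoord k x) {i j : Fin d}
    (hij : i ≠ j) : ¬ x i ∣ x j := by
  rintro ⟨a, ha⟩
  obtain ⟨J⟩ := h.nonempty_jet
  have := congrFun (congrArg J.lin ha) j
  rw [J.lin_coord, J.lin_mul, J.lin_coord, (J.mem_iff _).mp (h.mem i)] at this
  simp [hij.symm] at this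

/-- Existence of roots of units. -/
theorem exists_pow_eq_unit [IsAlgClosed K] [CharZero K] [IsAdicComplete (maximalIdeal A) A]
    (J : Jet k x) {N : ℕ} (hN : N ≠ 0) (u : Aˣ) : ∃ v : Aˣ, v ^ N = u := by
  obtain ⟨c, hc⟩ := IsAlgClosed.exists_pow_nat_eq (J.res u) (Nat.pos_of_ne_zero hN)
  have hc0 : c ≠ 0 := by
    rintro rfl
    rw [zero_pow hN] at hc
    exact (J.isUnit_iff _).mp u.isUnit hc.symm
  -- Hensel's lemma for `X ^ N - u`, starting at an `N`-th root of the residue of `u`; the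
  -- derivative there is invertible because `N ≠ 0` in characteristic zero.
  obtain ⟨v, hv, -⟩ := HenselianRing.is_henselian (I := maximalIdeal A)
    (Polynomial.X ^ N - Polynomial.C (u : A))
    (Polynomial.monic_X_pow_sub_C _ hN) (k c)
    (by
      rw [J.mem_iff]
      simp [J.res_const, hc])
    (by
      refine IsUnit.map _ ((J.isUnit_iff _).mpr ?_)
      simp [Polynomial.derivative_X_pow, J.res_const, hN, hc0])
  have hv' : v ^ N = u := by
    simpa [Polynomial.IsRoot, sub_eq_zero] using hv
  have hvu : IsUnit v := (isUnit_pow_iff hN).mp (hv' ▸ u.isUnit)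
  exact ⟨hvu.unit, Units.ext (by simpa using hv')⟩

theorem sup_pow_le {R : Type*} [CommRing R] (I J : Ideal R) (n : ℕ) : (I ⊔ J) ^ n ≤ I ⊔ J ^ n := by
  have h : ((I ⊔ J) ^ n).map (Ideal.Quotient.mk I) = (J ^ n).map (Ideal.Quotient.mk I) := by
    rw [Ideal.map_pow, Ideal.map_pow, Ideal.map_sup, Ideal.map_quotient_self, bot_sup_eq]
  have h1 := Ideal.map_le_iff_le_comap.mp h.le
  rwa [Ideal.comap_map_of_surjective' _ Ideal.Quotient.mk_surjective, Ideal.mk_ker,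
    sup_comm (J ^ n)] at h1

theorem eval₂_mul_of_isHomogeneous {R S σ : Type*} [CommSemiring R] [CommSemiring S]
    [Fintype σ] (f : R →+* S) (g : σ → S) (t : S) {n : ℕ} {F : MvPolynomial σ R}
    (hF : F.IsHomogeneous n) :
    F.eval₂ f (fun i => g i * t) = F.eval₂ f g * t ^ n := by
  rw [MvPolynomial.eval₂_eq', MvPolynomial.eval₂_eq', Finset.sum_mul]
  refine Finset.sum_congr rfl fun m hm => ?_
  have hdeg : ∑ i, m i = n := by
    have := hF (MvPolynomial.mem_support_iff.mp hm)
    rw [← this, Finsupp.weight_apply, Finsupp.sum_fintype _ _ (by simp)]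
    simp
  simp only [mul_pow, Finset.prod_mul_distrib, Finset.prod_pow_eq_pow_sum, hdeg, mul_assoc]

/-- In a local ring whose dimension is at least the number `d` of the generators `x` of the maximal
ideal, a form of degree `n` whose value at `x` lies in `m ^ (n + 1)` is zero. -/
theorem homogeneous_eq_zero [Infinite K] [IsNoetherianRing A]
    (hs : Ideal.span (Set.range x) = maximalIdeal A) (hd : (d : WithBot ℕ∞) ≤ ringKrullDim A)
    {n : ℕ} {F : MvPolynomial (Fin d) K} (hF : F.IsHomogeneous n)
    (hm : F.eval₂Hom k x ∈ maximalIdeal A ^ (n + 1)) : F = 0 := by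
  classical
  have hx : ∀ i, x i ∈ maximalIdeal A := fun i => hs ▸ Ideal.subset_span ⟨i, rfl⟩
  have hk : ∀ c : K, k c ∈ maximalIdeal A → c = 0 := fun c hc => by
    by_contra h0
    exact (mem_nonunits_iff.mp ((mem_maximalIdeal _).mp hc)) ((IsUnit.mk0 c h0).map k)
  by_contra hF0
  -- A nonzero form over an infinite field has a point `c` where it does not vanish. The point `c =
  -- 0` can occur only in degree zero, which is handled separately.
  obtain ⟨c, hc⟩ : ∃ c : Fin d → K, MvPolynomial.eval c F ≠ 0 := by
    by_contra! H
    exact hF0 (MvPolynomial.funext fun c => by rw [H c, map_zero])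
  by_cases hc0 : ∀ j, c j = 0
  · have hc0' : c = fun i => c i * 0 := by
      ext i
      simp [hc0 i]
    have h1 : MvPolynomial.eval c F = MvPolynomial.eval c F * 0 ^ n := by
      conv_lhs => rw [hc0']
      exact eval₂_mul_of_isHomogeneous (RingHom.id K) c 0 hF
    have hn : n = 0 := by
      by_contra hn
      rw [zero_pow hn, mul_zero] at h1
      exact hc h1
    subst hn
    have hFC : F = MvPolynomial.C (F.coeff 0) :=
      MvPolynomial.totalDegree_eq_zero_iff_eq_C.mp (hF.totalDegree hF0)
    rw [hFC] at hm hF0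
    simp only [MvPolynomial.coe_eval₂Hom, MvPolynomial.eval₂_C, zero_add, pow_one] at hm
    exact hF0 (by rw [hk _ hm, map_zero])
  push Not at hc0
  obtain ⟨j, hj⟩ := hc0
  -- Scale the point so that its `j`-th coordinate is one. The ideal `J` of the `d - 1` elements
  -- `x_i - g_i x_j` then satisfies `m = J + (x_j)`, and modulo `J` the value `F(x)` is `F(g) x_j ^
  -- n`.
  set g : Fin d → K := fun i => c i / c j with hg
  have hgF : MvPolynomial.eval g F ≠ 0 := by
    have h1 := eval₂_mul_of_isHomogeneous (RingHom.id K) g (c j) hF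
    have h2 : (fun i => g i * c j) = c := by
      ext i
      simp [hg, hj]
    rw [h2] at h1
    intro h0
    refine hc ?_
    change MvPolynomial.eval₂ (RingHom.id K) c F = 0
    rw [h1]
    change MvPolynomial.eval g F * _ = 0
    rw [h0, zero_mul]
  set s : Finset A := (Finset.univ.erase j).image fun i => x i - k (g i) * x j with hsdef
  set J : Ideal A := Ideal.span (s : Set A) with hJ
  have hJm : J ≤ maximalIdeal A := by
    refine Ideal.span_le.mpr fun a ha => ?_
    obtain ⟨i, -, rfl⟩ := Finset.mem_image.mp (Finset.mem_coe.mp ha)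
    exact sub_mem (hx i) (Ideal.mul_mem_left _ _ (hx j))
  have hxJ : ∀ i, x i - k (g i) * x j ∈ J := by
    intro i
    by_cases hij : i = j
    · subst hij
      simp [hg, hj]
    · exact Ideal.subset_span (Finset.mem_coe.mpr
        (Finset.mem_image_of_mem _ (Finset.mem_erase.mpr ⟨hij, Finset.mem_univ i⟩)))
  have hmJ : maximalIdeal A = J ⊔ Ideal.span {x j} := by
    refine le_antisymm ?_ (sup_le hJm ((Ideal.span_singleton_le_iff_mem _).mpr (hx j)))
    rw [← hs, Ideal.span_le]
    rintro _ ⟨i, rfl⟩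
    rw [← sub_add_cancel (x i) (k (g i) * x j)]
    exact Submodule.add_mem_sup (hxJ i)
      (Ideal.mul_mem_left _ _ (Ideal.mem_span_singleton_self _))
  have hval : F.eval₂Hom k x - k (MvPolynomial.eval g F) * x j ^ n ∈ J := by
    rw [← Ideal.Quotient.eq]
    have h1 : (Ideal.Quotient.mk J).comp (MvPolynomial.eval₂Hom k x) =
        MvPolynomial.eval₂Hom ((Ideal.Quotient.mk J).comp k)
          (fun i => Ideal.Quotient.mk J (k (g i)) * Ideal.Quotient.mk J (x j)) := by
      refine MvPolynomial.ringHom_ext (by simp) fun i => ?_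
      simp only [RingHom.comp_apply, MvPolynomial.coe_eval₂Hom, MvPolynomial.eval₂_X]
      rw [← map_mul]
      exact Ideal.Quotient.eq.mpr (hxJ i)
    have h2 : MvPolynomial.eval₂ ((Ideal.Quotient.mk J).comp k)
        (fun i => Ideal.Quotient.mk J (k (g i))) F =
          Ideal.Quotient.mk J (k (MvPolynomial.eval g F)) := by
      have := MvPolynomial.eval₂_comp_left ((Ideal.Quotient.mk J).comp k) (RingHom.id K) g F
      exact this.symm
    have h3 := congrArg (fun φ => φ F) h1
    simp only [RingHom.comp_apply, MvPolynomial.coe_eval₂Hom] at h3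
    rw [eval₂_mul_of_isHomogeneous _ _ _ hF, h2] at h3
    simpa using h3
  have hpow : maximalIdeal A ^ (n + 1) ≤ J ⊔ Ideal.span {x j ^ (n + 1)} := by
    rw [hmJ, ← Ideal.span_singleton_pow]
    exact sup_pow_le J _ (n + 1)
  -- As `F(x)` lies in `m ^ (n + 1) ⊆ J + (x_j ^ (n + 1))`, some `(F(g) - r x_j) x_j ^ n` lies in
  -- `J`, and the factor is a unit since `F(g) ≠ 0`.
  have hxn : x j ^ n ∈ J := by
    obtain ⟨b, hb, r, hr, hbr⟩ := Submodule.mem_sup.mp (hpow hm)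
    obtain ⟨r, rfl⟩ := Ideal.mem_span_singleton'.mp hr
    have h1 : (k (MvPolynomial.eval g F) - r * x j) * x j ^ n ∈ J := by
      have : (k (MvPolynomial.eval g F) - r * x j) * x j ^ n =
          b - (F.eval₂Hom k x - k (MvPolynomial.eval g F) * x j ^ n) := by
        rw [← hbr]
        ring
      rw [this]
      exact sub_mem hb hval
    refine (Ideal.unit_mul_mem_iff_mem J ?_).mp h1
    by_contra hu
    have hmem : k (MvPolynomial.eval g F) - r * x j ∈ maximalIdeal A :=
      (mem_maximalIdeal _).mpr hu
    exact hgF (hk _ ((Submodule.sub_mem_iff_left _ (Ideal.mul_mem_left _ _ (hx j))).mp hmem))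
  -- Hence `m` is minimal over an ideal with at most `d - 1` generators, and Krull's height theorem
  -- contradicts the bound on the dimension.
  have hmin : maximalIdeal A ∈ J.minimalPrimes := by
    refine ⟨⟨inferInstance, hJm⟩, fun q ⟨hq, hJq⟩ _ => ?_⟩
    rw [hmJ]
    refine sup_le hJq ((Ideal.span_singleton_le_iff_mem _).mpr ?_)
    exact hq.mem_of_pow_mem n (hJq hxn)
  have hht := Ideal.height_le_card_of_mem_minimalPrimes_span_finset hmin
  rw [← maximalIdeal_height_eq_ringKrullDim] at hd
  have hcard : s.card < d := by
    have : s.card ≤ (Finset.univ.erase j).card := Finset.card_image_le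
    rw [Finset.card_erase_of_mem (Finset.mem_univ j), Finset.card_univ, Fintype.card_fin] at this
    have := j.pos
    omega
  have hd' : (d : ℕ∞) ≤ (maximalIdeal A).height := by exact_mod_cast hd
  have : (d : ℕ∞) ≤ s.card := hd'.trans hht
  exact absurd (Nat.cast_le.mp this) (not_le.mpr hcard)

/-- The associated graded ring is a polynomial ring: if `F` is already in `(X) ^ j`, its form of
degree `j` takes a value in `m ^ (j + 1)` and vanishes by `homogeneous_eq_zero`. -/
theorem IsCoord.of_ringKrullDim_le [Infinite K] [IsNoetherianRing A]
    (hs : Ideal.span (Set.range x) = maximalIdeal A)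
    (hr : ∀ a : A, ∃ c : K, a - k c ∈ maximalIdeal A) (hd : (d : WithBot ℕ∞) ≤ ringKrullDim A) :
    IsCoord k x where
  span := hs
  residue := hr
  indep := by
    have hx : ∀ i, x i ∈ maximalIdeal A := fun i => hs ▸ Ideal.subset_span ⟨i, rfl⟩
    intro n F hF
    suffices H : ∀ j ≤ n, F ∈ idealOfVars (Fin d) K ^ j from H n le_rfl
    intro j
    induction j with
    | zero => simp
    | succ j ih =>
      intro hj
      have hFj := ih (Nat.le_of_succ_le hj)
      have hsub : F - F.homogeneousComponent j ∈ idealOfVars (Fin d) K ^ (j + 1) := by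
        rw [MvPolynomial.mem_pow_idealOfVars_iff'] at hFj ⊢
        intro m hm
        rw [MvPolynomial.coeff_sub, MvPolynomial.coeff_homogeneousComponent]
        split_ifs with h
        · rw [sub_self]
        · rw [sub_zero]
          exact hFj m (lt_of_le_of_ne (Nat.lt_succ_iff.mp hm) h)
      have hG : (F.homogeneousComponent j).eval₂Hom k x ∈ maximalIdeal A ^ (j + 1) := by
        have := sub_mem (Ideal.pow_le_pow_right hj hF) (eval_mem_pow (k := k) hx hsub)
        rwa [← map_sub, sub_sub_cancel] at this
      rw [homogeneous_eq_zero hs hd (F.homogeneousComponent_isHomogeneous j) hG, sub_zero] at hsub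
      exact hsub

end Local

end Coordinates

/-! ### Coordinates on a completion -/

section Completed

variable {K R : Type*} [Field K] [CommRing R] [IsLocalRing R] [IsNoetherianRing R] {d : ℕ}
  {k : K →+* R} {x : Fin d → R}

theorem evalₐ_eq_zero_of_mem_pow {n : ℕ} {a : AdicCompletion (maximalIdeal R) R}
    (ha : a ∈ maximalIdeal (AdicCompletion (maximalIdeal R) R) ^ n) :
    AdicCompletion.evalₐ (maximalIdeal R) n a = 0 := by
  rw [AdicCompletion.maximalIdeal_eq_map, ← Ideal.map_pow] at ha
  have h : (maximalIdeal R ^ n).map (algebraMap R (AdicCompletion (maximalIdeal R) R)) ≤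
      RingHom.ker (AdicCompletion.evalₐ (maximalIdeal R) n) := by
    refine Ideal.map_le_iff_le_comap.mpr fun r hr => ?_
    rw [Ideal.mem_comap, RingHom.mem_ker, AlgHom.commutes]
    exact Ideal.Quotient.eq_zero_iff_mem.mpr hr
  exact h ha

theorem algebraMap_mem_pow_iff {n : ℕ} {r : R} :
    algebraMap R (AdicCompletion (maximalIdeal R) R) r ∈
      maximalIdeal (AdicCompletion (maximalIdeal R) R) ^ n ↔ r ∈ maximalIdeal R ^ n := by
  constructor
  · intro h
    have := evalₐ_eq_zero_of_mem_pow h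
    rw [AlgHom.commutes] at this
    exact Ideal.Quotient.eq_zero_iff_mem.mp this
  · intro h
    rw [AdicCompletion.maximalIdeal_eq_map, ← Ideal.map_pow]
    exact Ideal.mem_map_of_mem _ h

theorem exists_sub_algebraMap_mem_pow (n : ℕ) (a : AdicCompletion (maximalIdeal R) R) :
    ∃ r : R, a - algebraMap R (AdicCompletion (maximalIdeal R) R) r ∈
      maximalIdeal (AdicCompletion (maximalIdeal R) R) ^ n := by
  obtain ⟨r, hr⟩ :=
    Submodule.Quotient.mk_surjective _ (AdicCompletion.eval (maximalIdeal R) R n a)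
  refine ⟨r, ?_⟩
  have h : a - AdicCompletion.of (maximalIdeal R) R r ∈
      LinearMap.ker (AdicCompletion.eval (maximalIdeal R) R n) := by
    rw [LinearMap.mem_ker, map_sub, AdicCompletion.eval_of, ← hr, sub_eq_zero]
    rfl
  rw [← AdicCompletion.pow_smul_top_eq_ker_eval (maximalIdeal R).fg_of_isNoetherianRing,
    Ideal.smul_top_eq_map, Submodule.restrictScalars_mem] at h
  rwa [AdicCompletion.maximalIdeal_eq_map, ← Ideal.map_pow]

theorem exists_sub_const_mem_completion (hr : ∀ a : R, ∃ c : K, a - k c ∈ maximalIdeal R)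
    (a : AdicCompletion (maximalIdeal R) R) :
    ∃ c : K, a - (algebraMap R (AdicCompletion (maximalIdeal R) R)).comp k c ∈
      maximalIdeal (AdicCompletion (maximalIdeal R) R) := by
  obtain ⟨r, h⟩ := exists_sub_algebraMap_mem_pow 1 a
  obtain ⟨c, hc⟩ := hr r
  refine ⟨c, ?_⟩
  rw [pow_one] at h
  rw [← pow_one (maximalIdeal R), ← algebraMap_mem_pow_iff, pow_one, map_sub] at hc
  simpa using add_mem h hc

theorem IsCoord.completion (h : IsCoord k x) :
    IsCoord ((algebraMap R (AdicCompletion (maximalIdeal R) R)).comp k)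
      (fun i => algebraMap R (AdicCompletion (maximalIdeal R) R) (x i)) where
  span := by
    rw [AdicCompletion.maximalIdeal_eq_map, ← h.span, Ideal.map_span, ← Set.range_comp]
    rfl
  residue := exists_sub_const_mem_completion h.residue
  indep n F hF := by
    refine h.indep n F ?_
    rw [← algebraMap_mem_pow_iff]
    convert hF using 1
    rw [← RingHom.comp_apply]
    have : (algebraMap R (AdicCompletion (maximalIdeal R) R)).comp (MvPolynomial.eval₂Hom k x) =
        MvPolynomial.eval₂Hom ((algebraMap R (AdicCompletion (maximalIdeal R) R)).comp k)
          (fun i => algebraMap R (AdicCompletion (maximalIdeal R) R) (x i)) :=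
      MvPolynomial.ringHom_ext (by simp) (by simp)
    rw [this]

theorem algebraMap_completion_injective :
    Function.Injective (algebraMap R (AdicCompletion (maximalIdeal R) R)) := by
  rw [injective_iff_map_eq_zero]
  intro r hr
  refine IsHausdorff.haus (I := maximalIdeal R) inferInstance r fun n => ?_
  rw [SModEq.zero, smul_eq_mul, Ideal.mul_top, ← algebraMap_mem_pow_iff, hr]
  exact zero_mem _

theorem IsCoord.isDomain_of_isNoetherianRing (h : IsCoord k x) : IsDomain R := by
  have := h.completion.isDomain
  exact algebraMap_completion_injective.isDomain (algebraMap R (AdicCompletion (maximalIdeal R) R))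

/-- In a local ring of dimension `d` whose maximal ideal is generated by `d` elements, these
elements are prime. -/
theorem prime_of_ringKrullDim_eq [Infinite K] (hs : Ideal.span (Set.range x) = maximalIdeal R)
    (hr : ∀ a : R, ∃ c : K, a - k c ∈ maximalIdeal R) (hd : (d : WithBot ℕ∞) ≤ ringKrullDim R)
    (i : Fin d) : Prime (x i) := by
  have hc := IsCoord.of_ringKrullDim_le hs hr hd
  obtain ⟨e, rfl⟩ : ∃ e, d = e + 1 := ⟨d - 1, by have := i.pos; omega⟩
  have hxi := hc.mem i
  have hne : Ideal.span {x i} ≠ ⊤ := by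
    rw [Ideal.ne_top_iff_one]
    intro h
    exact (Ideal.ne_top_iff_one _).mp (maximalIdeal.isMaximal R).ne_top
      ((Ideal.span_singleton_le_iff_mem _).mpr hxi h)
  have : Nontrivial (R ⧸ Ideal.span {x i}) := Ideal.Quotient.nontrivial_iff.mpr hne
  have : IsLocalRing (R ⧸ Ideal.span {x i}) :=
    IsLocalRing.of_surjective' (Ideal.Quotient.mk _) Ideal.Quotient.mk_surjective
  have hmap : maximalIdeal (R ⧸ Ideal.span {x i}) =
      (maximalIdeal R).map (Ideal.Quotient.mk (Ideal.span {x i})) :=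
    (IsLocalRing.map_maximalIdeal_of_surjective _ Ideal.Quotient.mk_surjective).symm
  -- The other `d - 1` parameters generate the maximal ideal of `R/(x_i)`, whose dimension is at
  -- least `d - 1`. So they are coordinates there, and the quotient is a domain.
  have hcoord : IsCoord ((Ideal.Quotient.mk (Ideal.span {x i})).comp k)
      (fun j : Fin e => Ideal.Quotient.mk (Ideal.span {x i}) (x (i.succAbove j))) := by
    refine IsCoord.of_ringKrullDim_le ?_ ?_ ?_
    · rw [hmap, ← hs, Ideal.map_span, ← Set.range_comp]
      refine le_antisymm (Ideal.span_mono ?_) (Ideal.span_le.mpr ?_)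
      · rintro _ ⟨j, rfl⟩
        exact ⟨i.succAbove j, rfl⟩
      · rintro _ ⟨j, rfl⟩
        rcases eq_or_ne j i with rfl | hj
        · have h0 : Ideal.Quotient.mk (Ideal.span {x j}) (x j) = 0 :=
            Ideal.Quotient.eq_zero_iff_mem.mpr (Ideal.mem_span_singleton_self _)
          rw [Function.comp_apply, h0]
          exact zero_mem _
        · obtain ⟨j, rfl⟩ := Fin.exists_succAbove_eq hj
          exact Ideal.subset_span ⟨j, rfl⟩
    · intro a
      obtain ⟨a, rfl⟩ := Ideal.Quotient.mk_surjective a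
      obtain ⟨c, hc⟩ := hr a
      refine ⟨c, ?_⟩
      rw [hmap, RingHom.comp_apply, ← map_sub]
      exact Ideal.mem_map_of_mem _ hc
    · have h1 := ringKrullDim_le_ringKrullDim_quotient_add_card (R := R) {x i} (by
        simpa [IsLocalRing.ringJacobson_eq_maximalIdeal] using hxi)
      rw [Finset.coe_singleton, Finset.card_singleton] at h1
      have h2 := hd.trans h1
      push_cast at h2
      exact (WithBot.add_le_add_iff_right' WithBot.one_ne_bot
        (WithBot.coe_injective.ne ENat.one_ne_top)).mp h2
  have := hcoord.isDomain_of_isNoetherianRing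
  refine (Ideal.span_singleton_prime ?_).mp ((Ideal.Quotient.isDomain_iff_prime _).mp this)
  intro h0
  have hj := hc.completion.prime i
  simp [h0] at hj

end Completed

/-! ### Monomials in primes -/

section Monomials

theorem not_dvd_prod_of_notMem {A : Type*} [CommRing A] {n : ℕ} {x : Fin n → A}
    (hp : ∀ i, Prime (x i)) (hne : ∀ i j, i ≠ j → ¬ x i ∣ x j)
    (i : Fin n) (s : Finset (Fin n)) (hi : i ∉ s) (b : Fin n → ℕ) : ¬ x i ∣ ∏ j ∈ s, x j ^ b j := by
  intro h
  obtain ⟨j, hj, hd⟩ := (hp i).exists_mem_finset_dvd h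
  exact hne i j (fun hij => hi (hij ▸ hj)) ((hp i).dvd_of_dvd_pow hd)

/-- A product of primes none of which divides another generates a radical ideal: each `x_i` divides
`a`, and they can be split off one at a time. -/
theorem prod_dvd_of_pow_mem {A : Type*} [CommRing A] {n : ℕ} {x : Fin n → A}
    (hp : ∀ i, Prime (x i)) (hne : ∀ i j, i ≠ j → ¬ x i ∣ x j) {a : A} {N : ℕ}
    (h : ∏ i, x i ∣ a ^ N) : ∏ i, x i ∣ a := by
  have hi : ∀ i, x i ∣ a := fun i =>
    (hp i).dvd_of_dvd_pow ((Finset.dvd_prod_of_mem x (Finset.mem_univ i)).trans h)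
  have H : ∀ s : Finset (Fin n), ∏ i ∈ s, x i ∣ a := by
    intro s
    induction s using Finset.induction_on with
    | empty => simp
    | insert i s his ih =>
      obtain ⟨c, hc⟩ := ih
      have hnd : ¬ x i ∣ ∏ j ∈ s, x j := by
        simpa using not_dvd_prod_of_notMem hp hne i s his fun _ => 1
      have h2 : x i ∣ (∏ j ∈ s, x j) * c := hc ▸ hi i
      obtain ⟨e, rfl⟩ := ((hp i).dvd_or_dvd h2).resolve_left hnd
      refine ⟨e, ?_⟩
      rw [Finset.prod_insert his, hc]
      ring
  exact H Finset.univ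

variable {A : Type*} [CommRing A] [IsDomain A] {n : ℕ} {x : Fin n → A}

/-- The power is a product of primes indexed by pairs of an index and a copy. A divisor takes a
subset of the pairs, up to a unit, and `b i` counts the copies of `x i` in it. -/
theorem exists_eq_unit_mul_prod_pow_of_dvd (hp : ∀ i, Prime (x i)) {N : ℕ} {a : A}
    (h : a ∣ (∏ i, x i) ^ N) : ∃ (u : Aˣ) (b : Fin n → ℕ), a = u * ∏ i, x i ^ b i := by
  obtain ⟨c, hc⟩ := h
  have h1 : a * c = 1 * ∏ q ∈ Finset.univ ×ˢ Finset.range N, x q.1 := by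
    rw [← hc, one_mul, Finset.prod_product, ← Finset.prod_pow]
    simp
  obtain ⟨t, s, v, w, -, -, hvw, ha, -⟩ := mul_eq_mul_prime_prod (fun q _ => hp q.1) h1
  refine ⟨Units.mkOfMulEqOne v w hvw.symm, fun i => (t.filter fun q => q.1 = i).card, ?_⟩
  rw [ha, Units.val_mkOfMulEqOne]
  congr 1
  rw [← Finset.prod_fiberwise_of_maps_to (g := Prod.fst) (t := Finset.univ) (by simp)]
  refine Finset.prod_congr rfl fun i _ => ?_
  rw [Finset.prod_congr rfl (g := fun _ => x i) (by
    intro q hq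
    rw [(Finset.mem_filter.mp hq).2]), Finset.prod_const]

theorem le_of_unit_mul_prod_pow_dvd (hp : ∀ i, Prime (x i))
    (hne : ∀ i j, i ≠ j → ¬ x i ∣ x j) {b c : Fin n → ℕ} (u v : Aˣ)
    (h : u * ∏ i, x i ^ b i ∣ v * ∏ i, x i ^ c i) : b ≤ c := by
  intro i
  rw [Units.mul_left_dvd, Units.dvd_mul_left] at h
  rw [← Finset.mul_prod_erase _ _ (Finset.mem_univ i),
    ← Finset.mul_prod_erase Finset.univ (fun i => x i ^ c i) (Finset.mem_univ i)] at h
  have h1 := (hp i).pow_dvd_of_dvd_mul_right _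
    (not_dvd_prod_of_notMem hp hne i (Finset.univ.erase i) (Finset.notMem_erase i _) c)
    ((Dvd.intro _ rfl).trans h)
  exact (pow_dvd_pow_iff (hp i).ne_zero (hp i).not_isUnit).mp h1

theorem eq_of_unit_mul_prod_pow_eq (hp : ∀ i, Prime (x i))
    (hne : ∀ i j, i ≠ j → ¬ x i ∣ x j) {b c : Fin n → ℕ} {u v : Aˣ}
    (h : u * ∏ i, x i ^ b i = v * ∏ i, x i ^ c i) : b = c ∧ u = v := by
  have hbc : b = c := le_antisymm (le_of_unit_mul_prod_pow_dvd hp hne u v h.dvd)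
    (le_of_unit_mul_prod_pow_dvd hp hne v u h.symm.dvd)
  subst hbc
  refine ⟨rfl, Units.ext (mul_right_cancel₀ ?_ h)⟩
  exact Finset.prod_ne_zero_iff.mpr fun i _ => pow_ne_zero _ (hp i).ne_zero

end Monomials

/-! ### Linear algebra -/

/-- An independent family of `n` vectors in `K ^ d` extends to a basis. -/
theorem exists_linearIndependent_extend {K : Type*} [Field K] {n d : ℕ}
    (v : Fin n → Fin d → K) (hv : LinearIndependent K v) :
    ∃ (h : n ≤ d) (w : Fin d → Fin d → K), LinearIndependent K w ∧
      ∀ i, w (Fin.castLE h i) = v i := by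
  have hnd : n ≤ d := by
    have := hv.fintype_card_le_finrank
    simpa using this
  suffices H : ∀ e, n + e ≤ d → ∃ w : Fin (n + e) → Fin d → K, LinearIndependent K w ∧
      ∀ i, w (Fin.castAdd e i) = v i by
    obtain ⟨e, rfl⟩ := Nat.exists_eq_add_of_le hnd
    obtain ⟨w, hw, hwv⟩ := H e le_rfl
    exact ⟨hnd, w, hw, hwv⟩
  intro e
  induction e with
  | zero => exact fun _ => ⟨v, hv, fun i => rfl⟩
  | succ e ih =>
    intro he
    obtain ⟨w, hw, hwv⟩ := ih (by omega)
    have hlt : Submodule.span K (Set.range w) ≠ ⊤ := by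
      intro htop
      have h1 := finrank_range_le_card (R := K) w
      rw [Set.finrank, htop] at h1
      simp at h1
      omega
    obtain ⟨z, hz⟩ := SetLike.exists_not_mem_of_ne_top _ hlt rfl
    exact ⟨Fin.snoc (α := fun _ => Fin d → K) w z, linearIndependent_finSnoc.mpr ⟨hw, hz⟩,
      fun i => by
        rw [← hwv]
        exact Fin.snoc_castSucc (α := fun _ => Fin d → K) z w (Fin.castAdd e i)⟩

/-! ### Monomial charts -/

section Charts

/-- From `ℤ` to `ℚ` this is clearing denominators. From `ℚ` to `K`, apply every `ℚ`-linear
functional `φ : K → ℚ` to a relation with coefficients `c i`: the `φ (c i)` form a rational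
relation, so all of them vanish. -/
theorem linearIndependent_intCast {K ι κ : Type*} [Field K] [CharZero K] [Finite κ]
    {v : ι → κ → ℤ} (hv : LinearIndependent ℤ v) :
    LinearIndependent K fun i j => (v i j : K) := by
  have hQ : LinearIndependent ℚ fun i j => (v i j : ℚ) := by
    rw [← LinearIndependent.iff_fractionRing (R := ℤ)]
    have := hv.map' (LinearMap.compLeft (Algebra.linearMap ℤ ℚ) κ) (by
      rw [LinearMap.ker_eq_bot]
      intro a b hab
      ext j
      have := congrFun hab j
      simpa using this)
    exact this
  rw [linearIndependent_iff']
  intro s c hc i hi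
  rw [← Module.forall_dual_apply_eq_zero_iff ℚ]
  intro φ
  refine linearIndependent_iff'.mp hQ s (fun i => φ (c i)) ?_ i hi
  ext j
  have h1 := congrArg φ (congrFun hc j)
  simp only [Finset.sum_apply, Pi.smul_apply, smul_eq_mul, Pi.zero_apply, map_sum, map_zero] at h1 ⊢
  rw [← h1]
  refine Finset.sum_congr rfl fun i _ => ?_
  have : c i * (v i j : K) = (v i j : ℚ) • c i := by
    rw [Rat.smul_def, Rat.cast_intCast, mul_comm]
  rw [this, map_smul, smul_eq_mul, mul_comm]

/-- A homomorphism from a submonoid containing an element `s₀` which absorbs all others extends to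
the whole group. -/
theorem exists_addMonoidHom_extend {M G : Type*} [AddCommGroup M] [AddCommGroup G]
    (S : AddSubmonoid M) (s₀ : S) (h : ∀ t : M, ∃ N : ℕ, N • (s₀ : M) + t ∈ S) (B : S →+ G) :
    ∃ B' : M →+ G, ∀ s : S, B' s = B s := by
  choose N hN using h
  -- The extension is forced to send `t` to `B (n s₀ + t) - n B s₀`; this does not depend on the `n`
  -- chosen.
  have key : ∀ (t : M) (n : ℕ) (hn : n • (s₀ : M) + t ∈ S),
      B ⟨_, hN t⟩ - N t • B s₀ = B ⟨_, hn⟩ - n • B s₀ := by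
    intro t n hn
    have h1 : (n • s₀ + ⟨_, hN t⟩ : S) = N t • s₀ + ⟨_, hn⟩ := by
      ext
      simp only [AddSubmonoid.coe_add, AddSubmonoidClass.coe_nsmul]
      abel
    have h2 := congrArg B h1
    rw [map_add, map_add, map_nsmul, map_nsmul] at h2
    rw [sub_eq_sub_iff_add_eq_add, add_comm, h2, add_comm]
  refine ⟨AddMonoidHom.mk' (fun t => B ⟨_, hN t⟩ - N t • B s₀) fun t t' => ?_, fun s => ?_⟩
  · have hadd : (N t + N t') • (s₀ : M) + (t + t') ∈ S := by
      rw [add_smul, add_add_add_comm]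
      exact add_mem (hN t) (hN t')
    rw [key _ _ hadd, show (⟨_, hadd⟩ : S) = ⟨_, hN t⟩ + ⟨_, hN t'⟩ by
      ext
      simp only [AddSubmonoid.coe_add]
      rw [add_smul, add_add_add_comm], map_add, add_smul]
    abel
  · have h0 : 0 • (s₀ : M) + s ∈ S := by simp
    change B ⟨_, hN s⟩ - N s • B s₀ = _
    rw [key _ _ h0]
    simp

theorem prod_pow_single_add {A : Type*} [CommRing A] {n : ℕ} (y : Fin n → A) (j : Fin n) (c : Fin n → ℕ) :
    ∏ i, y i ^ ((Pi.single j 1 + c : Fin n → ℕ) i) = y j * ∏ i, y i ^ c i := by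
  simp only [Pi.add_apply, pow_add, Finset.prod_mul_distrib]
  congr 1
  rw [Finset.prod_eq_single j] <;> simp +contextual

variable {K A : Type*} [Field K] [CommRing A] [IsLocalRing A] {d : ℕ} {k : K →+* A}
  {x : Fin d → A}

/-- Monomials `χ` on the complete regular local ring `A`, indexed by a submonoid of `ℤ ^ d`, are
expressed through the parameters `x`: `χ(s)` is `x ^ b(s)` times the unit `u(s)`. -/
structure Chart (J : Jet k x) {n : ℕ} (hn : n ≤ d) (S : AddSubmonoid (Fin d → ℤ))
    (χ : S → A) where
  b : (Fin d → ℤ) →+ (Fin n → ℤ)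
  u : (Fin d → ℤ) →+ Additive Aˣ
  nonneg : ∀ s : S, 0 ≤ b s
  eq_mul : ∀ s : S, χ s = (Additive.toMul (u s) : Aˣ) *
    ∏ j, x (Fin.castLE hn j) ^ (b s j).toNat
  exists_single : ∀ j, ∃ s : S, b s = Pi.single j 1

/-- The exponents and the transversal logarithmic linear part of a Laurent monomial. -/
def Chart.logVec {J : Jet k x} {n : ℕ} {hn : n ≤ d} {S : AddSubmonoid (Fin d → ℤ)}
    {χ : S → A} (C : Chart J hn S χ) : (Fin d → ℤ) →+ (Fin d → K) where
  toFun t i := if h : (i : ℕ) < n then (C.b t ⟨i, h⟩ : K) else J.dlog (C.u t) i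
  map_zero' := by
    ext i
    simp
  map_add' s t := by
    ext i
    simp only [map_add, Pi.add_apply]
    split_ifs <;> simp

theorem mem_span_lin (J : Jet k x) {ι : Type*} (f : ι → A) (hf : ∀ i, f i ∈ maximalIdeal A)
    {a : A} (ha : a ∈ Ideal.span (Set.range f)) :
    J.lin a ∈ Submodule.span K (Set.range fun i => J.lin (f i)) := by
  rw [Ideal.span, Finsupp.mem_span_range_iff_exists_finsupp] at ha
  obtain ⟨c, rfl⟩ := ha
  rw [Finsupp.sum, map_sum]
  refine sum_mem fun i _ => ?_
  rw [smul_eq_mul, J.lin_mul, (J.mem_iff _).mp (hf i), zero_smul, add_zero]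
  exact Submodule.smul_mem _ _ (Submodule.subset_span ⟨i, rfl⟩)

theorem lin_mul_mul_eq_zero (J : Jet k x) {a b c : A} (ha : a ∈ maximalIdeal A)
    (hb : b ∈ maximalIdeal A) : J.lin (a * (b * c)) = 0 := by
  refine J.lin_eq_zero_of_mem_sq ?_
  rw [pow_two]
  exact Ideal.mul_mem_mul ha (Ideal.mul_mem_right _ _ hb)

theorem eq_zero_or_eq_single_add {n : ℕ} (b : Fin n → ℕ) :
    b = 0 ∨ ∃ (j : Fin n) (c : Fin n → ℕ), b = Pi.single j 1 + c := by
  by_cases h : b = 0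
  · exact Or.inl h
  · obtain ⟨j, hj⟩ := Function.ne_iff.mp h
    refine Or.inr ⟨j, b - Pi.single j 1, ?_⟩
    ext i
    rcases eq_or_ne i j with rfl | hij
    · have : b i ≠ 0 := hj
      simp only [Pi.add_apply, Pi.sub_apply, Pi.single_eq_same]
      omega
    · simp [hij]

/-- The structure of monomial charts: if monomials `χ` generate the maximal ideal up to constants
and cut out the divisor `x_1 ⋯ x_n = 0`, they are expressed through a chart whose logarithmic
vectors are independent. -/
theorem exists_chart [CharZero K] [IsAdicComplete (maximalIdeal A) A] (h : IsCoord k x)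
    (J : Jet k x) {n : ℕ} (hn : n ≤ d) (S : AddSubmonoid (Fin d → ℤ)) (χ : Multiplicative S →* A)
    (s₀ : S) (hs₀ : ∀ t : Fin d → ℤ, ∃ N : ℕ, N • (s₀ : Fin d → ℤ) + t ∈ S)
    (hgen : maximalIdeal A = Ideal.span (Set.range fun s : S =>
      χ (Multiplicative.ofAdd s) - k (J.res (χ (Multiplicative.ofAdd s)))))
    (hdvd : ∏ j : Fin n, x (Fin.castLE hn j) ∣ χ (Multiplicative.ofAdd s₀))
    (hdvd' : ∃ N : ℕ, χ (Multiplicative.ofAdd s₀) ∣ (∏ j : Fin n, x (Fin.castLE hn j)) ^ N) :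
    ∃ C : Chart J hn S fun s => χ (Multiplicative.ofAdd s),
      ∀ (ι : Type) (v : ι → Fin d → ℤ), LinearIndependent ℤ v →
        LinearIndependent K fun i => C.logVec (v i) := by
  classical
  have := h.isDomain
  obtain ⟨N₀, hN₀⟩ := hdvd'
  set y : Fin n → A := fun j => x (Fin.castLE hn j) with hy
  have hp : ∀ j, Prime (y j) := fun j => h.prime _
  have hne : ∀ i j, i ≠ j → ¬ y i ∣ y j := fun i j hij =>
    h.not_dvd fun h' => hij (Fin.castLE_injective hn h')
  have hym : ∀ j, y j ∈ maximalIdeal A := fun j => h.mem _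
  -- monomials are units times monomials in the parameters
  have hmono : ∀ s : S, ∃ (u : Aˣ) (b : Fin n → ℕ),
      χ (Multiplicative.ofAdd s) = u * ∏ i, y i ^ b i := by
    intro s
    refine exists_eq_unit_mul_prod_pow_of_dvd hp (N := N₀ * (hs₀ (-s)).choose) ?_
    -- Some `N s₀ - s` lies in `S`, so `χ s` divides `χ s₀ ^ N` and thus a power of `x_1 ⋯ x_n`.
    have h1 : ((hs₀ (-s)).choose • s₀ : S) = s + ⟨_, (hs₀ (-s)).choose_spec⟩ := by
      ext
      simp
    have h2 : χ (Multiplicative.ofAdd s) ∣ χ (Multiplicative.ofAdd s₀) ^ (hs₀ (-s)).choose := by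
      rw [← map_pow, ← ofAdd_nsmul, h1, ofAdd_add, map_mul]
      exact Dvd.intro _ rfl
    rw [pow_mul]
    exact h2.trans (pow_dvd_pow_of_dvd hN₀ _)
  choose u₀ b₀ hub using hmono
  -- Uniqueness of the unit and of the exponents makes both of them additive in the character.
  have hadd : ∀ s t, b₀ (s + t) = b₀ s + b₀ t ∧ u₀ (s + t) = u₀ s * u₀ t := by
    intro s t
    refine eq_of_unit_mul_prod_pow_eq hp hne ?_
    rw [← hub, ofAdd_add, map_mul, hub, hub]
    simp only [Units.val_mul, Pi.add_apply, pow_add, Finset.prod_mul_distrib]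
    ring
  have hzero : b₀ 0 = 0 ∧ u₀ 0 = 1 := by
    refine eq_of_unit_mul_prod_pow_eq hp hne ?_
    rw [← hub]
    simp
  let Bh : S →+ (Fin n → ℤ) :=
    { toFun := fun s j => (b₀ s j : ℤ)
      map_zero' := by ext; simp [hzero.1]
      map_add' := by intro s t; ext; simp [(hadd s t).1] }
  let Uh : S →+ Additive Aˣ :=
    { toFun := fun s => Additive.ofMul (u₀ s)
      map_zero' := by simp [hzero.2]
      map_add' := by intro s t; simp [(hadd s t).2] }
  obtain ⟨b, hb⟩ := exists_addMonoidHom_extend S s₀ hs₀ Bh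
  obtain ⟨u, hu⟩ := exists_addMonoidHom_extend S s₀ hs₀ Uh
  have hb' : ∀ (s : S) j, b s j = (b₀ s j : ℤ) := fun s j => congrFun (hb s) j
  have hu' : ∀ s : S, u s = Additive.ofMul (u₀ s) := hu
  -- linear extensions
  let Tb : (Fin d → K) →ₗ[K] (Fin n → K) :=
    (Fintype.linearCombination K fun i => fun j => ((b (Pi.single i 1) j : ℤ) : K))
  let Tu : (Fin d → K) →ₗ[K] (Fin d → K) :=
    (Fintype.linearCombination K fun i => J.dlog (u (Pi.single i 1)))
  have hexp : ∀ t : Fin d → ℤ, t = ∑ i, t i • (Pi.single i 1 : Fin d → ℤ) := by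
    intro t
    ext j
    simp [Finset.sum_apply, Pi.single_apply]
  have hTb : ∀ t : Fin d → ℤ, Tb (fun i => (t i : K)) = fun j => ((b t j : ℤ) : K) := by
    intro t
    ext j
    conv_rhs => rw [hexp t]
    simp only [Tb, Fintype.linearCombination_apply, map_sum, map_zsmul, Finset.sum_apply,
      Pi.smul_apply, smul_eq_mul, Int.cast_sum, Int.cast_mul]
  have hTu : ∀ t : Fin d → ℤ, Tu (fun i => (t i : K)) = J.dlog (u t) := by
    intro t
    conv_rhs => rw [hexp t]
    simp only [Tu, Fintype.linearCombination_apply, map_sum, map_zsmul]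
    refine Finset.sum_congr rfl fun i _ => ?_
    rw [Int.cast_smul_eq_zsmul]
  -- the linear parts of the monomials span
  let Js : Finset (Fin n) := Finset.univ.filter fun j => ∃ s : S, b₀ s = Pi.single j 1
  -- `W₁` contains the linear parts of the characters that are units, and `W₂` those of the
  -- characters with exponent a single unit vector. All other characters lie in the square of the
  -- maximal ideal and have no linear part.
  let W₁ : Submodule K (Fin d → K) := (LinearMap.ker Tb).map Tu
  let W₂ : Submodule K (Fin d → K) :=
    Submodule.span K ((fun j : Fin n => (Pi.single (Fin.castLE hn j) 1 : Fin d → K)) '' Js)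
  have hlin : ∀ s : S, J.lin (χ (Multiplicative.ofAdd s)) ∈ W₁ ⊔ W₂ := by
    intro s
    rcases eq_zero_or_eq_single_add (b₀ s) with h0 | ⟨j, c, hjc⟩
    · refine Submodule.mem_sup_left ?_
      rw [hub, h0]
      simp only [Pi.zero_apply, pow_zero, Finset.prod_const_one, mul_one]
      rw [J.lin_unit]
      refine Submodule.smul_mem _ _ ⟨fun i => ((s : Fin d → ℤ) i : K), ?_, ?_⟩
      · change _ = _
        rw [hTb]
        ext j
        simp [hb', h0]
      · rw [hTu, hu']
    · rw [hub, hjc, prod_pow_single_add]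
      rcases eq_zero_or_eq_single_add c with h0 | ⟨j', c', rfl⟩
      · refine Submodule.mem_sup_right ?_
        subst h0
        rw [add_zero] at hjc
        simp only [Pi.zero_apply, pow_zero, Finset.prod_const_one, mul_one]
        rw [J.lin_mul, (J.mem_iff _).mp (hym j), zero_smul, add_zero, hy, J.lin_coord]
        exact Submodule.smul_mem _ _ (Submodule.subset_span ⟨j, by simpa [Js] using ⟨s, s.2, hjc⟩, rfl⟩)
      · rw [prod_pow_single_add, mul_left_comm, mul_left_comm (u₀ s : A),
          lin_mul_mul_eq_zero J (hym j) (hym j')]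
        exact zero_mem _
  have htop : W₁ ⊔ W₂ = ⊤ := by
    rw [eq_top_iff]
    intro v _
    have h1 : J.lin (∑ i, k (v i) * x i) = v := by
      ext j
      simp [map_sum, J.lin_const_mul, J.lin_coord, Finset.sum_apply, Pi.single_apply]
    have h2 : ∑ i, k (v i) * x i ∈ maximalIdeal A :=
      sum_mem fun i _ => Ideal.mul_mem_left _ _ (h.mem i)
    rw [hgen] at h2
    have h3 := mem_span_lin J _ (fun s => J.sub_const_mem _) h2
    rw [h1] at h3
    refine Submodule.span_le.mpr ?_ h3
    rintro _ ⟨s, rfl⟩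
    simp only [J.lin_sub_const]
    exact hlin s
  -- every parameter occurs
  have hcard : Module.finrank K (LinearMap.range Tb) ≤ Js.card := by
    -- From `W₁ ⊔ W₂ = ⊤` one gets `d ≤ (d - rank Tb) + |Js|`.
    have h1 := Submodule.finrank_add_le_finrank_add_finrank W₁ W₂
    rw [htop, finrank_top, Module.finrank_fin_fun] at h1
    have h2 : Module.finrank K W₁ ≤ Module.finrank K (LinearMap.ker Tb) :=
      Submodule.finrank_map_le _ _
    have h3 : Module.finrank K W₂ ≤ Js.card := by
      classical
      have := finrank_span_finset_le_card (R := K)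
        (Js.image fun j : Fin n => (Pi.single (Fin.castLE hn j) 1 : Fin d → K))
      rw [Finset.coe_image] at this
      exact this.trans Finset.card_image_le
    have h4 := Tb.finrank_range_add_finrank_ker
    rw [Module.finrank_fin_fun] at h4
    omega
  let W₃ : Submodule K (Fin n → K) :=
    Submodule.span K (Set.range fun j : Js => (Pi.single (j : Fin n) 1 : Fin n → K))
  have hW₃ : W₃ = LinearMap.range Tb := by
    refine Submodule.eq_of_le_of_finrank_le ?_ ?_
    · refine Submodule.span_le.mpr ?_
      rintro _ ⟨⟨j, hj⟩, rfl⟩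
      obtain ⟨s, hs⟩ := (Finset.mem_filter.mp hj).2
      refine ⟨fun i => ((s : Fin d → ℤ) i : K), ?_⟩
      rw [hTb]
      ext i
      simp [hb', hs, Pi.single_apply]
    · refine hcard.trans ?_
      have hli : LinearIndependent K fun j : Js => (Pi.single (j : Fin n) 1 : Fin n → K) :=
        (Pi.linearIndependent_single_one (Fin n) K).comp _ Subtype.val_injective
      rw [finrank_span_eq_card hli, Fintype.card_coe]
  -- By the dimension count the image of `Tb` is spanned by the unit vectors with index in `Js`. It
  -- contains the exponents of `χ s₀`, all of which are positive because `x_1 ⋯ x_n` divides `χ s₀`.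
  have hJs : ∀ j, j ∈ Js := by
    intro j
    by_contra hj
    have h1 : Tb (fun i => ((s₀ : Fin d → ℤ) i : K)) ∈ W₃ := hW₃ ▸ LinearMap.mem_range_self _ _
    have h2 : W₃ ≤ LinearMap.ker (LinearMap.proj j : (Fin n → K) →ₗ[K] K) := by
      refine Submodule.span_le.mpr ?_
      rintro _ ⟨⟨i, hi⟩, rfl⟩
      have : j ≠ i := fun h' => hj (h' ▸ hi)
      simp [this]
    have h3 := h2 h1
    rw [LinearMap.mem_ker, LinearMap.proj_apply, hTb] at h3
    simp only [hb'] at h3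
    have h4 : b₀ s₀ j = 0 := by exact_mod_cast h3
    have h5 : (fun _ => 1 : Fin n → ℕ) ≤ b₀ s₀ := by
      refine le_of_unit_mul_prod_pow_dvd hp hne 1 (u₀ s₀) ?_
      rw [← hub]
      simpa using hdvd
    have := h5 j
    simp [h4] at this
  let C : Chart J hn S fun s => χ (Multiplicative.ofAdd s) :=
    { b := b
      u := u
      nonneg := fun s j => by rw [hb']; positivity
      eq_mul := fun s => by
        rw [hub, hu']
        simp [hb', hy]
      exists_single := fun j => by
        obtain ⟨s, hs⟩ := (Finset.mem_filter.mp (hJs j)).2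
        refine ⟨s, ?_⟩
        ext i
        rw [hb', hs]
        simp [Pi.single_apply] }
  refine ⟨C, ?_⟩
  let T : (Fin d → K) →ₗ[K] (Fin d → K) :=
    Fintype.linearCombination K fun i => C.logVec (Pi.single i 1)
  have hT : ∀ t : Fin d → ℤ, T (fun i => (t i : K)) = C.logVec t := by
    intro t
    conv_rhs => rw [hexp t]
    simp only [T, Fintype.linearCombination_apply, map_sum, map_zsmul]
    refine Finset.sum_congr rfl fun i _ => ?_
    rw [Int.cast_smul_eq_zsmul]
  have hTi : ∀ c (i : Fin d), T c i = if hi : (i : ℕ) < n then Tb c ⟨i, hi⟩ else Tu c i := by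
    intro c i
    simp only [T, Tb, Tu, Fintype.linearCombination_apply, Finset.sum_apply, Pi.smul_apply,
      Chart.logVec, C]
    split_ifs with hi <;> simp [hi]
  -- Vectors vanishing in the first `n` entries are images of elements of `ker Tb`, because `W₂`
  -- only contributes to those entries; the first `n` entries can be prescribed because `Tb` is
  -- onto. A surjective endomorphism of `K ^ d` is injective.
  have hsurj : Function.Surjective T := by
    have hker : ∀ v : Fin d → K, (∀ i : Fin d, (i : ℕ) < n → v i = 0) → ∃ c, T c = v := by
      intro v hv
      obtain ⟨w₁, ⟨c, hc, rfl⟩, w₂, hw₂, hw⟩ := Submodule.mem_sup.mp (htop ▸ trivial : v ∈ W₁ ⊔ W₂)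
      refine ⟨c, ?_⟩
      ext i
      rw [hTi]
      split_ifs with hi
      · rw [LinearMap.mem_ker.mp hc, hv i hi]
        rfl
      · have : W₂ ≤ LinearMap.ker (LinearMap.proj i : (Fin d → K) →ₗ[K] K) := by
          refine Submodule.span_le.mpr ?_
          rintro _ ⟨j, -, rfl⟩
          have : i ≠ Fin.castLE hn j := by
            rintro rfl
            exact hi j.2
          simp [this]
        have h0 : w₂ i = 0 := this hw₂
        rw [← hw, Pi.add_apply, h0, add_zero]
    intro v
    have hTbs : LinearMap.range Tb = ⊤ := by
      rw [← hW₃, eq_top_iff, ← (Pi.basisFun K (Fin n)).span_eq]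
      refine Submodule.span_mono ?_
      rintro _ ⟨j, rfl⟩
      exact ⟨⟨j, hJs j⟩, by simp⟩
    obtain ⟨c, hc⟩ := LinearMap.range_eq_top.mp hTbs fun j => v (Fin.castLE hn j)
    obtain ⟨c', hc'⟩ := hker (v - T c) fun i hi => by
      rw [Pi.sub_apply, hTi, dif_pos hi, hc]
      exact sub_self _
    exact ⟨c + c', by rw [map_add, hc', add_sub_cancel]⟩
  have hinj : LinearMap.ker T = ⊥ :=
    LinearMap.ker_eq_bot.mpr (LinearMap.injective_iff_surjective.mpr hsurj)
  intro ι v hv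
  have := (linearIndependent_intCast (K := K) hv).map' T hinj
  have he : (T ∘ fun i j => ((v i j : ℤ) : K)) = fun i => C.logVec (v i) :=
    funext fun i => hT (v i)
  rwa [he] at this

end Charts

/-! ### Reordering matrices and charts -/

section Reorder

theorem exists_perm_extend {ι κ : Type*} [Finite κ] (f g : ι → κ) (hf : Function.Injective f)
    (hg : Function.Injective g) : ∃ ρ : Equiv.Perm κ, ∀ i, ρ (f i) = g i := by
  classical
  let e : {a // a ∈ Set.range f} ≃ {a // a ∈ Set.range g} :=
    (Equiv.ofInjective f hf).symm.trans (Equiv.ofInjective g hg)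
  refine ⟨e.extendSubtype, fun i => ?_⟩
  rw [Equiv.extendSubtype_apply_of_mem e (f i) ⟨i, rfl⟩]
  have : (⟨f i, ⟨i, rfl⟩⟩ : {a // a ∈ Set.range f}) = Equiv.ofInjective f hf i := rfl
  rw [this]
  simp [e]

theorem exists_rows {F : Type*} [Field F] {l : ℕ} {κ : Type*} [Finite κ] (v : Fin l → κ → F) :
    ∃ (c : Fin (Module.finrank F (Submodule.span F (Set.range v))) → Fin l),
      Function.Injective c ∧ LinearIndependent F (v ∘ c) ∧
        Submodule.span F (Set.range (v ∘ c)) = Submodule.span F (Set.range v) := by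
  obtain ⟨ι, c, hc, hs, hli⟩ := exists_linearIndependent' F v
  have : Finite ι := Finite.of_injective c hc
  have : Fintype ι := Fintype.ofFinite ι
  have hcard : Fintype.card ι = Module.finrank F (Submodule.span F (Set.range v)) := by
    rw [← hs, finrank_span_eq_card hli]
  let e : Fin (Module.finrank F (Submodule.span F (Set.range v))) ≃ ι :=
    (Fintype.equivFinOfCardEq hcard).symm
  refine ⟨c ∘ e, hc.comp e.injective, hli.comp e e.injective, ?_⟩
  refine Eq.trans ?_ hs
  rw [← Function.comp_assoc, Set.range_comp (v ∘ c) e, e.surjective.range_eq, Set.image_univ]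

/-- Rows and columns of a matrix can be permuted so that the leading minor of the size of the rank
does not vanish. -/
theorem exists_perm_leading_minor {F : Type*} [Field F] {l n : ℕ} (M : Matrix (Fin l) (Fin n) F) :
    ∃ (r : ℕ) (hrl : r ≤ l) (hrn : r ≤ n) (ρ : Equiv.Perm (Fin l)) (π : Equiv.Perm (Fin n)),
      r = M.rank ∧
      ((M.submatrix ρ π).submatrix (Fin.castLE hrl) (Fin.castLE hrn)).det ≠ 0 ∧
      ∀ i, ∃ q : Fin r → F, ∀ j,
        M.submatrix ρ π i j = ∑ i', q i' * M.submatrix ρ π (Fin.castLE hrl i') j := by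
  -- A maximal independent set `c` of rows leaves an `r × n` matrix of rank `r`; a maximal
  -- independent set `e` of its columns gives the nonvanishing minor.
  obtain ⟨c, hc, hcli, hcs⟩ := exists_rows M.row
  have hr : Module.finrank F (Submodule.span F (Set.range M.row)) = M.rank := by
    rw [M.rank_eq_finrank_span_row]
  generalize Module.finrank F (Submodule.span F (Set.range M.row)) = r at c hc hcli hcs hr
  have hM' : (M.submatrix c id).rank = r := by
    have : LinearIndependent F (M.submatrix c id).row := hcli
    rw [this.rank_matrix, Fintype.card_fin]
  have hr' : Module.finrank F (Submodule.span F (Set.range (M.submatrix c id).col)) = r := by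
    rw [← Matrix.rank_eq_finrank_span_cols, hM']
  obtain ⟨e, he, heli, -⟩ := exists_rows (M.submatrix c id).col
  generalize Module.finrank F (Submodule.span F (Set.range (M.submatrix c id).col)) = r' at e he heli hr'
  subst hr'
  have hrl : r' ≤ l := by simpa using Fintype.card_le_of_injective c hc
  have hrn : r' ≤ n := by simpa using Fintype.card_le_of_injective e he
  obtain ⟨ρ, hρ⟩ := exists_perm_extend (Fin.castLE hrl) c (Fin.castLE_injective hrl) hc
  obtain ⟨π, hπ⟩ := exists_perm_extend (Fin.castLE hrn) e (Fin.castLE_injective hrn) he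
  refine ⟨r', hrl, hrn, ρ, π, hr, ?_, fun i => ?_⟩
  · rw [← isUnit_iff_ne_zero, ← Matrix.isUnit_iff_isUnit_det,
      ← Matrix.linearIndependent_cols_iff_isUnit]
    have : ((M.submatrix ρ π).submatrix (Fin.castLE hrl) (Fin.castLE hrn)).col =
        (M.submatrix c id).col ∘ e := by
      ext j i
      simp [hρ, hπ]
    rw [this]
    exact heli
  · have h1 : M.row (ρ i) ∈ Submodule.span F (Set.range (M.row ∘ c)) := by
      rw [hcs]
      exact Submodule.subset_span ⟨_, rfl⟩
    obtain ⟨q, hq⟩ := (Submodule.mem_span_range_iff_exists_fun F).mp h1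
    refine ⟨q, fun j => ?_⟩
    have := congrFun hq (π j)
    simp only [Finset.sum_apply, Pi.smul_apply, smul_eq_mul, Function.comp_apply,
      Matrix.row_apply] at this
    simp only [Matrix.submatrix_apply, hρ, this]

/-- In a divisible group, integral linear systems with non-zero determinant can be solved. -/
theorem exists_sum_smul_eq {G : Type*} [AddCommGroup G]
    (hG : ∀ (N : ℕ), N ≠ 0 → ∀ g : G, ∃ h : G, N • h = g) {r : ℕ}
    (B : Matrix (Fin r) (Fin r) ℤ) (hB : B.det ≠ 0) (u : Fin r → G) :
    ∃ v : Fin r → G, ∀ i, ∑ j, B i j • v j = u i := by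
  have hG' : ∀ g : G, ∃ h : G, B.det • h = g := by
    intro g
    obtain ⟨h, hh⟩ := hG B.det.natAbs (Int.natAbs_ne_zero.mpr hB) g
    rcases Int.natAbs_eq B.det with hd | hd
    · exact ⟨h, by rw [hd, natCast_zsmul, hh]⟩
    · exact ⟨-h, by rw [hd, neg_smul_neg, natCast_zsmul, hh]⟩
  choose t ht using fun i => hG' (u i)
  -- Cramer's rule, with `t` chosen such that `det B • t i = u i`.
  refine ⟨fun j => ∑ i, B.adjugate j i • t i, fun i => ?_⟩
  simp only [Finset.smul_sum, smul_smul]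
  rw [Finset.sum_comm]
  have h1 : ∀ k, ∑ j, (B i j * B.adjugate j k) • t k = (if i = k then B.det else 0) • t k := by
    intro k
    rw [← Finset.sum_smul, ← Matrix.mul_apply, Matrix.mul_adjugate, Matrix.smul_apply,
      Matrix.one_apply]
    split_ifs <;> simp
  simp only [h1, ite_smul, zero_smul, Finset.sum_ite_eq, Finset.mem_univ, if_true, ht]

end Reorder

/-! ### The normal form for maps of monomial charts -/

section NormalForm

/-- Outside of the range of `p` a relation involves only the `w i`, whose coefficients therefore
vanish; the other coefficients are read off at the positions `p j`. -/
theorem linearIndependent_addCases_single {K : Type*} [Field K] {n d e : ℕ} (p : Fin n → Fin d)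
    (hp : Function.Injective p) (w : Fin e → Fin d → K)
    (hw : ∀ c : Fin e → K, (∀ t, t ∉ Set.range p → ∑ i, c i * w i t = 0) → c = 0) :
    LinearIndependent K (Fin.addCases (fun j => (Pi.single (p j) 1 : Fin d → K)) w :
      Fin (n + e) → Fin d → K) := by
  rw [Fintype.linearIndependent_iff]
  intro g hg
  rw [Fin.sum_univ_add] at hg
  simp only [Fin.addCases_left, Fin.addCases_right] at hg
  have h0 : (fun i => g (Fin.natAdd n i)) = 0 := by
    refine hw _ fun t ht => ?_
    have := congrFun hg t
    simp only [Pi.add_apply, Finset.sum_apply, Pi.smul_apply, smul_eq_mul, Pi.zero_apply] at this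
    rw [Finset.sum_eq_zero, zero_add] at this
    · exact this
    · intro j _
      have : t ≠ p j := fun h => ht ⟨j, h.symm⟩
      simp [this]
  have h1 : ∀ i, g (Fin.natAdd n i) = 0 := congrFun h0
  simp only [h1, zero_smul, Finset.sum_const_zero, add_zero] at hg
  intro i
  induction i using Fin.addCases with
  | right i => exact h1 i
  | left j =>
    have := congrFun hg (p j)
    simpa [Finset.sum_apply, Pi.single_apply, hp.eq_iff] using this

/-- The homomorphism `b` is onto, so its kernel is free of rank `m - l`; a basis of the kernel
completes the given lifts of the unit vectors. -/
theorem exists_adapted_family {m l : ℕ} (b : (Fin m → ℤ) →+ (Fin l → ℤ)) (f₀ : Fin l → Fin m → ℤ)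
    (hf₀ : ∀ i, b (f₀ i) = Pi.single i 1) (hl : l ≤ m) :
    ∃ f : Fin m → Fin m → ℤ, LinearIndependent ℤ f ∧ (∀ i, f (Fin.castLE hl i) = f₀ i) ∧
      ∀ i : Fin m, l ≤ (i : ℕ) → b (f i) = 0 := by
  let bL : (Fin m → ℤ) →ₗ[ℤ] (Fin l → ℤ) := b.toIntLinearMap
  have hbL : ∀ t, bL t = b t := fun t => rfl
  have hsurj : Function.Surjective bL := by
    intro c
    refine ⟨∑ i, c i • f₀ i, ?_⟩
    simp only [map_sum, hbL, map_zsmul, hf₀]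
    ext j
    simp [Finset.sum_apply, Pi.single_apply]
  have hrank : Module.finrank ℤ (LinearMap.ker bL) = m - l := by
    have := bL.ker.finrank_quotient_add_finrank
    rw [(bL.quotKerEquivOfSurjective hsurj).finrank_eq, Module.finrank_fin_fun,
      Module.finrank_fin_fun] at this
    omega
  let B := Module.finBasisOfFinrankEq ℤ (LinearMap.ker bL) hrank
  refine ⟨fun i => if h : (i : ℕ) < l then f₀ ⟨i, h⟩ else B ⟨i - l, by omega⟩, ?_, ?_, ?_⟩
  · obtain ⟨e, rfl⟩ := Nat.exists_eq_add_of_le hl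
    rw [Fintype.linearIndependent_iff]
    intro g hg
    rw [Fin.sum_univ_add] at hg
    simp only [Fin.val_castAdd, Fin.is_lt, dif_pos, Fin.val_natAdd, Nat.not_lt.mpr (Nat.le_add_right l _),
      dif_neg, not_false_eq_true] at hg
    have h1 := congrArg bL hg
    rw [map_add, map_sum, map_sum, map_zero] at h1
    have h2 : ∀ i : Fin e, bL (g (Fin.natAdd l i) •
        (B ⟨l + i - l, by omega⟩ : Fin (l + e) → ℤ)) = 0 := by
      intro i
      rw [map_smul, LinearMap.mem_ker.mp (B _).2, smul_zero]
    rw [Finset.sum_eq_zero fun i _ => h2 i, add_zero] at h1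
    have h3 : ∀ i : Fin l, g (Fin.castAdd e i) = 0 := by
      intro i
      have := congrFun h1 i
      simp only [hbL, map_zsmul, Fin.eta, hf₀] at this
      simpa [Finset.sum_apply, Pi.single_apply] using this
    simp only [h3, zero_smul, Finset.sum_const_zero, zero_add] at hg
    have h4 : ∑ i : Fin e, g (Fin.natAdd l i) • B ⟨l + i - l, by omega⟩ = 0 := by
      ext1
      push_cast
      exact hg
    have h5 : ∀ i : Fin e, g (Fin.natAdd l i) = 0 := by
      have hli := B.linearIndependent.comp (fun i : Fin e => (⟨l + i - l, by omega⟩ : Fin (l + e - l)))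
        (by
          intro i j hij
          rw [Fin.mk.injEq] at hij
          ext
          omega)
      exact Fintype.linearIndependent_iff.mp hli _ h4
    intro i
    induction i using Fin.addCases with
    | right i => exact h5 i
    | left j => exact h3 j
  · intro i
    simp
  · intro i hi
    have h : ¬ (i : ℕ) < l := by omega
    simp only [h, dif_neg, not_false_eq_true]
    exact LinearMap.mem_ker.mp (B _).2

variable {K A : Type*} [Field K] [CommRing A] [IsLocalRing A] {d : ℕ} {k : K →+* A}
  {x : Fin d → A}

/-- Extend the linear parts of the `z i` to a basis of `K ^ d`, realize the added vectors by linear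
forms in `x`, and apply the formal inverse function theorem `Jet.span_eq`. -/
theorem exists_coord_extend (h : IsCoord k x) (J : Jet k x) {N : ℕ} (z : Fin N → A)
    (hz : ∀ i, z i ∈ maximalIdeal A) (hl : LinearIndependent K fun i => J.lin (z i)) :
    ∃ (hN : N ≤ d) (x' : Fin d → A), Ideal.span (Set.range x') = maximalIdeal A ∧
      ∀ i, x' (Fin.castLE hN i) = z i := by
  obtain ⟨hN, w, hw, hwz⟩ := exists_linearIndependent_extend _ hl
  let x' : Fin d → A := fun i => if hi : (i : ℕ) < N then z ⟨i, hi⟩ else ∑ t, k (w i t) * x t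
  refine ⟨hN, x', J.span_eq h (fun i => ?_) ?_, fun i => by simp [x']⟩
  · simp only [x']
    split_ifs with hi
    · exact hz _
    · exact sum_mem fun t _ => Ideal.mul_mem_left _ _ (h.mem t)
  · convert hw using 1
    ext1 i
    simp only [x']
    split_ifs with hi
    · rw [← hwz ⟨i, hi⟩]
      rfl
    · rw [map_sum]
      ext t
      simp [J.lin_const_mul, J.lin_coord, Finset.sum_apply, Pi.single_apply]

theorem Chart.apply_of_eq_zero {J : Jet k x} {n : ℕ} {hn : n ≤ d} {S : AddSubmonoid (Fin d → ℤ)}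
    {χ : S → A} (C : Chart J hn S χ) {s t : S} {e : Fin d → ℤ} (he : (t : Fin d → ℤ) = s + e)
    (hb : C.b e = 0) : χ t = (Additive.toMul (C.u e) : Aˣ) * χ s := by
  rw [C.eq_mul, C.eq_mul, he, map_add C.u, map_add C.b, hb, add_zero]
  simp only [toMul_add, Units.val_mul]
  ring

/-- Two monomials with a unit factor. -/
theorem Chart.eq_of_unit_mul_eq [IsAdicComplete (maximalIdeal A) A] (h : IsCoord k x)
    {J : Jet k x} {n : ℕ} {hn : n ≤ d}
    {S : AddSubmonoid (Fin d → ℤ)} {χ : S → A} (C : Chart J hn S χ) {s t : S} {w : Aˣ}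
    (hw : χ t = w * χ s) : C.b t = C.b s ∧ C.u t = Additive.ofMul w + C.u s := by
  have := h.isDomain
  rw [C.eq_mul, C.eq_mul, ← mul_assoc, ← Units.val_mul] at hw
  obtain ⟨h1, h2⟩ := eq_of_unit_mul_prod_pow_eq (fun j => h.prime _)
    (fun i j hij => h.not_dvd fun h' => hij (Fin.castLE_injective hn h')) hw
  constructor
  · ext j
    have h3 := congrFun h1 j
    have h4 : 0 ≤ C.b t j := C.nonneg t j
    have h5 : 0 ≤ C.b s j := C.nonneg s j
    omega
  · rw [← ofMul_toMul (C.u t), h2]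
    rfl

end NormalForm

/-! ### Parameters and units coming from charts -/

section NormalForm

variable {K A : Type*} [Field K] [CommRing A] [IsLocalRing A] {d : ℕ} {k : K →+* A}
  {x : Fin d → A}

theorem linearIndependent_of_eq_smul {K V ι : Type*} [Field K] [AddCommGroup V] [Module K V]
    {v w : ι → V} (hv : LinearIndependent K v) (h : ∀ i, ∃ c : K, c ≠ 0 ∧ w i = c • v i) :
    LinearIndependent K w := by
  choose c hc hw using h
  have := hv.units_smul fun i => Units.mk0 (c i) (hc i)
  convert this using 1
  ext1 i
  exact hw i

theorem Jet.lin_unit_mul_coord (h : IsCoord k x) (J : Jet k x) (u : Aˣ) (i : Fin d) :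
    J.lin (u * x i) = J.res u • (Pi.single i 1 : Fin d → K) := by
  rw [J.lin_mul, J.lin_coord, (J.mem_iff _).mp (h.mem i), zero_smul, add_zero]

theorem Chart.logVec_apply {J : Jet k x} {n : ℕ} {hn : n ≤ d} {S : AddSubmonoid (Fin d → ℤ)}
    {χ : S → A} (C : Chart J hn S χ) (t : Fin d → ℤ) (i : Fin d) :
    C.logVec t i = if h : (i : ℕ) < n then (C.b t ⟨i, h⟩ : K) else J.dlog (C.u t) i := rfl

/-- Up to nonzero scalars the linear parts are unit vectors in the first `n` directions and the
`dlog` of the units `C.u (f i)`. The latter are independent modulo those directions, because the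
logarithmic vectors of the `f i` with `i ≥ n` vanish there. -/
theorem Chart.span_parameters (h : IsCoord k x) {J : Jet k x} {n : ℕ} {hn : n ≤ d}
    {S : AddSubmonoid (Fin d → ℤ)} {χ : S → A} (C : Chart J hn S χ) {f : Fin d → Fin d → ℤ}
    (hf : LinearIndependent K fun i => C.logVec (f i)) (ρ : Equiv.Perm (Fin n))
    (hf0 : ∀ i : Fin d, n ≤ (i : ℕ) → C.b (f i) = 0) (z : Fin d → A)
    (hz : ∀ i : Fin n, ∃ u : Aˣ, z (Fin.castLE hn i) = u * x (Fin.castLE hn (ρ i)))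
    (hz' : ∀ i : Fin d, n ≤ (i : ℕ) → z i = (Additive.toMul (C.u (f i)) : Aˣ) -
      k (J.res (Additive.toMul (C.u (f i)) : Aˣ))) :
    Ideal.span (Set.range z) = maximalIdeal A := by
  obtain ⟨e, rfl⟩ := Nat.exists_eq_add_of_le hn
  have hli : LinearIndependent K (Fin.addCases
      (fun j => (Pi.single (Fin.castLE hn (ρ j)) 1 : Fin (n + e) → K))
      (fun i => J.dlog (C.u (f (Fin.natAdd n i)))) : Fin (n + e) → Fin (n + e) → K) := by
    refine linearIndependent_addCases_single _ ((Fin.castLE_injective hn).comp ρ.injective) _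
      fun c hc => ?_
    have h1 := hf.comp _ (Fin.natAdd_injective e n)
    rw [Fintype.linearIndependent_iff] at h1
    ext i
    refine h1 c ?_ i
    ext t
    simp only [Finset.sum_apply, Pi.smul_apply, smul_eq_mul, Function.comp_apply, C.logVec_apply,
      Pi.zero_apply]
    split_ifs with ht
    · simp [hf0]
    · refine hc t ?_
      rintro ⟨j, rfl⟩
      exact ht (ρ j).2
  refine J.span_eq h ?_ (linearIndependent_of_eq_smul hli ?_)
  · intro i
    induction i using Fin.addCases with
    | left i =>
      obtain ⟨u, hu⟩ := hz i
      rw [show Fin.castAdd e i = Fin.castLE hn i from rfl, hu]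
      exact Ideal.mul_mem_left _ _ (h.mem _)
    | right i =>
      rw [hz' _ (by simp)]
      exact J.sub_const_mem _
  · intro i
    induction i using Fin.addCases with
    | left i =>
      obtain ⟨u, hu⟩ := hz i
      refine ⟨J.res u, (J.isUnit_iff _).mp u.isUnit, ?_⟩
      rw [show Fin.castAdd e i = Fin.castLE hn i from rfl, hu, J.lin_unit_mul_coord h,
        show Fin.castLE hn i = Fin.castAdd e i from rfl, Fin.addCases_left]
    | right i =>
      refine ⟨J.res (Additive.toMul (C.u (f (Fin.natAdd n i))) : Aˣ),
        (J.isUnit_iff _).mp (Units.isUnit _), ?_⟩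
      rw [hz' _ (by simp), J.lin_sub_const, J.lin_unit, Fin.addCases_right]
      rfl

variable {B : Type*} [CommRing B] [IsLocalRing B] {m : ℕ} {kB : K →+* B} {y : Fin m → B}

/-- A map of charts compatible with a homomorphism of the groups of monomials identifies units. -/
theorem Chart.map_unit [IsAdicComplete (maximalIdeal A) A] (h : IsCoord k x)
    {J : Jet k x} {n : ℕ} {hn : n ≤ d} {S : AddSubmonoid (Fin d → ℤ)} {χ : S → A}
    (C : Chart J hn S χ) {J' : Jet kB y} {l : ℕ} {hl : l ≤ m} {S' : AddSubmonoid (Fin m → ℤ)}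
    {χ' : S' → B} (C' : Chart J' hl S' χ') (Φ : B →+* A)
    (γ : (Fin m → ℤ) →+ (Fin d → ℤ)) (hγ : ∀ s : S', γ s ∈ S)
    (hΦ : ∀ s : S', Φ (χ' s) = χ ⟨γ s, hγ s⟩) (s₀ : S')
    (hs₀ : ∀ t : Fin m → ℤ, ∃ N : ℕ, N • (s₀ : Fin m → ℤ) + t ∈ S') (t : Fin m → ℤ)
    (ht : C'.b t = 0) :
    C.b (γ t) = 0 ∧ C.u (γ t) = Additive.ofMul (Units.map Φ (Additive.toMul (C'.u t))) := by
  -- The lattice point `t` need not lie in `S'`; its unit is the ratio of the characters of `N s₀ +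
  -- t` and `N s₀`, which do.
  obtain ⟨N, hN⟩ := hs₀ t
  have h1 := congrArg Φ (C'.apply_of_eq_zero (s := N • s₀) (t := ⟨_, hN⟩) (by simp) ht)
  rw [map_mul, hΦ, hΦ] at h1
  obtain ⟨h2, h3⟩ := C.eq_of_unit_mul_eq h (w := Units.map (Φ : B →* A) (Additive.toMul (C'.u t))) h1
  simp only [AddSubmonoidClass.coe_nsmul, map_add] at h2 h3
  constructor
  · simpa using h2
  · rw [add_comm] at h3
    exact add_right_cancel h3

end NormalForm

/-! ### The normal form of a monomial homomorphism -/

section NormalForm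

theorem sum_castLE {G : Type*} [AddCommMonoid G] {r n : ℕ} (hrn : r ≤ n) (g : Fin n → G)
    (hg : ∀ j : Fin n, r ≤ (j : ℕ) → g j = 0) : ∑ j, g j = ∑ j : Fin r, g (Fin.castLE hrn j) := by
  obtain ⟨e, rfl⟩ := Nat.exists_eq_add_of_le hrn
  rw [Fin.sum_univ_add, Finset.sum_eq_zero (s := Finset.univ (α := Fin e)) fun i _ =>
    hg (Fin.natAdd r i) (by simp), add_zero]
  rfl

theorem linearIndependent_sub_sum {K V ι₁ ι₂ : Type*} [Field K] [AddCommGroup V] [Module K V]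
    [Fintype ι₁] [Fintype ι₂] {L₁ : ι₁ → V} {L₂ : ι₂ → V}
    (hL : LinearIndependent K (Sum.elim L₁ L₂)) (Q : ι₂ → ι₁ → K) :
    LinearIndependent K fun i => L₂ i - ∑ i', Q i i' • L₁ i' := by
  rw [Fintype.linearIndependent_iff] at hL ⊢
  intro c hc i
  refine hL (Sum.elim (fun i' => -∑ i, c i * Q i i') c) ?_ (Sum.inr i)
  rw [Fintype.sum_sum_type, ← hc]
  simp only [Sum.elim_inl, Sum.elim_inr, smul_sub, Finset.sum_sub_distrib, Finset.smul_sum,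
    neg_smul, Finset.sum_smul, Finset.sum_neg_distrib, smul_smul]
  rw [Finset.sum_comm]
  abel

theorem Jet.res_map {K A B : Type*} [Field K] [CommRing A] [IsLocalRing A] [CommRing B]
    [IsLocalRing B] {d m : ℕ} {k : K →+* A} {x : Fin d → A} {kB : K →+* B} {y : Fin m → B}
    (J : Jet k x) (J' : Jet kB y) (Φ : B →+* A) [IsLocalHom Φ] (hk : ∀ c, Φ (kB c) = k c) (b : B) :
    J.res (Φ b) = J'.res b := by
  have h1 : Φ (b - kB (J'.res b)) ∈ maximalIdeal A :=
    (map_mem_nonunits_iff Φ _).mpr (J'.sub_const_mem b)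
  rw [J.mem_iff, map_sub, map_sub, hk, J.res_const, sub_eq_zero] at h1
  exact h1

variable {K A : Type*} [Field K] [CommRing A] [IsLocalRing A] {d : ℕ} {k : K →+* A}
  {x : Fin d → A} {B : Type*} [CommRing B] [IsLocalRing B] {m : ℕ} {kB : K →+* B} {y : Fin m → B}

/-- A homomorphism of complete regular local rings which is monomial with respect to charts has the
monomial normal form. -/
theorem exists_normal_form [IsAlgClosed K] [CharZero K] [IsAdicComplete (maximalIdeal A) A]
    [IsAdicComplete (maximalIdeal B) B] (h : IsCoord k x) (h' : IsCoord kB y)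
    {J : Jet k x} {n : ℕ} {hn : n ≤ d} {S : AddSubmonoid (Fin d → ℤ)} {χ : S → A}
    (C : Chart J hn S χ) {J' : Jet kB y} {l : ℕ} {hl : l ≤ m} {S' : AddSubmonoid (Fin m → ℤ)}
    {χ' : S' → B} (C' : Chart J' hl S' χ')
    (hC : ∀ (ι : Type) (v : ι → Fin d → ℤ), LinearIndependent ℤ v →
        LinearIndependent K fun i => C.logVec (v i))
    (hC' : ∀ (ι : Type) (v : ι → Fin m → ℤ), LinearIndependent ℤ v →
        LinearIndependent K fun i => C'.logVec (v i))
    (Φ : B →+* A) [IsLocalHom Φ] (hk : ∀ c, Φ (kB c) = k c)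
    (γ : (Fin m → ℤ) →+ (Fin d → ℤ)) (hγi : Function.Injective γ) (hγ : ∀ s : S', γ s ∈ S)
    (hΦ : ∀ s : S', Φ (χ' s) = χ ⟨γ s, hγ s⟩) (s₀ : S')
    (hs₀ : ∀ t : Fin m → ℤ, ∃ N : ℕ, N • (s₀ : Fin m → ℤ) + t ∈ S')
    (hdvd : ∏ j, x (Fin.castLE hn j) ∣ Φ (∏ i, y (Fin.castLE hl i))) :
    ∃ (x' : Fin d → A) (y' : Fin m → B) (a : Matrix (Fin l) (Fin n) ℕ) (r : ℕ) (hrl : r ≤ l)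
      (hrn : r ≤ n) (_ : n + m ≤ d + r) (α : Fin d → K),
      (Ideal.span (Set.range x') = maximalIdeal A ∧
        Associated (∏ j, x' (Fin.castLE hn j)) (∏ j, x (Fin.castLE hn j))) ∧
      (Ideal.span (Set.range y') = maximalIdeal B ∧
        Associated (∏ j, y' (Fin.castLE hl j)) (∏ j, y (Fin.castLE hl j))) ∧
      (∀ i : Fin r, Φ (y' (Fin.castLE (hrl.trans hl) i)) =
        ∏ j : Fin n, x' (Fin.castLE hn j) ^ a (Fin.castLE hrl i) j) ∧
      (∀ (i : Fin l) (_ : r ≤ (i : ℕ)), Φ (y' (Fin.castLE hl i)) =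
        (∏ j : Fin n, x' (Fin.castLE hn j) ^ a i j) *
          (x' ⟨n - r + i, by omega⟩ + k (α ⟨n - r + i, by omega⟩))) ∧
      (∀ (i : Fin m) (_ : l ≤ (i : ℕ)), Φ (y' i) = x' ⟨n - r + i, by omega⟩) ∧
      (∀ k : Fin d, n ≤ (k : ℕ) → (k : ℕ) < n + (l - r) → α k ≠ 0) ∧
      (a.map (Nat.cast : ℕ → ℚ)).rank = r ∧
      ((a.map (Nat.cast : ℕ → ℚ)).submatrix (Fin.castLE hrl) (Fin.castLE hrn)).rank = r ∧
      (∀ j : Fin n, 0 < ∑ i : Fin l, a i j) ∧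
      (∀ i : Fin l, 0 < ∑ j : Fin n, a i j) := by
  have := h.isDomain
  choose s₁ hs₁ using C'.exists_single
  -- The first `l` members are units times single parameters of `B`; the remaining ones have
  -- exponent zero, so only their units matter.
  obtain ⟨f₀, hf₀, hf₀s, hf₀b⟩ := exists_adapted_family C'.b (fun i => (s₁ i : Fin m → ℤ)) hs₁ hl
  obtain ⟨r, hrl, hrn, ρ, π, hr, hdet, hq⟩ := exists_perm_leading_minor
    (Matrix.of fun (i : Fin l) (j : Fin n) => (C.b (γ (s₁ i)) j : ℚ))
  choose q hq using hq
  -- the permuted family of monomials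
  let e : Fin l ↪ Fin m := ⟨Fin.castLE hl, Fin.castLE_injective hl⟩
  let f : Fin m → Fin m → ℤ := f₀ ∘ ρ.viaEmbedding e
  have hfl : ∀ i : Fin l, f (Fin.castLE hl i) = s₁ (ρ i) := by
    intro i
    have : ρ.viaEmbedding e (Fin.castLE hl i) = Fin.castLE hl (ρ i) :=
      Equiv.Perm.viaEmbedding_apply ρ e i
    simp only [f, Function.comp_apply, this, hf₀s]
  have hfb : ∀ i : Fin m, l ≤ (i : ℕ) → C'.b (f i) = 0 := by
    intro i hi
    have : ρ.viaEmbedding e i = i := by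
      refine Equiv.Perm.viaEmbedding_apply_of_notMem ρ e i ?_
      rintro ⟨j, rfl⟩
      exact absurd j.2 (not_lt.mpr hi)
    simp only [f, Function.comp_apply, this]
    exact hf₀b i hi
  have hf : LinearIndependent ℤ f := hf₀.comp _ (Equiv.injective _)
  let a : Matrix (Fin l) (Fin n) ℕ := fun i j => (C.b (γ (s₁ (ρ i))) (π j)).toNat
  have ha : ∀ i j, (a i j : ℤ) = C.b (γ (s₁ (ρ i))) (π j) := fun i j =>
    Int.toNat_of_nonneg (C.nonneg ⟨_, hγ _⟩ _)
  have haQ : a.map (Nat.cast : ℕ → ℚ) =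
      (Matrix.of fun (i : Fin l) (j : Fin n) => (C.b (γ (s₁ i)) j : ℚ)).submatrix ρ π := by
    ext i j
    simp only [Matrix.map_apply, Matrix.submatrix_apply, Matrix.of_apply, ← ha, Int.cast_natCast]
  -- roots
  obtain ⟨v, hv⟩ := exists_sum_smul_eq (G := Additive Aˣ)
    (fun N hN g => by
      obtain ⟨w, hw⟩ := exists_pow_eq_unit J hN (Additive.toMul g)
      exact ⟨Additive.ofMul w, congrArg Additive.ofMul hw⟩)
    (Matrix.of fun i j : Fin r => (a (Fin.castLE hrl i) (Fin.castLE hrn j) : ℤ))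
    (by
      rw [← haQ] at hdet
      intro h0
      apply hdet
      have := congrArg (Int.castRingHom ℚ) h0
      rw [RingHom.map_det, map_zero] at this
      rw [← this]
      congr 1)
    (fun i => C.u (γ (s₁ (ρ (Fin.castLE hrl i)))))
  -- Only the first `r` parameters are rescaled, by the solution `v` of the system given by the
  -- leading minor. The unit that remains in the `i`-th monomial is `w i`, and `v` is chosen to make
  -- it trivial for `i < r`.
  let v' : Fin n → Additive Aˣ := fun j => if hj : (j : ℕ) < r then v ⟨j, hj⟩ else 0
  let w : Fin m → Additive Aˣ := fun i => C.u (γ (f i)) - ∑ j, C.b (γ (f i)) (π j) • v' j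
  have hw0 : ∀ i : Fin m, (i : ℕ) < r → w i = 0 := by
    intro i hi
    obtain ⟨i, rfl⟩ : ∃ i' : Fin r, i = Fin.castLE hl (Fin.castLE hrl i') := ⟨⟨i, hi⟩, rfl⟩
    simp only [w, hfl, sub_eq_zero]
    rw [← hv i, sum_castLE hrn _ fun j hj => by simp [v', Nat.not_lt.mpr hj]]
    refine Finset.sum_congr rfl fun j _ => ?_
    simp [v', ← ha]
  have hw0' : ∀ i : Fin r, w (Fin.castLE hl (Fin.castLE hrl i)) = 0 := fun i => hw0 _ i.2
  -- the transversal parameters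
  let idx : Fin (m - r) → Fin m := fun i => ⟨r + i, by omega⟩
  have hdlog : ∀ i : Fin m, J.dlog (C.u (γ (f i))) = J.dlog (w i) +
      ∑ j, (C.b (γ (f i)) (π j) : K) • J.dlog (v' j) := by
    intro i
    simp only [w, map_sub, map_sum, map_zsmul, Int.cast_smul_eq_zsmul, sub_add_cancel]
  have hγf : LinearIndependent ℤ fun i => γ (f i) :=
    hf.map' γ.toIntLinearMap (LinearMap.ker_eq_bot.mpr hγi)
  -- `Q` expresses the lower exponent rows through the first `r` rows; rows with index at least `l`
  -- are zero.
  let Q : Fin (m - r) → Fin r → K := fun i i' =>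
    if hi : r + (i : ℕ) < l then (q ⟨r + i, hi⟩ i' : K) else 0
  have hbl : ∀ i : Fin m, l ≤ (i : ℕ) → C.b (γ (f i)) = 0 := fun i hi =>
    (C.map_unit h C' Φ γ hγ hΦ s₀ hs₀ (f i) (hfb i hi)).1
  have hQ : ∀ i j, (C.b (γ (f (idx i))) (π j) : K) =
      ∑ i', Q i i' * (C.b (γ (f (Fin.castLE hl (Fin.castLE hrl i')))) (π j) : K) := by
    intro i j
    by_cases hi : r + (i : ℕ) < l
    · have h1 : idx i = Fin.castLE hl ⟨r + i, hi⟩ := rfl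
      have h2 := hq ⟨r + i, hi⟩ j
      rw [h1]
      simp only [hfl, Q, hi, dif_pos]
      simp only [Matrix.submatrix_apply, Matrix.of_apply] at h2
      have h3 := congrArg (Rat.castHom K) h2
      simpa using h3
    · rw [hbl (idx i) (by simpa [idx] using hi)]
      simp [Q, hi]
  have hind := linearIndependent_sub_sum (L₁ := fun i => C.logVec
    (γ (f (Fin.castLE hl (Fin.castLE hrl i))))) (L₂ := fun i => C.logVec (γ (f (idx i))))
    (by
      have h1 := hC _ _ (hγf.comp (Sum.elim (fun i => Fin.castLE hl (Fin.castLE hrl i)) idx) (by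
        rintro (i | i) (j | j) hij
        · exact congrArg _ (Fin.ext (by simpa using congrArg Fin.val hij))
        · have h2 : (i : ℕ) = r + j := congrArg Fin.val hij
          have := i.2
          omega
        · have h2 : r + (i : ℕ) = j := congrArg Fin.val hij
          have := j.2
          omega
        · exact congrArg _ (Fin.ext (by simpa [idx] using congrArg Fin.val hij))))
      rw [show Sum.elim (fun i => C.logVec (γ (f (Fin.castLE hl (Fin.castLE hrl i)))))
        (fun i => C.logVec (γ (f (idx i)))) = fun i => C.logVec (((fun i => γ (f i)) ∘
          Sum.elim (fun i => Fin.castLE hl (Fin.castLE hrl i)) idx) i) by ext1 (i | i) <;> rfl]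
      exact h1) Q
  -- Subtracting the `Q`-combination of the first `r` logarithmic vectors from a lower one kills the
  -- first `n` entries and leaves `dlog (w i)` in the others: the contributions of `v'` cancel, and
  -- the first `r` of the `w` are trivial.
  have hli : LinearIndependent K (Fin.addCases
      (fun j => (Pi.single (Fin.castLE hn (π j)) 1 : Fin d → K))
      (fun i => J.dlog (w (idx i))) : Fin (n + (m - r)) → Fin d → K) := by
    refine linearIndependent_addCases_single _ ((Fin.castLE_injective hn).comp π.injective) _
      fun c hc => ?_
    rw [Fintype.linearIndependent_iff] at hind
    ext i
    refine hind c ?_ i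
    ext t
    simp only [Finset.sum_apply, Pi.smul_apply, smul_eq_mul, C.logVec_apply, Pi.sub_apply,
      Pi.zero_apply]
    by_cases ht : (t : ℕ) < n
    · refine Finset.sum_eq_zero fun i _ => ?_
      obtain ⟨j, hj⟩ := π.surjective ⟨t, ht⟩
      simp only [ht, dif_pos, ← hj, hQ, sub_self, mul_zero]
    · simp only [ht, dif_neg, not_false_eq_true]
      rw [← hc t (by rintro ⟨j, rfl⟩; exact ht (π j).2)]
      refine Finset.sum_congr rfl fun i _ => ?_
      congr 1
      simp only [hdlog, hQ, Pi.add_apply, Finset.sum_apply, Pi.smul_apply, smul_eq_mul]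
      simp only [hw0', map_zero, Pi.zero_apply,
        zero_add, Finset.mul_sum, Finset.sum_mul]
      rw [Finset.sum_comm]
      simp only [mul_assoc, add_sub_cancel_right]
  let z : Fin (n + (m - r)) → A := Fin.addCases
    (fun j => (Additive.toMul (v' j) : Aˣ) * x (Fin.castLE hn (π j)))
    (fun i => (Additive.toMul (w (idx i)) : Aˣ) - k (J.res (Additive.toMul (w (idx i)) : Aˣ)))
  obtain ⟨hN, x', hx', hz⟩ := exists_coord_extend h J z
    (by
      intro i
      induction i using Fin.addCases with
      | left i =>
        simp only [z, Fin.addCases_left]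
        exact Ideal.mul_mem_left _ _ (h.mem _)
      | right i =>
        simp only [z, Fin.addCases_right]
        exact J.sub_const_mem _)
    (linearIndependent_of_eq_smul hli (by
      intro i
      induction i using Fin.addCases with
      | left i =>
        simp only [z, Fin.addCases_left]
        exact ⟨_, (J.isUnit_iff _).mp (Units.isUnit _), J.lin_unit_mul_coord h _ _⟩
      | right i =>
        simp only [z, Fin.addCases_right, J.lin_sub_const, J.lin_unit]
        exact ⟨_, (J.isUnit_iff _).mp (Units.isUnit _), rfl⟩))
  have hz1 : ∀ j : Fin n, x' (Fin.castLE hn j) =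
      (Additive.toMul (v' j) : Aˣ) * x (Fin.castLE hn (π j)) := by
    intro j
    have := hz (Fin.castAdd _ j)
    simp only [z, Fin.addCases_left] at this
    exact this
  have hz2 : ∀ (i : Fin m) (_ : r ≤ (i : ℕ)) (hd : n - r + i < d), x' ⟨n - r + i, hd⟩ =
      (Additive.toMul (w i) : Aˣ) - k (J.res (Additive.toMul (w i) : Aˣ)) := by
    intro i hi hd
    have := hz (Fin.natAdd n ⟨i - r, by omega⟩)
    simp only [z, Fin.addCases_right] at this
    have h1 : idx ⟨i - r, by omega⟩ = i := Fin.ext (by simp [idx]; omega)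
    rw [h1] at this
    rw [← this]
    congr 1
    ext
    simp
    omega
  let y' : Fin m → B := fun i => if hi : (i : ℕ) < l then χ' (s₁ (ρ ⟨i, hi⟩)) else
    (Additive.toMul (C'.u (f i)) : Bˣ) - kB (J'.res (Additive.toMul (C'.u (f i)) : Bˣ))
  have hy1 : ∀ i : Fin l, y' (Fin.castLE hl i) = χ' (s₁ (ρ i)) := fun i => by
    simp [y']
  have hy2 : ∀ i : Fin m, l ≤ (i : ℕ) → y' i = (Additive.toMul (C'.u (f i)) : Bˣ) -
      kB (J'.res (Additive.toMul (C'.u (f i)) : Bˣ)) := fun i hi => by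
    simp [y', Nat.not_lt.mpr hi]
  have hy3 : ∀ i : Fin l, y' (Fin.castLE hl i) =
      (Additive.toMul (C'.u (s₁ (ρ i))) : Bˣ) * y (Fin.castLE hl (ρ i)) := by
    intro i
    rw [hy1, C'.eq_mul, hs₁, Finset.prod_eq_single (ρ i)]
    · simp
    · intro j _ hj
      simp [hj]
    · simp
  have hmon : ∀ i : Fin l, Φ (y' (Fin.castLE hl i)) =
      (∏ j : Fin n, x' (Fin.castLE hn j) ^ a i j) * (Additive.toMul (w (Fin.castLE hl i)) : Aˣ) := by
    intro i
    have h1 : C.u (γ (s₁ (ρ i))) = w (Fin.castLE hl i) + ∑ j, a i j • v' j := by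
      simp only [w, hfl, ← ha, natCast_zsmul, sub_add_cancel]
    rw [hy1, hΦ, C.eq_mul, h1, toMul_add, toMul_sum, Units.val_mul, Units.coe_prod,
      ← Equiv.prod_comp π fun j => x (Fin.castLE hn j) ^ (C.b (γ (s₁ (ρ i))) j).toNat]
    simp only [hz1, mul_pow, Finset.prod_mul_distrib, toMul_nsmul, Units.val_pow_eq_pow_val, a]
    ring
  -- For `t = n - r + i` with `i ≥ r` this is the residue of `w i`. The normal form reads `α` only
  -- at indices of this kind with `i < l`.
  let α : Fin d → K := fun t => if ht : r + ((t : ℕ) - n) < m then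
    J.res (Additive.toMul (w ⟨r + (t - n), ht⟩) : Aˣ) else 0
  have hα : ∀ (i : Fin m) (_ : r ≤ (i : ℕ)) (hd : n - r + i < d), α ⟨n - r + i, hd⟩ =
      J.res (Additive.toMul (w i) : Aˣ) := by
    intro i hi hd
    have h1 : r + (n - r + i - n) = (i : ℕ) := by omega
    simp only [α, h1, i.2, dif_pos]
  refine ⟨x', y', a, r, hrl, hrn, by omega, α, ⟨hx', ?_⟩, ⟨?_, ?_⟩, ?_, ?_, ?_, ?_, ?_, ?_, ?_, ?_⟩
  · simp only [hz1, Finset.prod_mul_distrib]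
    rw [Equiv.prod_comp π fun j => x (Fin.castLE hn j), ← Units.coe_prod]
    exact (associated_isUnit_mul_left_iff (Units.isUnit _)).mpr (Associated.refl _)
  · exact C'.span_parameters h' (hC' _ _ hf) ρ hfb y' (fun i => ⟨_, hy3 i⟩) hy2
  · simp only [hy3, Finset.prod_mul_distrib]
    rw [Equiv.prod_comp ρ fun j => y (Fin.castLE hl j), ← Units.coe_prod]
    exact (associated_isUnit_mul_left_iff (Units.isUnit _)).mpr (Associated.refl _)
  · intro i
    have := hmon (Fin.castLE hrl i)
    rw [hw0 _ i.2, toMul_zero, Units.val_one, mul_one] at this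
    exact this
  · intro i hi
    have h1 := hz2 (Fin.castLE hl i) hi
    have h2 := hα (Fin.castLE hl i) hi
    simp only [Fin.val_castLE] at h1 h2
    have hd : n - r + (i : ℕ) < d := by omega
    rw [hmon, h1 hd, h2 hd, sub_add_cancel]
  · intro i hi
    obtain ⟨hb, hu⟩ := C.map_unit h C' Φ γ hγ hΦ s₀ hs₀ (f i) (hfb i hi)
    have hwi : w i = Additive.ofMul (Units.map Φ (Additive.toMul (C'.u (f i)))) := by
      simp [w, hb, hu]
    rw [hy2 i hi, hz2 i (hrl.trans hi), hwi, map_sub, hk]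
    simp only [toMul_ofMul, Units.coe_map, MonoidHom.coe_coe]
    rw [J.res_map J' Φ hk]
  · intro t ht1 ht2
    have := hα ⟨r + (t - n), by omega⟩ (by simp) (by simp; omega)
    have h1 : (⟨n - r + (r + (t - n)), by omega⟩ : Fin d) = t := Fin.ext (by simp; omega)
    simp only [h1] at this
    rw [this]
    exact (J.isUnit_iff _).mp (Units.isUnit _)
  · rw [haQ, Matrix.rank_submatrix, ← hr]
  · rw [haQ, Matrix.rank_of_isUnit _ ((Matrix.isUnit_iff_isUnit_det _).mpr hdet.isUnit),
      Fintype.card_fin]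
  · intro j
    rw [Finset.sum_pos_iff]
    -- The equation of the divisor divides the pullback of the equation downstairs, so the prime
    -- `x_(π j)` divides some `Φ (y' i)`, and then `a i j` cannot be zero.
    have h1 : x (Fin.castLE hn (π j)) ∣ Φ (∏ i, y' (Fin.castLE hl i)) := by
      refine (Finset.dvd_prod_of_mem (fun j => x (Fin.castLE hn j)) (Finset.mem_univ (π j))).trans
        (hdvd.trans ?_)
      refine map_dvd Φ ?_
      simp only [hy3, Finset.prod_mul_distrib]
      rw [Equiv.prod_comp ρ fun j => y (Fin.castLE hl j)]
      exact Dvd.intro_left _ rfl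
    rw [map_prod] at h1
    obtain ⟨i, -, h2⟩ := (h.prime _).exists_mem_finset_dvd h1
    refine ⟨i, Finset.mem_univ _, Nat.pos_of_ne_zero fun h0 => ?_⟩
    rw [hmon, Units.dvd_mul_right] at h2
    obtain ⟨j', -, h3⟩ := (h.prime _).exists_mem_finset_dvd h2
    have hjj : j' = j := by
      by_contra hne
      have h4 := (h.prime _).dvd_of_dvd_pow h3
      rw [hz1, Units.dvd_mul_left] at h4
      refine h.not_dvd ?_ h4
      intro h5
      exact hne (π.injective (Fin.castLE_injective hn h5)).symm
    subst hjj
    rw [h0, pow_zero] at h3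
    exact (h.prime _).not_isUnit (isUnit_of_dvd_one h3)
  · intro i
    rw [Finset.sum_pos_iff]
    by_contra! h0
    have h1 : ∀ j, a i j = 0 := fun j => Nat.le_zero.mp (h0 j (Finset.mem_univ _))
    have h2 := hmon i
    simp only [h1, pow_zero, Finset.prod_const_one, one_mul] at h2
    -- With a zero row the image of `y' i` is a unit. As `Φ` is local, `y' i` would be a unit,
    -- although it is a prime times a unit.
    have h3 : IsUnit (y' (Fin.castLE hl i)) := by
      refine (isUnit_map_iff Φ _).mp ?_
      rw [h2]
      exact Units.isUnit _
    rw [hy3, Units.isUnit_units_mul] at h3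
    exact (h'.prime _).not_isUnit h3

end NormalForm

/-! ### Affine toric varieties -/

section Cones

variable {d : ℕ}

/-- Nonnegativity on a cone can be tested on generators, and the zero generator can be dropped.
Having only nonzero generators is what makes strong convexity applicable in
`ToricCone.exists_interior`. -/
theorem ToricCone.exists_generators (σ : ToricCone d) : ∃ S : Finset (Fin d → ℤ),
    (∀ v ∈ S, v ≠ 0 ∧ (fun i => (v i : ℝ)) ∈ σ.cone) ∧
    ∀ a : Fin d → ℤ, a ∈ σ.semigroup ↔ ∀ v ∈ S, 0 ≤ ∑ i, a i * v i := by
  classical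
  obtain ⟨S, hS⟩ := σ.rational
  have hcone : ∀ v ∈ S, (fun i => (v i : ℝ)) ∈ σ.cone := fun v hv => by
    rw [hS]
    exact PointedCone.subset_hull ⟨v, hv, rfl⟩
  refine ⟨S.filter (· ≠ 0), fun v hv => ?_, fun a => ⟨fun ha v hv => ?_, fun ha => ?_⟩⟩
  · rw [Finset.mem_filter] at hv
    exact ⟨hv.2, hcone v hv.1⟩
  · rw [Finset.mem_filter] at hv
    have := ha _ (hcone v hv.1)
    exact_mod_cast this
  · intro v hv
    rw [hS] at hv
    induction hv using Submodule.span_induction with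
    | mem v hv =>
      obtain ⟨w, hw, rfl⟩ := hv
      by_cases h0 : w = 0
      · simp [h0]
      · have := ha w (Finset.mem_filter.mpr ⟨hw, h0⟩)
        have h1 : (0 : ℝ) ≤ ∑ i, (a i : ℝ) * (w i : ℝ) := by exact_mod_cast this
        exact h1
    | zero => simp
    | add v w _ _ hv hw =>
      simpa [mul_add, Finset.sum_add_distrib] using add_nonneg hv hw
    | smul c v _ hv =>
      have : ∑ i, (a i : ℝ) * (c • v) i = c * ∑ i, (a i : ℝ) * v i := by
        rw [Finset.mul_sum]
        refine Finset.sum_congr rfl fun i _ => ?_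
        change (a i : ℝ) * ((c : ℝ) * v i) = _
        ring
      rw [this]
      exact mul_nonneg c.2 hv

/-- Gordan's lemma. -/
theorem ToricCone.semigroup_fg (σ : ToricCone d) : σ.semigroup.FG := by
  classical
  obtain ⟨S, -, hS⟩ := σ.exists_generators
  -- Write a lattice point as a difference of two vectors `p`, `q` with entries in `ℕ`. Membership
  -- becomes `p · v = q · v + slack` with a slack in `ℕ` for each generator `v`. The solutions in
  -- `ℕ` of linear equations are finitely generated by Dickson's lemma, and `D` maps them onto the
  -- semigroup.
  have : WellQuasiOrderedLE (Fin d ⊕ Fin d ⊕ S → ℕ) := inferInstance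
  let F : (Fin d ⊕ Fin d ⊕ S → ℕ) →+ (S → ℤ) :=
    { toFun := fun p v => ∑ i, (p (Sum.inl i) : ℤ) * v.1 i
      map_zero' := by ext; simp
      map_add' := by intro p q; ext; simp [add_mul, Finset.sum_add_distrib] }
  let G : (Fin d ⊕ Fin d ⊕ S → ℕ) →+ (S → ℤ) :=
    { toFun := fun p v => ∑ i, (p (Sum.inr (Sum.inl i)) : ℤ) * v.1 i + p (Sum.inr (Sum.inr v))
      map_zero' := by ext; simp
      map_add' := by
        intro p q
        ext
        simp [add_mul, Finset.sum_add_distrib]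
        ring }
  let D : (Fin d ⊕ Fin d ⊕ S → ℕ) →+ (Fin d → ℤ) :=
    { toFun := fun p i => (p (Sum.inl i) : ℤ) - p (Sum.inr (Sum.inl i))
      map_zero' := by ext; simp
      map_add' := by
        intro p q
        ext
        simp
        ring }
  convert (AddSubmonoid.fg_eqLocusM F G).map D using 1
  ext a
  rw [hS, AddSubmonoid.mem_map]
  constructor
  · intro ha
    refine ⟨Sum.elim (fun i => (a i).toNat) (Sum.elim (fun i => (-a i).toNat)
      fun v => (∑ i, a i * v.1 i).toNat), ?_, ?_⟩
    · rw [AddMonoidHom.mem_eqLocusM]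
      ext v
      simp only [F, G, AddMonoidHom.coe_mk, ZeroHom.coe_mk, Sum.elim_inl, Sum.elim_inr]
      rw [Int.toNat_of_nonneg (ha v.1 v.2), ← Finset.sum_add_distrib]
      refine Finset.sum_congr rfl fun i _ => ?_
      rw [← add_mul]
      congr 1
      omega
    · ext i
      simp only [D, AddMonoidHom.coe_mk, ZeroHom.coe_mk, Sum.elim_inl, Sum.elim_inr]
      omega
  · rintro ⟨p, hp, rfl⟩ v hv
    have := congrFun (AddMonoidHom.mem_eqLocusM.mp hp) ⟨v, hv⟩
    simp only [F, G, D, AddMonoidHom.coe_mk, ZeroHom.coe_mk, sub_mul, Finset.sum_sub_distrib]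
      at this ⊢
    rw [this]
    simp

/-- The condition is open, so it has a rational solution near the real one; multiplying by all
denominators makes it integral. -/
theorem exists_int_of_finset_pos (S : Finset (Fin d → ℤ)) (c : Fin d → ℝ)
    (hc : ∀ v ∈ S, 0 < ∑ i, c i * (v i : ℝ)) :
    ∃ s : Fin d → ℤ, ∀ v ∈ S, 0 < ∑ i, s i * v i := by
  have hopen : IsOpen {c : Fin d → ℝ | ∀ v ∈ S, 0 < ∑ i, c i * (v i : ℝ)} := by
    simp only [Set.ofPred_forall]
    refine isOpen_biInter_finset fun v _ => ?_
    exact isOpen_lt continuous_const (by fun_prop)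
  have hdense : DenseRange (fun (q : Fin d → ℚ) (i : Fin d) => (q i : ℝ)) :=
    DenseRange.piMap fun _ => Rat.isDenseEmbedding_coe_real.dense
  obtain ⟨q, hq⟩ := hdense.exists_mem_open hopen ⟨c, hc⟩
  refine ⟨fun i => (q i).num * ∏ j ∈ Finset.univ.erase i, ((q j).den : ℤ), fun v hv => ?_⟩
  have h1 : 0 < ∑ i, q i * (v i : ℚ) := by
    have : 0 < ∑ i, (q i : ℝ) * (v i : ℝ) := hq v hv
    exact_mod_cast this
  have h2 : (0 : ℚ) < ∏ j, ((q j).den : ℚ) := Finset.prod_pos fun j _ => by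
    exact_mod_cast (q j).den_pos
  have h3 := mul_pos h2 h1
  have h4 : (∏ j, ((q j).den : ℚ)) * ∑ i, q i * (v i : ℚ) =
      ((∑ i, ((q i).num * ∏ j ∈ Finset.univ.erase i, ((q j).den : ℤ)) * v i : ℤ) : ℚ) := by
    push_cast
    rw [Finset.mul_sum]
    refine Finset.sum_congr rfl fun i _ => ?_
    rw [← Finset.mul_prod_erase _ _ (Finset.mem_univ i), ← mul_assoc]
    congr 1
    rw [mul_right_comm, Rat.den_mul_eq_num]
  rw [h4] at h3
  exact_mod_cast h3

/-- Strongly convex cones have lattice points in the interior of the dual cone. -/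
theorem ToricCone.exists_interior (σ : ToricCone d) :
    ∃ s₀ : σ.semigroup, ∀ t : Fin d → ℤ, ∃ N : ℕ, N • (s₀ : Fin d → ℤ) + t ∈ σ.semigroup := by
  classical
  obtain ⟨S, hSc, hS⟩ := σ.exists_generators
  -- If `s` is positive, hence at least one, on every generator, then `N s + t` is nonnegative as
  -- soon as `N` exceeds all `|t · v|`; the sum of these numbers is such an `N`.
  suffices h : ∃ s : Fin d → ℤ, ∀ v ∈ S, 0 < ∑ i, s i * v i by
    obtain ⟨s, hs⟩ := h
    refine ⟨⟨s, (hS s).mpr fun v hv => (hs v hv).le⟩, fun t =>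
      ⟨∑ v ∈ S, (∑ i, t i * v i).natAbs, (hS _).mpr fun v hv => ?_⟩⟩
    have h1 : (∑ i, t i * v i).natAbs ≤ ∑ v ∈ S, (∑ i, t i * v i).natAbs :=
      Finset.single_le_sum (f := fun v => (∑ i, t i * v i).natAbs) (fun _ _ => Nat.zero_le _) hv
    generalize ∑ v ∈ S, (∑ i, t i * v i).natAbs = N at h1
    have h2 : ∑ i, (N • s + t) i * v i = N * ∑ i, s i * v i + ∑ i, t i * v i := by
      rw [Finset.mul_sum, ← Finset.sum_add_distrib]
      refine Finset.sum_congr rfl fun i _ => ?_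
      simp only [Pi.add_apply, nsmul_eq_mul, Pi.mul_apply, Pi.natCast_apply]
      ring
    rw [h2]
    have h3 := hs v hv
    have h4 : (N : ℤ) * 1 ≤ N * ∑ i, s i * v i := by
      refine mul_le_mul_of_nonneg_left (by omega) (by positivity)
    omega
  let T : Finset (Fin d → ℝ) := S.image fun v i => (v i : ℝ)
  have hT0 : ∀ v ∈ T, v ≠ 0 ∧ v ∈ σ.cone := by
    intro v hv
    obtain ⟨w, hw, rfl⟩ := Finset.mem_image.mp hv
    refine ⟨fun h => (hSc w hw).1 ?_, (hSc w hw).2⟩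
    ext i
    have : (w i : ℝ) = 0 := congrFun h i
    exact_mod_cast this
  -- If a convex combination of the generators vanished, a nonzero term and its negative would both
  -- be in the cone. Separating `0` from the convex hull then gives a functional that is positive on
  -- the generators.
  have h0 : (0 : Fin d → ℝ) ∉ convexHull ℝ (T : Set (Fin d → ℝ)) := by
    intro h
    rw [Finset.convexHull_eq] at h
    obtain ⟨w, hw0, hw1, hw⟩ := h
    rw [Finset.centerMass_eq_of_sum_1 _ _ hw1] at hw
    obtain ⟨v, hv, hvw⟩ : ∃ v ∈ T, w v ≠ 0 := by
      by_contra! h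
      rw [Finset.sum_eq_zero h] at hw1
      exact zero_ne_one hw1
    have hmem : ∀ v ∈ T, w v • v ∈ σ.cone := fun v hv =>
      σ.cone.smul_mem (hw0 v hv) (hT0 v hv).2
    have h1 : w v • v = 0 := by
      refine σ.strongly_convex _ (hmem v hv) ?_
      have : -(w v • v) = ∑ u ∈ T.erase v, w u • u := by
        rw [neg_eq_iff_add_eq_zero, Finset.add_sum_erase _ (fun u => w u • u) hv]
        exact hw
      rw [this]
      exact sum_mem fun u hu => hmem u (Finset.mem_of_mem_erase hu)
    exact (smul_ne_zero hvw (hT0 v hv).1) h1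
  obtain ⟨f, u, hu, hf⟩ := geometric_hahn_banach_point_closed (convex_convexHull ℝ _)
    (T.finite_toSet.isClosed_convexHull ℝ) h0
  rw [map_zero] at hu
  refine exists_int_of_finset_pos S (fun i => f (Pi.single i 1)) fun v hv => ?_
  have h1 := hf (fun i => (v i : ℝ)) (subset_convexHull ℝ _ (Finset.mem_image_of_mem _ hv))
  have h2 : f (fun i => (v i : ℝ)) = ∑ i, f (Pi.single i 1) * (v i : ℝ) := by
    conv_lhs => rw [pi_eq_sum_univ' fun i => (v i : ℝ)]
    rw [map_sum]
    refine Finset.sum_congr rfl fun i _ => ?_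
    rw [map_smul, smul_eq_mul, mul_comm]
  rw [← h2]
  exact hu.trans h1

end Cones

/-! ### Stalks of affine schemes -/

section SpecStalk

variable (R : CommRingCat.{u}) (x : Spec R)

instance isPrime_asIdeal : x.asIdeal.IsPrime := PrimeSpectrum.isPrime x

/-- The canonical map from `R` to the stalks of `Spec R`. -/
def specGerm : R →+* (Spec R).presheaf.stalk x :=
  ((Scheme.ΓSpecIso R).inv ≫ (Spec R).presheaf.germ ⊤ x trivial).hom

theorem isLocalization_specGerm :
    @IsLocalization.AtPrime R _ ((Spec R).presheaf.stalk x) _ (specGerm R x).toAlgebra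
      x.asIdeal _ :=
  StructureSheaf.IsLocalization.to_stalk R x

theorem exists_mul_specGerm (a : (Spec R).presheaf.stalk x) :
    ∃ r s : R, s ∉ x.asIdeal ∧ a * specGerm R x s = specGerm R x r := by
  let := (specGerm R x).toAlgebra
  have := isLocalization_specGerm R x
  obtain ⟨⟨r, s⟩, h⟩ := IsLocalization.surj x.asIdeal.primeCompl a
  exact ⟨r, s, s.2, h⟩

theorem isUnit_specGerm_iff (r : R) : IsUnit (specGerm R x r) ↔ r ∉ x.asIdeal := by
  let := (specGerm R x).toAlgebra
  have := isLocalization_specGerm R x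
  exact IsLocalization.AtPrime.isUnit_to_map_iff _ x.asIdeal r

theorem specGerm_mem_maximalIdeal_iff (r : R) :
    specGerm R x r ∈ maximalIdeal ((Spec R).presheaf.stalk x) ↔ r ∈ x.asIdeal := by
  rw [mem_maximalIdeal, mem_nonunits_iff, isUnit_specGerm_iff, not_not]

theorem maximalIdeal_specStalk : maximalIdeal ((Spec R).presheaf.stalk x) =
    x.asIdeal.map (specGerm R x) := by
  let := (specGerm R x).toAlgebra
  have := isLocalization_specGerm R x
  exact (IsLocalization.AtPrime.map_eq_maximalIdeal x.asIdeal _).symm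

theorem isNoetherianRing_specStalk [IsNoetherianRing R] :
    IsNoetherianRing ((Spec R).presheaf.stalk x) := by
  let := (specGerm R x).toAlgebra
  have := isLocalization_specGerm R x
  exact IsLocalization.isNoetherianRing x.asIdeal.primeCompl _ inferInstance

theorem stalkIdeal_compl_basicOpen (f : R) :
    stalkIdeal (Spec R) ((PrimeSpectrum.basicOpen f : Set (PrimeSpectrum R))ᶜ) x =
      (Ideal.span {specGerm R x f}).radical := by
  rw [stalkIdeal, Spec.fromSpecStalk_eq, ← PrimeSpectrum.vanishingIdeal_zeroLocus_eq_radical]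
  congr 1
  ext q
  rw [PrimeSpectrum.zeroLocus_span, PrimeSpectrum.mem_zeroLocus, Set.singleton_subset_iff]
  change ¬ ¬ _ ↔ _
  rw [not_not]
  rfl

variable {R x} in
theorem stalkMap_specGerm {R' : CommRingCat.{u}} (θ : R' ⟶ R) (r : R') :
    ((Spec.map θ).stalkMap x).hom (specGerm R' (Spec.map θ x) r) = specGerm R x (θ r) := by
  have h := Scheme.Hom.germ_stalkMap (Spec.map θ) ⊤ x trivial
  have h2 : (Scheme.ΓSpecIso R').inv ≫ (Spec R').presheaf.germ ⊤ (Spec.map θ x) trivial ≫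
      (Spec.map θ).stalkMap x =
      θ ≫ (Scheme.ΓSpecIso R).inv ≫ (Spec R).presheaf.germ ⊤ x trivial := by
    rw [h, ← Category.assoc, ← Category.assoc, Scheme.ΓSpecIso_inv_naturality]
    rfl
  exact congrArg (fun f => f.hom r) h2

end SpecStalk

/-! ### Completion maps on elements of the local rings -/

section CompletionMap

variable {R S : Type u} [CommRing R] [IsLocalRing R] [CommRing S] [IsLocalRing S]

theorem completionMap_algebraMap (f : R →+* S) [IsLocalHom f] (r : R) :
    completionMap f (algebraMap R (Completion R) r) = algebraMap S (Completion S) (f r) := by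
  refine AdicCompletion.ext_evalₐ fun n => ?_
  rw [AlgHom.commutes, completionMap, AdicCompletion.evalₐ_liftRingHom, completionMapMod,
    RingHom.comp_apply, RingHom.coe_coe, AlgHom.commutes]
  rfl

theorem const_spec {K : Type u} [Field K] {R : Type u} [CommRing R] [Algebra K R]
    (x : Spec (CommRingCat.of R)) (c : K) :
    const (Spec.map (CommRingCat.ofHom (algebraMap K R))) x c =
      algebraMap _ (completedStalk _ x) (specGerm (CommRingCat.of R) x (algebraMap K R c)) := by
  have h : (Scheme.ΓSpecIso (CommRingCat.of K)).inv ≫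
      (Spec.map (CommRingCat.ofHom (algebraMap K R))).appTop =
      CommRingCat.ofHom (algebraMap K R) ≫ (Scheme.ΓSpecIso (CommRingCat.of R)).inv :=
    (Scheme.ΓSpecIso_inv_naturality _).symm
  rw [const, ← Category.assoc, h]
  rfl

end CompletionMap

/-! ### Semigroup algebras and the boundary of the torus -/

section Toric

variable {K : Type u} [Field K] {d : ℕ} (σ : ToricCone d)

/-- The character `χ ^ s` of the semigroup algebra. -/
abbrev character (s : σ.semigroup) : SemigroupAlgebra K σ := AddMonoidAlgebra.single s 1

instance : Algebra.FiniteType K (SemigroupAlgebra K σ) := by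
  have : AddMonoid.FG σ.semigroup := (AddMonoid.fg_iff_addSubmonoid_fg _).mpr σ.semigroup_fg
  infer_instance

instance : IsNoetherianRing (SemigroupAlgebra K σ) :=
  Algebra.FiniteType.isNoetherianRing K _

/-- The inclusion of `K[S_σ]` into `K[M]`. -/
def toTorus : SemigroupAlgebra K σ →ₐ[K] TorusAlgebra K d :=
  AddMonoidAlgebra.mapDomainAlgHom K K σ.semigroup.subtype

theorem toTorus_injective : Function.Injective (toTorus (K := K) σ) :=
  AddMonoidAlgebra.mapDomain_injective Subtype.val_injective

theorem toTorus_single (s : σ.semigroup) (c : K) :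
    toTorus σ (AddMonoidAlgebra.single s c) = AddMonoidAlgebra.single (s : Fin d → ℤ) c :=
  AddMonoidAlgebra.mapDomain_single

/-- Every Laurent monomial enters the semigroup algebra after multiplication by a power of `χ^s₀`.
Hence the torus is a basic open set, and the boundary is the zero set of the single function `χ^s₀`.
-/
theorem isLocalization_toTorus {s₀ : σ.semigroup}
    (hs₀ : ∀ t : Fin d → ℤ, ∃ N : ℕ, N • (s₀ : Fin d → ℤ) + t ∈ σ.semigroup) :
    @IsLocalization.Away (SemigroupAlgebra K σ) _ (character σ s₀) (TorusAlgebra K d) _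
      (toTorus σ).toRingHom.toAlgebra := by
  let := (toTorus (K := K) σ).toRingHom.toAlgebra
  have hpow : ∀ N : ℕ, toTorus (K := K) σ (character σ s₀) ^ N =
      AddMonoidAlgebra.single (N • (s₀ : Fin d → ℤ)) 1 := fun N => by
    rw [toTorus_single, AddMonoidAlgebra.single_pow, one_pow]
  have hmap : ∀ f, algebraMap (SemigroupAlgebra K σ) (TorusAlgebra K d) f = toTorus σ f :=
    fun _ => rfl
  refine IsLocalization.Away.mk _ ?_ (fun f => ?_) fun a b hab => ⟨0, ?_⟩
  · rw [hmap, toTorus_single]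
    refine IsUnit.of_mul_eq_one (AddMonoidAlgebra.single (-(s₀ : Fin d → ℤ)) 1) ?_
    rw [AddMonoidAlgebra.single_mul_single, add_neg_cancel, mul_one]
    rfl
  · simp only [hmap]
    induction f using AddMonoidAlgebra.induction_linear with
    | zero => exact ⟨0, 0, by simp⟩
    | add f g hf hg =>
      obtain ⟨n, a, ha⟩ := hf
      obtain ⟨m, b, hb⟩ := hg
      refine ⟨n + m, a * character σ s₀ ^ m + b * character σ s₀ ^ n, ?_⟩
      rw [map_add, map_mul, map_mul, ← ha, ← hb, map_pow, map_pow]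
      ring
    | single t c =>
      obtain ⟨N, hN⟩ := hs₀ t
      refine ⟨N, AddMonoidAlgebra.single ⟨_, hN⟩ c, ?_⟩
      rw [hpow, toTorus_single, AddMonoidAlgebra.single_mul_single, mul_one, add_comm]
  · rw [toTorus_injective σ hab]

theorem range_torusInclusion {s₀ : σ.semigroup}
    (hs₀ : ∀ t : Fin d → ℤ, ∃ N : ℕ, N • (s₀ : Fin d → ℤ) + t ∈ σ.semigroup) :
    Set.range (torusInclusion K σ) = (PrimeSpectrum.basicOpen (character (K := K) σ s₀) :
      Set (PrimeSpectrum (SemigroupAlgebra K σ))) := by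
  let := (toTorus (K := K) σ).toRingHom.toAlgebra
  have := isLocalization_toTorus (K := K) σ hs₀
  exact PrimeSpectrum.localization_away_comap_range (TorusAlgebra K d) _

theorem stalkIdeal_toricBoundary {s₀ : σ.semigroup}
    (hs₀ : ∀ t : Fin d → ℤ, ∃ N : ℕ, N • (s₀ : Fin d → ℤ) + t ∈ σ.semigroup)
    (p : toricVariety K σ) : stalkIdeal _ (toricBoundary K σ) p =
      (Ideal.span {specGerm _ p (character σ s₀)}).radical := by
  rw [toricBoundary, range_torusInclusion σ hs₀, ← stalkIdeal_compl_basicOpen]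

/-- The Nullstellensatz: `R/m` is finite over the algebraically closed field `K`, hence equal to it.
-/
theorem exists_sub_algebraMap_mem [IsAlgClosed K] {R : Type*} [CommRing R] [Algebra K R]
    [Algebra.FiniteType K R] (m : Ideal R) [m.IsMaximal] (a : R) :
    ∃ c : K, a - algebraMap K R c ∈ m := by
  let := Ideal.Quotient.field m
  have := finite_of_finite_type_of_isJacobsonRing K (R ⧸ m)
  obtain ⟨c, hc⟩ := (IsAlgClosed.algebraMap_bijective_of_isIntegral (k := K) (K := R ⧸ m)).2
    (Ideal.Quotient.mk m a)
  exact ⟨c, Ideal.Quotient.eq.mp hc.symm⟩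

theorem isMaximal_asIdeal {R : CommRingCat.{u}} {x : Spec R} (hx : IsClosed ({x} : Set (Spec R))) :
    x.asIdeal.IsMaximal := (PrimeSpectrum.isClosed_singleton_iff_isMaximal x).mp hx

/-- At a point with residue field `K` the maximal ideal is generated by the characters up to
constants. -/
theorem asIdeal_eq_span (P : Ideal (SemigroupAlgebra K σ)) (hP : P ≠ ⊤) (c : σ.semigroup → K)
    (hc : ∀ s, character σ s - algebraMap K _ (c s) ∈ P) :
    P = Ideal.span (Set.range fun s => character σ s - algebraMap K _ (c s)) := by
  refine le_antisymm ?_ (Ideal.span_le.mpr (Set.range_subset_iff.mpr hc))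
  -- Modulo the span every element is a constant, and a constant that lies in the proper ideal `P`
  -- is zero.
  have h : ∀ f : SemigroupAlgebra K σ, ∃ e : K, f - algebraMap K _ e ∈
      Ideal.span (Set.range fun s => character σ s - algebraMap K _ (c s)) := by
    intro f
    induction f using AddMonoidAlgebra.induction_linear with
    | zero => exact ⟨0, by simp⟩
    | add f g hf hg =>
      obtain ⟨e, he⟩ := hf
      obtain ⟨e', he'⟩ := hg
      refine ⟨e + e', ?_⟩
      rw [map_add, add_sub_add_comm]
      exact add_mem he he'
    | single s a =>
      refine ⟨a * c s, ?_⟩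
      have : (AddMonoidAlgebra.single s a : SemigroupAlgebra K σ) - algebraMap K _ (a * c s) =
          algebraMap K _ a * (character σ s - algebraMap K _ (c s)) := by
        rw [mul_sub, map_mul, ← Algebra.smul_def a (character σ s), AddMonoidAlgebra.smul_single,
          smul_eq_mul, mul_one]
      rw [this]
      exact Ideal.mul_mem_left _ _ (Ideal.subset_span ⟨s, rfl⟩)
  intro f hf
  obtain ⟨e, he⟩ := h f
  have h1 : algebraMap K (SemigroupAlgebra K σ) e ∈ P := by
    have := sub_mem hf ((Ideal.span_le.mpr (Set.range_subset_iff.mpr hc)) he)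
    rwa [sub_sub_cancel] at this
  have h2 : e = 0 := by
    by_contra h0
    exact hP (Ideal.eq_top_of_isUnit_mem _ h1 ((IsUnit.mk0 e h0).map _))
  rw [h2, map_zero, sub_zero] at he
  exact he

end Toric

/-! ### Characters in completed local rings and charts of local models -/

section ToricCharts

variable {K : Type u} [Field K] {d m : ℕ} {σ : ToricCone d} {τ : ToricCone m}

variable (K σ) in
/-- The characters as elements of the completed local rings. -/
def formalCharacter (p : toricVariety K σ) :
    Multiplicative σ.semigroup →* completedStalk (toricVariety K σ) p :=
  ((algebraMap ((toricVariety K σ).presheaf.stalk p) (completedStalk _ p)).comp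
    (specGerm _ p) : SemigroupAlgebra K σ →* _).comp (AddMonoidAlgebra.of K σ.semigroup)

theorem formalCharacter_apply (p : toricVariety K σ) (s : σ.semigroup) :
    formalCharacter K σ p (Multiplicative.ofAdd s) =
      algebraMap ((toricVariety K σ).presheaf.stalk p) _ (specGerm _ p (character σ s)) := rfl

/-- A bialgebra homomorphism preserves group-like elements, and those of `K[M]` are the characters,
so `g` comes from a lattice homomorphism `γ`. It respects the semigroups because the pullback of
`χ^s` already lies in `K[S_σ]`. -/
theorem IsToric.exists_addMonoidHom {ψ : toricVariety K σ ⟶ toricVariety K τ} (hψ : IsToric ψ) :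
    ∃ (γ : (Fin m → ℤ) →+ (Fin d → ℤ)) (hγ : ∀ s : τ.semigroup, γ s ∈ σ.semigroup),
      ∀ (p : toricVariety K σ) (s : τ.semigroup),
        completedStalkMap ψ p (formalCharacter K τ (ψ p) (Multiplicative.ofAdd s)) =
          formalCharacter K σ p (Multiplicative.ofAdd ⟨γ s, hγ s⟩) := by
  obtain ⟨g, hg⟩ := hψ
  obtain ⟨θ, rfl⟩ := Spec.map_surjective ψ
  rw [torusInclusion, torusInclusion, ← Spec.map_comp, ← Spec.map_comp] at hg
  have hθ : ∀ f : SemigroupAlgebra K τ, toTorus σ (θ.hom f) = g (toTorus τ f) := fun f =>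
    congrArg (fun h => h.hom f) (Spec.map_injective hg)
  have hgl : ∀ t : Fin m → ℤ, ∃ e : Fin d → ℤ,
      g (AddMonoidAlgebra.single t 1) = AddMonoidAlgebra.single e 1 := by
    intro t
    have h1 : IsGroupLikeElem K (AddMonoidAlgebra.single t 1 : TorusAlgebra K m) :=
      AddMonoidAlgebra.isGroupLikeElem_of _
    obtain ⟨e, he⟩ := AddMonoidAlgebra.isGroupLikeElem_iff_mem_range_of.mp (h1.map g)
    exact ⟨Multiplicative.toAdd e, he.symm⟩
  choose e he using hgl
  have hinj : Function.Injective fun e : Fin d → ℤ => (AddMonoidAlgebra.single e 1 : TorusAlgebra K d) :=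
    AddMonoidAlgebra.of_injective
  let γ : (Fin m → ℤ) →+ (Fin d → ℤ) := AddMonoidHom.mk' e fun s t => hinj (by
    simp only
    rw [← he, ← mul_one (1 : K), ← AddMonoidAlgebra.single_mul_single, ← AddMonoidAlgebra.single_mul_single, map_mul,
      he, he])
  have hmem : ∀ s : τ.semigroup, γ s ∈ σ.semigroup := by
    intro s
    have h1 := hθ (character τ s)
    rw [toTorus_single, he] at h1
    by_contra h
    have h2 := congrArg (fun f => f.coeff (e s)) h1
    have h3 : (toTorus σ (θ.hom (character τ s))).coeff (e s) = 0 :=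
      Finsupp.mapDomain_of_notMem_range _ _ (by
        rintro ⟨a, ha⟩
        refine h ?_
        change e s ∈ σ.semigroup
        rw [← ha]
        exact a.2)
    rw [h3] at h2
    simp at h2
  refine ⟨γ, hmem, fun p s => ?_⟩
  rw [formalCharacter_apply, formalCharacter_apply, completedStalkMap, completionMap_algebraMap,
    stalkMap_specGerm]
  congr 2
  refine toTorus_injective σ ?_
  exact (hθ _).trans (by rw [toTorus_single, toTorus_single, he]; rfl)

theorem maximalIdeal_completedStalk_toric [IsAlgClosed K] (p : toricVariety K σ)
    (hp : IsClosed ({p} : Set (toricVariety K σ))) :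
    IsNoetherianRing ((toricVariety K σ).presheaf.stalk p) ∧
    ∃ c : σ.semigroup → K, maximalIdeal (completedStalk _ p) =
      Ideal.span (Set.range fun s => formalCharacter K σ p (Multiplicative.ofAdd s) -
        const (toricStructure K σ) p (c s)) := by
  have hN : IsNoetherianRing ((toricVariety K σ).presheaf.stalk p) :=
    isNoetherianRing_specStalk (CommRingCat.of (SemigroupAlgebra K σ)) p
  refine ⟨hN, ?_⟩
  have hmax := isMaximal_asIdeal hp
  choose c hc using exists_sub_algebraMap_mem (K := K) (R := SemigroupAlgebra K σ) p.asIdeal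
  refine ⟨fun s => c (character σ s), ?_⟩
  rw [AdicCompletion.maximalIdeal_eq_map]
  have h1 := maximalIdeal_specStalk (CommRingCat.of (SemigroupAlgebra K σ)) p
  refine (congrArg (Ideal.map _) h1).trans ?_
  have h2 := asIdeal_eq_span σ p.asIdeal hmax.ne_top (fun s => c (character σ s)) fun s => hc _
  rw [h2, Ideal.map_map, Ideal.map_span, ← Set.range_comp]
  congr 2
  ext1 s
  simp only [Function.comp_apply, map_sub]
  rw [toricStructure, const_spec]
  rfl

/-- `exists_chart` applies to the characters transported along `ι`: they generate the maximal ideal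
up to constants. Moreover the boundary ideal contains `χ^s₀` and is contained in the radical of
`(χ^s₀)`, which gives the two divisibilities between `χ^s₀` and `x_1 ⋯ x_n`. -/
theorem exists_chart_of_isLocalModel [IsAlgClosed K] [CharZero K] {X : Scheme.{u}}
    {sX : X ⟶ Spec (CommRingCat.of K)} {D : ReducedDivisor X} {p : X}
    [IsNoetherianRing (X.presheaf.stalk p)] {p' : toricVariety K σ}
    {ι : completedStalk X p ≃+* completedStalk (toricVariety K σ) p'}
    (hι : IsLocalModel sX D p σ p' ι) {x : Fin d → completedStalk X p}
    (h : IsCoord (const sX p) x) (J : Jet (const sX p) x) {n : ℕ} (hn : n ≤ d)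
    (hI : completedIdeal X D.support p = Ideal.span {∏ j : Fin n, x (Fin.castLE hn j)}) :
    ∃ C : Chart J hn σ.semigroup
      (fun s => ι.symm (formalCharacter K σ p' (Multiplicative.ofAdd s))),
      ∀ (κ : Type) (v : κ → Fin d → ℤ), LinearIndependent ℤ v →
        LinearIndependent K fun i => C.logVec (v i) := by
  obtain ⟨s₀, hs₀⟩ := σ.exists_interior
  obtain ⟨hN, c, hc⟩ := maximalIdeal_completedStalk_toric p' hι.isClosed
  have hJ : completedIdeal (toricVariety K σ) (toricBoundary K σ) p' =
      (Ideal.span {∏ j : Fin n, x (Fin.castLE hn j)}).map (ι : completedStalk X p →+* _) := by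
    rw [← hI, hι.map_ideal]
  have hmem : ∀ a, a ∈ completedIdeal (toricVariety K σ) (toricBoundary K σ) p' ↔
      ∏ j : Fin n, x (Fin.castLE hn j) ∣ ι.symm a := by
    intro a
    rw [hJ, Ideal.map_span, Set.image_singleton, Ideal.mem_span_singleton]
    constructor
    · intro h1
      have := map_dvd ι.symm h1
      simpa using this
    · intro h1
      have := map_dvd ι h1
      simpa using this
  have hm : ∀ a : completedStalk (toricVariety K σ) p', a ∈ maximalIdeal _ ↔
      ι.symm a ∈ maximalIdeal (completedStalk X p) := by
    intro a
    rw [mem_maximalIdeal, mem_maximalIdeal, mem_nonunits_iff, mem_nonunits_iff,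
      MulEquiv.isUnit_map]
  have hconst : ∀ c : K, ι.symm (const (toricStructure K σ) p' c) = const sX p c := by
    intro c
    rw [← hι.map_const, RingEquiv.symm_apply_apply]
  let χ : Multiplicative σ.semigroup →* completedStalk X p :=
    (ι.symm : _ →* _).comp (formalCharacter K σ p')
  have hχ : ∀ s, χ s = ι.symm (formalCharacter K σ p' s) := fun _ => rfl
  have hres : ∀ s : σ.semigroup, J.res (χ (Multiplicative.ofAdd s)) = c s := by
    intro s
    have h1 : formalCharacter K σ p' (Multiplicative.ofAdd s) -
        const (toricStructure K σ) p' (c s) ∈ maximalIdeal _ := by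
      rw [hc]
      exact Ideal.subset_span ⟨s, rfl⟩
    rw [hm, map_sub, hconst, J.mem_iff, map_sub, J.res_const, sub_eq_zero] at h1
    exact h1
  refine exists_chart h J hn σ.semigroup χ s₀ hs₀ ?_ ?_ ?_
  · refine le_antisymm (fun a ha => ?_) (Ideal.span_le.mpr ?_)
    · have h1 : ι a ∈ maximalIdeal (completedStalk (toricVariety K σ) p') := by
        rw [hm, RingEquiv.symm_apply_apply]
        exact ha
      rw [hc] at h1
      have h2 := Ideal.mem_map_of_mem (ι.symm : _ →+* completedStalk X p) h1
      rw [Ideal.map_span, ← Set.range_comp] at h2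
      simp only [Function.comp_def, RingHom.coe_coe, map_sub, hconst, RingEquiv.symm_apply_apply]
        at h2
      simp only [hres]
      exact h2
    · rintro _ ⟨s, rfl⟩
      exact J.sub_const_mem _
  · rw [hχ, ← hmem, completedIdeal, formalCharacter_apply]
    refine Ideal.mem_map_of_mem _ ?_
    rw [stalkIdeal_toricBoundary σ hs₀]
    exact Ideal.le_radical (Ideal.mem_span_singleton_self _)
  · have h1 : ι (∏ j : Fin n, x (Fin.castLE hn j)) ∈
        completedIdeal (toricVariety K σ) (toricBoundary K σ) p' := by
      rw [hmem, RingEquiv.symm_apply_apply]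
    have h2 : completedIdeal (toricVariety K σ) (toricBoundary K σ) p' ≤
        (Ideal.span {formalCharacter K σ p' (Multiplicative.ofAdd s₀)}).radical := by
      rw [completedIdeal, stalkIdeal_toricBoundary σ hs₀]
      refine (Ideal.map_radical_le _).trans (Ideal.radical_mono ?_)
      rw [Ideal.map_span, Set.image_singleton]
      rfl
    obtain ⟨N, hN⟩ := h2 h1
    refine ⟨N, ?_⟩
    rw [← map_pow, Ideal.mem_span_singleton] at hN
    have h3 := map_dvd ι.symm hN
    rwa [RingEquiv.symm_apply_apply] at h3

end ToricCharts

/-! ### Dimension of the local rings at closed points -/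

section Dimension

variable {K O F : Type*} [Field K] [CommRing O] [IsLocalRing O] [Algebra K O] {e : ℕ}
  {x : Fin e → O}

/-- A polynomial relation lies in every power of `(X)` by `indep`, and the intersection of these
powers is zero by Krull's theorem. -/
theorem IsCoord.algebraicIndependent (h : IsCoord (algebraMap K O) x) :
    AlgebraicIndependent K x := by
  rw [algebraicIndependent_iff]
  intro P hP
  have h1 : ∀ n, P ∈ (MvPolynomial.idealOfVars (Fin e) K) ^ n := fun n => by
    refine h.indep n P ?_
    have : P.eval₂Hom (algebraMap K O) x = 0 := hP
    rw [this]
    exact zero_mem _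
  have h2 : MvPolynomial.idealOfVars (Fin e) K ≠ ⊤ := by
    rw [Ideal.ne_top_iff_one]
    intro h3
    have : MvPolynomial.idealOfVars (Fin e) K ≤ RingHom.ker (MvPolynomial.constantCoeff) := by
      rw [MvPolynomial.idealOfVars, Ideal.span_le]
      rintro _ ⟨i, rfl⟩
      simp
    simpa using this h3
  have h3 := Ideal.iInf_pow_eq_bot_of_isDomain _ h2
  have h4 : P ∈ (⨅ n, (MvPolynomial.idealOfVars (Fin e) K) ^ n) := by
    rw [Ideal.mem_iInf]
    exact h1
  rwa [h3] at h4

/-- The differentials of parameters generate the module of differentials. -/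
theorem span_D_eq_top [Algebra.EssFiniteType K O]
    (hs : Ideal.span (Set.range x) = maximalIdeal O)
    (hr : ∀ a : O, ∃ c : K, a - algebraMap K O c ∈ maximalIdeal O) :
    Submodule.span O (Set.range fun i => KaehlerDifferential.D K O (x i)) = ⊤ := by
  refine top_le_iff.mp (Submodule.le_of_le_smul_of_le_jacobson_bot (I := maximalIdeal O)
    Module.Finite.fg_top (jacobson_eq_maximalIdeal ⊥ bot_ne_top).ge ?_)
  rw [← KaehlerDifferential.span_range_derivation, Submodule.span_le]
  rintro _ ⟨a, rfl⟩
  obtain ⟨c, hc⟩ := hr a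
  have hc' := hc
  rw [← hs, Ideal.mem_span_range_iff_exists_fun] at hc
  obtain ⟨b, hb⟩ := hc
  -- If `a - c = ∑ b_i x_i`, then `da = ∑ b_i dx_i + ∑ x_i db_i`, with the second sum in `m Ω`;
  -- Nakayama applies because `Ω` is finite.
  have h1 : KaehlerDifferential.D K O a = ∑ i, (b i • KaehlerDifferential.D K O (x i) +
      x i • KaehlerDifferential.D K O (b i)) := by
    rw [← sub_add_cancel a (algebraMap K O c), map_add, Derivation.map_algebraMap, add_zero, ← hb,
      map_sum]
    simp only [Derivation.leibniz]
  rw [SetLike.mem_coe, h1]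
  refine sum_mem fun i _ => add_mem ?_ ?_
  · exact Submodule.mem_sup_left (Submodule.smul_mem _ _ (Submodule.subset_span ⟨i, rfl⟩))
  · refine Submodule.mem_sup_right (Submodule.smul_mem_smul ?_ ?_)
    · rw [← hs]
      exact Ideal.subset_span ⟨i, rfl⟩
    · exact Submodule.subset_span ⟨_, rfl⟩

theorem derivation_fractionRing_eq_zero {K O F : Type*} [CommRing K] [CommRing O] [Nontrivial O]
    [Field F] [Algebra O F] [IsFractionRing O F] [Algebra K F] {M : Type*} [AddCommGroup M] [Module F M] [Module K M]
    [IsScalarTower K F M]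
    (D : Derivation K F M) (h : ∀ a : O, D (algebraMap O F a) = 0) : D = 0 := by
  ext f
  obtain ⟨a, b, hb, rfl⟩ := IsFractionRing.div_surjective (A := O) f
  have hb0 : algebraMap O F b ≠ 0 := by
    simpa using nonZeroDivisors.ne_zero hb
  have h1 : D (algebraMap O F a / algebraMap O F b * algebraMap O F b) = 0 := by
    rw [div_mul_cancel₀ _ hb0, h]
  rw [Derivation.leibniz, h, smul_zero, zero_add] at h1
  exact (smul_eq_zero.mp h1).resolve_left hb0

variable [Field F] [Algebra O F] [IsFractionRing O F] [Algebra K F] [IsScalarTower K O F]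

open scoped IntermediateField.algebraAdjoinAdjoin in
-- Over the field `E` generated by the parameters, `F` has no differentials, since the differentials
-- of the parameters generate those of `O`. So `F` is unramified over `E` and essentially of finite
-- type, hence separable algebraic.
theorem IsCoord.isTranscendenceBasis [CharZero K] [Algebra.EssFiniteType K O]
    (h : IsCoord (algebraMap K O) x) :
    IsTranscendenceBasis K (fun i => algebraMap O F (x i)) := by
  have hinj : Function.Injective (algebraMap O F) := IsFractionRing.injective O F
  have hai : AlgebraicIndependent K (fun i => algebraMap O F (x i)) :=
    h.algebraicIndependent.map' (f := IsScalarTower.toAlgHom K O F) hinj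
  rw [hai.isTranscendenceBasis_iff_isAlgebraic]
  let E := IntermediateField.adjoin K (Set.range fun i => algebraMap O F (x i))
  have : Algebra.EssFiniteType O F := Algebra.EssFiniteType.of_isLocalization _ (nonZeroDivisors O)
  have : Algebra.EssFiniteType K F := Algebra.EssFiniteType.comp K O F
  have : Algebra.EssFiniteType E F := Algebra.EssFiniteType.of_comp K E F
  have hur : Algebra.FormallyUnramified E F := by
    constructor
    have hD : (KaehlerDifferential.D E F).restrictScalars K = 0 := by
      refine derivation_fractionRing_eq_zero (O := O) _ fun a => ?_
      let δ : Derivation K O Ω[F⁄E] :=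
        ((KaehlerDifferential.D E F).restrictScalars K).compAlgebraMap O
      have h1 : δ.liftKaehlerDifferential = 0 := by
        refine LinearMap.ext_on_range (span_D_eq_top h.span h.residue) fun i => ?_
        rw [Derivation.liftKaehlerDifferential_comp_D, LinearMap.zero_apply]
        change KaehlerDifferential.D E F (algebraMap O F (x i)) = 0
        have : algebraMap O F (x i) = algebraMap E F ⟨_, IntermediateField.subset_adjoin K _ ⟨i, rfl⟩⟩ := rfl
        rw [this, Derivation.map_algebraMap]
      change δ a = 0
      rw [← Derivation.liftKaehlerDifferential_comp_D, h1, LinearMap.zero_apply]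
    refine (Submodule.subsingleton_iff F).mp (subsingleton_of_bot_eq_top ?_)
    rw [← KaehlerDifferential.span_range_derivation, eq_comm, Submodule.span_eq_bot]
    rintro _ ⟨a, rfl⟩
    exact DFunLike.congr_fun hD a
  have : Algebra.IsSeparable E F := Algebra.FormallyUnramified.isSeparable E F
  have : Algebra.IsAlgebraic E F := inferInstance
  exact (IsFractionRing.comap_isAlgebraic_iff (A := Algebra.adjoin K
    (Set.range fun i => algebraMap O F (x i))) (K := E)).mpr this

end Dimension

/-! ### Closed points and structure maps of schemes over `K` -/

section ClosedPoints

variable {K : Type u} [Field K] {X Y : Scheme.{u}} (sX : X ⟶ Spec (CommRingCat.of K))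
  (sY : Y ⟶ Spec (CommRingCat.of K))

/-- The structure map `K → O_{X,p}`. -/
def baseMap (p : X) : K →+* X.presheaf.stalk p :=
  ((Scheme.ΓSpecIso (CommRingCat.of K)).inv ≫ sX.appTop ≫ X.presheaf.germ ⊤ p trivial).hom

theorem const_eq (p : X) :
    const sX p = (algebraMap (X.presheaf.stalk p) (completedStalk X p)).comp (baseMap sX p) := rfl

theorem stalkMap_baseMap {φ : X ⟶ Y} (hφ : φ ≫ sY = sX) (p : X) (c : K) :
    (φ.stalkMap p).hom (baseMap sY (φ p) c) = baseMap sX p c := by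
  subst hφ
  have h := Scheme.Hom.germ_stalkMap φ ⊤ p trivial
  have h2 : (Scheme.ΓSpecIso (CommRingCat.of K)).inv ≫ sY.appTop ≫
      Y.presheaf.germ ⊤ (φ p) trivial ≫ φ.stalkMap p =
      (Scheme.ΓSpecIso (CommRingCat.of K)).inv ≫ (φ ≫ sY).appTop ≫
        X.presheaf.germ ⊤ p trivial := by
    rw [h, Scheme.Hom.comp_appTop, Category.assoc]
    rfl
  exact congrArg (fun f => f.hom c) h2

theorem baseMap_eq_stalkMap (p : X) : baseMap sX p =
    (sX.stalkMap p).hom.comp (specGerm (CommRingCat.of K) (sX p)) := by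
  ext c
  have h := Scheme.Hom.germ_stalkMap sX ⊤ p trivial
  have h2 : (Scheme.ΓSpecIso (CommRingCat.of K)).inv ≫
      (Spec (CommRingCat.of K)).presheaf.germ ⊤ (sX p) trivial ≫ sX.stalkMap p =
      (Scheme.ΓSpecIso (CommRingCat.of K)).inv ≫ sX.appTop ≫ X.presheaf.germ ⊤ p trivial := by
    rw [h]
    rfl
  exact (congrArg (fun f => f.hom c) h2).symm

theorem baseMap_essFiniteType [LocallyOfFiniteType sX] (p : X) : (baseMap sX p).EssFiniteType := by
  rw [baseMap_eq_stalkMap]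
  refine RingHom.EssFiniteType.comp ?_ (LocallyOfFiniteType.stalkMap sX p)
  let := (specGerm (CommRingCat.of K) (sX p)).toAlgebra
  have := isLocalization_specGerm (CommRingCat.of K) (sX p)
  have : (sX p).asIdeal.IsPrime := isPrime_asIdeal (CommRingCat.of K) (sX p)
  exact Algebra.EssFiniteType.of_isLocalization _ (sX p).asIdeal.primeCompl

theorem exists_sub_baseMap_mem [IsAlgClosed K] [LocallyOfFiniteType sX] {p : X}
    (hp : IsClosed ({p} : Set X)) (a : X.presheaf.stalk p) :
    ∃ c : K, a - baseMap sX p c ∈ maximalIdeal (X.presheaf.stalk p) := by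
  let e := residueFieldIsoBase sX p hp
  have h1 : e.inv = CommRingCat.ofHom (baseMap sX p) ≫ X.residue p := by
    refine Spec.map_injective ?_
    rw [SpecMap_residueFieldIsoBase_inv, Scheme.fromSpecResidueField, Category.assoc,
      ← Scheme.SpecMap_stalkMap_fromSpecStalk, Spec.fromSpecStalk_eq, ← Spec.map_comp,
      ← Spec.map_comp, baseMap_eq_stalkMap]
    rfl
  refine ⟨e.hom.hom (X.residue p a), ?_⟩
  have h2 : ∀ c, X.residue p (baseMap sX p c) = e.inv c := fun c =>
    (congrArg (fun f => f.hom c) h1).symm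
  have h3 : X.residue p (a - baseMap sX p (e.hom.hom (X.residue p a))) = 0 := by
    rw [map_sub, h2, sub_eq_zero]
    exact (congrArg (fun f => f.hom (X.residue p a)) e.hom_inv_id).symm
  exact (IsLocalRing.residue_eq_zero_iff _).mp h3

theorem isClosed_singleton_map [LocallyOfFiniteType sX] [LocallyOfFiniteType sY] {φ : X ⟶ Y}
    (hφ : φ ≫ sY = sX) {p : X} (hp : IsClosed ({p} : Set X)) : IsClosed ({φ p} : Set Y) := by
  have : LocallyOfFiniteType φ := by
    have : LocallyOfFiniteType (φ ≫ sY) := hφ ▸ inferInstance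
    exact locallyOfFiniteType_of_comp φ sY
  have : JacobsonSpace Y := LocallyOfFiniteType.jacobsonSpace sY
  exact φ.closePoints_subset_preimage_closedPoints hp

theorem algebraMap_baseMap [IsIntegral X] (p : X) :
    (algebraMap (X.presheaf.stalk p) X.functionField).comp (baseMap sX p) =
      baseMap sX (genericPoint X) := by
  have h := X.presheaf.germ_stalkSpecializes (U := ⊤) (y := p) trivial
    ((genericPoint_spec X).specializes trivial)
  have h2 : ((Scheme.ΓSpecIso (CommRingCat.of K)).inv ≫ sX.appTop ≫
      X.presheaf.germ ⊤ p trivial) ≫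
        X.presheaf.stalkSpecializes ((genericPoint_spec X).specializes trivial) =
      (Scheme.ΓSpecIso (CommRingCat.of K)).inv ≫ sX.appTop ≫
        X.presheaf.germ ⊤ (genericPoint X) trivial := by
    rw [Category.assoc, Category.assoc, h]
  exact congrArg (fun f => f.hom) h2

end ClosedPoints

/-! ### Dimension at the closed points of a nonsingular variety -/

section Regular

variable {K : Type u} [Field K] {X : Scheme.{u}}
  {sX : X ⟶ Spec (CommRingCat.of K)} {d : ℕ}

theorem exists_span_eq_maximalIdeal (O : Type*) [CommRing O] [IsRegularLocalRing O] :
    ∃ (e : ℕ) (x : Fin e → O), Ideal.span (Set.range x) = maximalIdeal O ∧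
      ringKrullDim O = e := by
  obtain ⟨s, hs, hspan⟩ := Submodule.FG.exists_span_finset_card_eq_spanFinrank
    (IsNoetherian.noetherian (maximalIdeal O))
  refine ⟨s.card, fun i => (s.equivFin.symm i : O), ?_, ?_⟩
  · rw [← hspan, Ideal.span]
    congr 1
    ext a
    constructor
    · rintro ⟨i, rfl⟩
      exact (s.equivFin.symm i).2
    · intro ha
      exact ⟨s.equivFin ⟨a, ha⟩, by simp⟩
  · rw [← IsRegularLocalRing.spanFinrank_maximalIdeal, hs]

/-- Regular parameters at `p` form a transcendence basis of the function field, so the dimension at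
`p` is a transcendence degree that does not depend on `p`. -/
theorem exists_trdeg_eq [IsAlgClosed K] [CharZero K] (hX : IsNonsingularVariety sX d) {p : X} (hp : IsClosed ({p} : Set X)) :
    ∃ e : ℕ, ringKrullDim (X.presheaf.stalk p) = e ∧
      ∀ [IsIntegral X], @Algebra.trdeg K X.functionField _ _
        (baseMap sX (genericPoint X)).toAlgebra = e := by
  have := hX.isIntegral
  have := hX.locallyOfFiniteType
  have := hX.regular p
  obtain ⟨e, x, hx, he⟩ := exists_span_eq_maximalIdeal (X.presheaf.stalk p)
  have h := IsCoord.of_ringKrullDim_le (k := baseMap sX p) hx (exists_sub_baseMap_mem sX hp) he.ge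
  refine ⟨e, he, ?_⟩
  intro _
  let := (baseMap sX p).toAlgebra
  let := (baseMap sX (genericPoint X)).toAlgebra
  have : IsScalarTower K (X.presheaf.stalk p) X.functionField :=
    IsScalarTower.of_algebraMap_eq' (algebraMap_baseMap sX p).symm
  have : Algebra.EssFiniteType K (X.presheaf.stalk p) := baseMap_essFiniteType sX p
  have h1 : IsTranscendenceBasis K fun i => algebraMap (X.presheaf.stalk p) X.functionField (x i) :=
    IsCoord.isTranscendenceBasis h
  have h2 := h1.lift_cardinalMk_eq_trdeg
  simpa using h2.symm

theorem genericPoint_specializes_iff {X : Type*} [TopologicalSpace X] [QuasiSober X]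
    (W : IrreducibleCloseds X) (p : X) : W.isIrreducible.genericPoint ⤳ p ↔ p ∈ W := by
  rw [specializes_iff_mem_closure, W.isIrreducible.genericPoint_closure_eq, W.isClosed.closure_eq]
  rfl

/-- Take a chain of irreducible closed sets of length `d`. Its smallest member contains a closed
point by the Jacobson property, and the generic points of the chain bound the coheight of that point
from below. -/
theorem exists_closed_point_le_ringKrullDim (hX : IsNonsingularVariety sX d) :
    ∃ p : X, IsClosed ({p} : Set X) ∧ (d : WithBot ℕ∞) ≤ ringKrullDim (X.presheaf.stalk p) := by
  have := hX.locallyOfFiniteType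
  have : JacobsonSpace X := LocallyOfFiniteType.jacobsonSpace sX
  obtain ⟨l, hl⟩ := Order.le_krullDim_iff.mp hX.dim.ge
  obtain ⟨p, hpW, hp⟩ : ((l.head : Set X) ∩ closedPoints X).Nonempty := by
    rw [← closure_nonempty_iff, JacobsonSpace.closure_inter_closedPoints l.head.isClosed]
    exact l.head.isIrreducible.nonempty
  refine ⟨p, hp, ?_⟩
  rw [ringKrullDim_stalk_eq_coheight]
  have hmono : StrictMono fun W : IrreducibleCloseds X => W.isIrreducible.genericPoint := by
    have hle : ∀ W W' : IrreducibleCloseds X,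
        W.isIrreducible.genericPoint ≤ W'.isIrreducible.genericPoint ↔ W ≤ W' := by
      intro W W'
      change W'.isIrreducible.genericPoint ⤳ W.isIrreducible.genericPoint ↔ _
      rw [genericPoint_specializes_iff]
      constructor
      · intro h q hq
        exact ((genericPoint_specializes_iff W q).mpr hq).mem_closed W'.isClosed h
      · intro h
        exact h ((genericPoint_specializes_iff W _).mp specializes_rfl)
    intro W W' h
    rw [lt_iff_le_not_ge] at h ⊢
    simpa only [hle] using h
  have hle : p ≤ (LTSeries.map l _ hmono).head :=
    (genericPoint_specializes_iff _ _).mpr hpW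
  have := Order.length_le_coheight hle
  rw [LTSeries.map_length, hl] at this
  exact_mod_cast this

/-- The local rings at the closed points of a nonsingular variety have the dimension of the
variety. -/
theorem le_ringKrullDim_stalk [IsAlgClosed K] [CharZero K] (hX : IsNonsingularVariety sX d) {p : X}
    (hp : IsClosed ({p} : Set X)) : (d : WithBot ℕ∞) ≤ ringKrullDim (X.presheaf.stalk p) := by
  have := hX.isIntegral
  obtain ⟨p₀, hp₀, hd⟩ := exists_closed_point_le_ringKrullDim hX
  obtain ⟨e, he, hF⟩ := exists_trdeg_eq hX hp
  obtain ⟨e₀, he₀, hF₀⟩ := exists_trdeg_eq hX hp₀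
  have h1 : (e₀ : Cardinal.{u}) = e := hF₀.symm.trans hF
  rw [Nat.cast_inj] at h1
  rw [he, ← h1, ← he₀]
  exact hd

end Regular

/-! ### Divisors with simple normal crossings at a closed point -/

/-- The product of the factors that occur has a power divisible by the monomial, so a radical ideal
contains it. The exponents in the SNC condition may thus be taken to be zero or one. -/
theorem span_eq_span_prod_of_isRadical {R ι : Type*} [CommRing R] [Fintype ι] [DecidableEq ι]
    (x : ι → R) (a : ι → ℕ) (h : (Ideal.span {∏ i, x i ^ a i}).IsRadical) :
    Ideal.span {∏ i, x i ^ a i} = Ideal.span {∏ i with a i ≠ 0, x i} := by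
  have h1 : ∏ i, x i ^ a i = ∏ i with a i ≠ 0, x i ^ a i := by
    symm
    refine Finset.prod_filter_of_ne ?_
    rintro i - hi h0
    exact hi (by rw [h0, pow_zero])
  apply le_antisymm
  · rw [Ideal.span_singleton_le_span_singleton, h1]
    exact Finset.prod_dvd_prod_of_dvd _ _ fun i hi =>
      dvd_pow_self _ (Finset.mem_filter.mp hi).2
  · rw [Ideal.span_singleton_le_iff_mem]
    apply h
    refine ⟨∑ i, a i, ?_⟩
    rw [Ideal.mem_span_singleton, h1, ← Finset.prod_pow]
    exact Finset.prod_dvd_prod_of_dvd _ _ fun i _ =>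
      pow_dvd_pow _ (Finset.single_le_sum (fun _ _ => Nat.zero_le _) (Finset.mem_univ i))

section SNC

variable {K : Type u} [Field K] {X : Scheme.{u}} {D : ReducedDivisor X}
  {sX : X ⟶ Spec (CommRingCat.of K)} {d n : ℕ}

theorem ReducedDivisor.isClosed_support (D : ReducedDivisor X) : IsClosed D.support :=
  D.components.finite_toSet.isClosed_biUnion fun W _ => W.isClosed

theorem ReducedDivisor.mem_support {D : ReducedDivisor X} {p : X} :
    p ∈ D.support ↔ ∃ W ∈ D.components, p ∈ W := by
  simp only [ReducedDivisor.support, Set.mem_iUnion, exists_prop]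
  rfl

theorem ReducedDivisor.eq_of_le (D : ReducedDivisor X) {W W' : IrreducibleCloseds X}
    (hW : W ∈ D.components) (hW' : W' ∈ D.components) (h : W ≤ W') : W = W' := by
  by_contra hne
  have h1 := Order.coheight_strictAnti (lt_of_le_of_ne h hne)
    (by rw [D.codim_one W' hW']; exact ENat.one_lt_top)
  rw [D.codim_one W hW, D.codim_one W' hW'] at h1
  exact lt_irrefl _ h1

theorem ReducedDivisor.stalkIdeal_le_iff (D : ReducedDivisor X) (p : X)
    (q : Spec (X.presheaf.stalk p)) :
    stalkIdeal X D.support p ≤ q.asIdeal ↔ X.fromSpecStalk p q ∈ D.support := by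
  have h : IsClosed ((X.fromSpecStalk p) ⁻¹' D.support) :=
    D.isClosed_support.preimage (X.fromSpecStalk p).continuous
  change _ ↔ q ∈ (X.fromSpecStalk p) ⁻¹' D.support
  rw [← h.closure_eq]
  exact (Set.ext_iff.mp (PrimeSpectrum.zeroLocus_vanishingIdeal_eq_closure
    ((X.fromSpecStalk p) ⁻¹' D.support)) q)

theorem fromSpecStalk_specializes_iff (p : X) (q q' : Spec (X.presheaf.stalk p)) :
    (X.fromSpecStalk p q) ⤳ (X.fromSpecStalk p q') ↔ q.asIdeal ≤ q'.asIdeal := by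
  refine (X.fromSpecStalk p).isEmbedding.isInducing.specializes_iff.trans ?_
  exact (PrimeSpectrum.le_iff_specializes q q').symm

theorem fromSpecStalk_specializes (p : X) (q : Spec (X.presheaf.stalk p)) :
    (X.fromSpecStalk p q) ⤳ p := by
  have : X.fromSpecStalk p q ∈ Set.range (X.fromSpecStalk p) := ⟨q, rfl⟩
  rwa [Scheme.range_fromSpecStalk] at this

theorem exists_fromSpecStalk_eq {p y : X} (h : y ⤳ p) :
    ∃ q : Spec (X.presheaf.stalk p), X.fromSpecStalk p q = y := by
  have : y ∈ Set.range (X.fromSpecStalk p) := by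
    rw [Scheme.range_fromSpecStalk]
    exact h
  exact this

/-- The components of a divisor with local equation `∏ i ∈ s, x i` correspond to `s`. -/
theorem ReducedDivisor.card_eq_ncard {p : X} {ι : Type*} {x : ι → X.presheaf.stalk p}
    (hx : ∀ i, Prime (x i)) (hne : ∀ i j, i ≠ j → ¬ x i ∣ x j) {s : Finset ι}
    (hs : stalkIdeal X D.support p = Ideal.span {∏ i ∈ s, x i}) :
    {W : IrreducibleCloseds X | W ∈ D.components ∧ p ∈ W}.ncard = s.card := by
  let Q : ι → Spec (X.presheaf.stalk p) := fun i =>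
    ⟨Ideal.span {x i}, (Ideal.span_singleton_prime (hx i).ne_zero).mpr (hx i)⟩
  have hmem : ∀ q : Spec (X.presheaf.stalk p),
      X.fromSpecStalk p q ∈ D.support ↔ ∃ i ∈ s, (Q i).asIdeal ≤ q.asIdeal := by
    intro q
    rw [← D.stalkIdeal_le_iff, hs, Ideal.span_singleton_le_iff_mem, Ideal.IsPrime.prod_mem_iff]
    simp only [Q, Ideal.span_singleton_le_iff_mem]
  -- The point of the prime `(x_i)` lies on some component `W`. The prime `q` of the generic point
  -- of `W` contains some `x_j`, and `(x_j) ⊆ q ⊆ (x_i)` forces `j = i`. So `(x_i)` is the generic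
  -- point of `W`.
  have key : ∀ i ∈ s, ∃ W ∈ D.components, p ∈ W ∧
      X.fromSpecStalk p (Q i) = W.isIrreducible.genericPoint := by
    intro i hi
    obtain ⟨W, hW, hiW⟩ := ReducedDivisor.mem_support.mp ((hmem (Q i)).mpr ⟨i, hi, le_rfl⟩)
    have h1 := (genericPoint_specializes_iff W _).mpr hiW
    have h2 := h1.trans (fromSpecStalk_specializes p (Q i))
    obtain ⟨q, hq⟩ := exists_fromSpecStalk_eq h2
    refine ⟨W, hW, (genericPoint_specializes_iff W p).mp h2, ?_⟩
    have hqs : X.fromSpecStalk p q ∈ D.support := by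
      rw [hq]
      exact ReducedDivisor.mem_support.mpr
        ⟨W, hW, (genericPoint_specializes_iff W _).mp specializes_rfl⟩
    obtain ⟨j, -, hjq⟩ := (hmem q).mp hqs
    rw [← hq, fromSpecStalk_specializes_iff] at h1
    have hji : i = j := by
      by_contra hij
      have := hjq.trans h1
      rw [Ideal.span_singleton_le_span_singleton] at this
      exact hne i j hij this
    subst hji
    rw [← hq, PrimeSpectrum.ext (le_antisymm hjq h1)]
  choose F hF hpF hgen using key
  rw [← Set.ncard_coe_finset s]
  symm
  refine Set.ncard_congr (F) (fun i hi => ⟨hF i hi, hpF i hi⟩) ?_ ?_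
  · intro i j hi hj hij
    by_contra hne'
    have h1 : X.fromSpecStalk p (Q i) = X.fromSpecStalk p (Q j) := by
      have h : ∀ W W' : IrreducibleCloseds X, W = W' →
        W.isIrreducible.genericPoint = W'.isIrreducible.genericPoint := by
        rintro W _ rfl
        rfl
      exact (hgen i hi).trans ((h _ _ hij).trans (hgen j hj).symm)
    have h2 := (fromSpecStalk_specializes_iff p _ _).mp (specializes_of_eq h1.symm)
    rw [Ideal.span_singleton_le_span_singleton] at h2
    exact hne i j hne' h2
  -- The prime of the generic point of `W` contains some `x_i`, so `W` is contained in the component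
  -- of `x_i`; components are not properly contained in each other.
  · rintro W ⟨hW, hpW⟩
    obtain ⟨q, hq⟩ := exists_fromSpecStalk_eq ((genericPoint_specializes_iff W p).mpr hpW)
    have hqs : X.fromSpecStalk p q ∈ D.support := by
      rw [hq]
      exact ReducedDivisor.mem_support.mpr
        ⟨W, hW, (genericPoint_specializes_iff W _).mp specializes_rfl⟩
    obtain ⟨i, hi, hiq⟩ := (hmem q).mp hqs
    refine ⟨i, hi, (D.eq_of_le hW (hF i hi) ?_).symm⟩
    intro z hz
    rw [← fromSpecStalk_specializes_iff, hgen i hi, hq] at hiq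
    exact (genericPoint_specializes_iff _ z).mp
      (hiq.trans ((genericPoint_specializes_iff W z).mpr hz))

theorem exists_perm_castLE {d : ℕ} (s : Finset (Fin d)) (hn : s.card ≤ d) :
    ∃ e : Equiv.Perm (Fin d), ∀ {M : Type*} [CommMonoid M] (f : Fin d → M),
      ∏ j : Fin s.card, f (e (Fin.castLE hn j)) = ∏ i ∈ s, f i := by
  let e₀ : {i : Fin d // (i : ℕ) < s.card} ≃ {i : Fin d // i ∈ s} :=
    (Equiv.ofBijective (fun j : Fin s.card => (⟨Fin.castLE hn j, j.2⟩ :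
      {i : Fin d // (i : ℕ) < s.card}))
      ⟨fun i j h => by simpa using h, fun i => ⟨⟨i.1, i.2⟩, rfl⟩⟩).symm.trans s.equivFin.symm
  refine ⟨e₀.extendSubtype, ?_⟩
  intro M _ f
  have h : ∀ j : Fin s.card, e₀.extendSubtype (Fin.castLE hn j) = s.equivFin.symm j := by
    intro j
    rw [Equiv.extendSubtype_apply_of_mem e₀ _ j.2]
    refine congrArg (fun i => ((s.equivFin.symm i : s) : Fin d)) ?_
    exact Equiv.ofBijective_symm_apply_apply _ _ j
  simp only [h]
  rw [← Finset.prod_coe_sort s]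
  exact Equiv.prod_comp s.equivFin.symm fun i => f i

/-- At a closed point which is an `n`-point for an SNC divisor there are regular parameters such
that the product of the first `n` of them is a local equation of the divisor. -/
theorem ReducedDivisor.IsSNC.exists_isCoord [IsAlgClosed K] [CharZero K]
    (hX : IsNonsingularVariety sX d) (hD : D.IsSNC d) {p : X} (hp : IsClosed ({p} : Set X))
    (hn : D.IsNPoint n p) : ∃ (hnd : n ≤ d) (x : Fin d → X.presheaf.stalk p),
      IsCoord (baseMap sX p) x ∧
      stalkIdeal X D.support p = Ideal.span {∏ j : Fin n, x (Fin.castLE hnd j)} := by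
  have := hX.locallyOfFiniteType
  have := hX.regular p
  obtain ⟨x, a, hx, ha⟩ := hD p hp
  have hd := le_ringKrullDim_stalk hX hp
  have hr := exists_sub_baseMap_mem sX hp
  have hprime := prime_of_ringKrullDim_eq hx hr hd
  have hc : IsCoord (baseMap sX p) x := IsCoord.of_ringKrullDim_le hx hr hd
  have hne : ∀ i j, i ≠ j → ¬ x i ∣ x j := fun i j hij h =>
    hc.completion.not_dvd hij (map_dvd _ h)
  have hrad : (Ideal.span {∏ i, x i ^ a i}).IsRadical := by
    rw [← ha]
    exact PrimeSpectrum.isRadical_vanishingIdeal _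
  rw [span_eq_span_prod_of_isRadical x a hrad] at ha
  -- The number of parameters in the reduced equation is the number of components through `p`, which
  -- is `n`; a permutation moves these parameters to the front.
  have hcard := ReducedDivisor.card_eq_ncard hprime hne ha
  rw [hn] at hcard
  subst hcard
  have hle : (Finset.univ.filter fun i => a i ≠ 0).card ≤ d := by
    simpa using Finset.card_le_univ (Finset.univ.filter fun i => a i ≠ 0)
  obtain ⟨e, he⟩ := exists_perm_castLE _ hle
  refine ⟨hle, x ∘ e, IsCoord.of_ringKrullDim_le ?_ hr hd, ?_⟩
  · rw [e.surjective.range_comp, hx]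
  · rw [ha, ← he x]
    rfl

/-- Parameters which generate the maximal ideal and whose first `n` have the same product, up to a
unit, as given permissible parameters are permissible. -/
theorem ReducedDivisor.isPermissible_iff {p : X} {hn : n ≤ d} {x₀ : Fin d → completedStalk X p}
    [IsNoetherianRing (X.presheaf.stalk p)] [IsDomain (completedStalk X p)]
    (h₀ : completedIdeal X D.support p = Ideal.span {∏ j : Fin n, x₀ (Fin.castLE hn j)})
    {x : Fin d → completedStalk X p} :
    D.IsPermissible hn p x ↔ Ideal.span (Set.range x) = maximalIdeal (completedStalk X p) ∧
      Associated (∏ j : Fin n, x (Fin.castLE hn j)) (∏ j : Fin n, x₀ (Fin.castLE hn j)) := by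
  rw [← Ideal.span_singleton_eq_span_singleton, AdicCompletion.maximalIdeal_eq_map, ← h₀]
  exact ⟨fun h => ⟨h.span_eq, h.local_equation.symm⟩, fun h => ⟨h.1, h.2.symm⟩⟩

end SNC

/-! ### Pullback of the ideals of closed sets -/

section Pullback

variable {X Y : Scheme.{u}} (φ : X ⟶ Y) (p : X)

theorem stalkIdeal_map_le (Z : Set Y) :
    (stalkIdeal Y Z (φ p)).map (φ.stalkMap p).hom ≤ stalkIdeal X (φ ⁻¹' Z) p := by
  rw [Ideal.map_le_iff_le_comap]
  intro a ha
  rw [Ideal.mem_comap, stalkIdeal, PrimeSpectrum.mem_vanishingIdeal]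
  intro q hq
  have h1 := (PrimeSpectrum.mem_vanishingIdeal _ _).mp ha
    (Spec.map (φ.stalkMap p) q)
  refine h1 ?_
  have h2 := congrArg (fun f : Spec (X.presheaf.stalk p) ⟶ Y => f q)
    (Scheme.SpecMap_stalkMap_fromSpecStalk φ (x := p))
  exact (iff_of_eq (congrArg (· ∈ Z) h2)).mpr hq

theorem completedIdeal_map_le (Z : Set Y) :
    (completedIdeal Y Z (φ p)).map (completedStalkMap φ p) ≤ completedIdeal X (φ ⁻¹' Z) p := by
  rw [completedIdeal, completedIdeal, Ideal.map_map]
  have : (completedStalkMap φ p).comp (algebraMap (Y.presheaf.stalk (φ p)) _) =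
      (algebraMap (X.presheaf.stalk p) (completedStalk X p)).comp (φ.stalkMap p).hom :=
    RingHom.ext fun a => completionMap_algebraMap (φ.stalkMap p).hom a
  rw [this, ← Ideal.map_map]
  exact Ideal.map_mono (stalkIdeal_map_le φ p Z)

end Pullback

/-! ### Generic rank of a dominant morphism -/

section GenericRank

variable {K F : Type*} [Field K] [CharZero K] [Field F] [Algebra K F]
  {m : ℕ} {y : Fin m → F}

open KaehlerDifferential in
/-- In characteristic zero, the differentials of algebraically independent elements are linearly
independent. -/
theorem linearIndependent_D [Algebra.EssFiniteType K F] (hy : AlgebraicIndependent K y) :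
    LinearIndependent F fun i => D K F (y i) := by
  let P := MvPolynomial (Fin m) K
  let algPF : Algebra P F := (MvPolynomial.aeval y : P →ₐ[K] F).toRingHom.toAlgebra
  have tower : IsScalarTower K P F :=
    IsScalarTower.of_algebraMap_eq fun c => (MvPolynomial.aeval_C y c).symm
  have : FaithfulSMul P F := (faithfulSMul_iff_algebraMap_injective P F).mpr hy
  let algE : Algebra (FractionRing P) F := FractionRing.liftAlgebra P F
  have towerE : IsScalarTower P (FractionRing P) F := FractionRing.isScalarTower_liftAlgebra P F
  have towerK : IsScalarTower K (FractionRing P) F := by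
    refine IsScalarTower.of_algebraMap_eq fun c => ?_
    rw [IsScalarTower.algebraMap_apply K P F, IsScalarTower.algebraMap_apply P (FractionRing P) F,
      ← IsScalarTower.algebraMap_apply K P (FractionRing P)]
  have : Algebra.EssFiniteType (FractionRing P) F := Algebra.EssFiniteType.of_comp K _ F
  have : CharZero (FractionRing P) := charZero_of_injective_algebraMap
    (algebraMap K (FractionRing P)).injective
  -- In characteristic zero `F` is formally smooth over the field generated by `y`, hence over the
  -- polynomial ring `P`. The first cotangent homology therefore vanishes, and `F ⊗ Ω_P → Ω_F` is
  -- injective.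
  have : Algebra.FormallySmooth (FractionRing P) F := Algebra.FormallySmooth.of_perfectField
  have : Algebra.FormallySmooth P (FractionRing P) :=
    Algebra.FormallySmooth.of_isLocalization (nonZeroDivisors P)
  have : Algebra.FormallySmooth P F := .comp P (FractionRing P) F
  have hinj : Function.Injective (mapBaseChange K P F) := by
    rw [injective_iff_map_eq_zero]
    intro a ha
    obtain ⟨b, rfl⟩ := (Algebra.H1Cotangent.exact_δ_mapBaseChange K P F a).mp ha
    rw [Subsingleton.elim b 0, map_zero]
  have h1 := ((mvPolynomialBasis K (Fin m)).baseChange F).linearIndependent.map'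
    (mapBaseChange K P F) (LinearMap.ker_eq_bot.mpr hinj)
  have h2 : ∀ i, mapBaseChange K P F (((mvPolynomialBasis K (Fin m)).baseChange F) i) =
      D K F (y i) := by
    intro i
    rw [Module.Basis.baseChange_apply, mvPolynomialBasis_apply]
    refine (mapBaseChange_tmul K P F _ _).trans ?_
    rw [one_smul, map_D]
    exact congrArg _ (MvPolynomial.aeval_X y i)
  simpa only [Function.comp_def, h2] using h1

variable {O : Type*} [CommRing O] [IsLocalRing O] [Algebra K O] [Algebra.EssFiniteType K O]
  [Algebra O F] [IsFractionRing O F] [IsScalarTower K O F] {d : ℕ} {x : Fin d → O}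

/-- The Jacobian matrix `b` of algebraically independent functions with respect to parameters `x`
has a right inverse up to a nonzero factor. -/
theorem exists_jacobian_right_inverse (hs : Ideal.span (Set.range x) = maximalIdeal O)
    (hr : ∀ a : O, ∃ c : K, a - algebraMap K O c ∈ maximalIdeal O) {y : Fin m → O}
    (hy : AlgebraicIndependent K fun i => algebraMap O F (y i)) :
    ∃ (b : Fin m → Fin d → O) (c : Fin d → Fin m → O) (h : O), h ∈ nonZeroDivisors O ∧
      (∀ i, KaehlerDifferential.D K O (y i) = ∑ j, b i j • KaehlerDifferential.D K O (x j)) ∧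
      ∀ i k, ∑ j, b i j * c j k = if i = k then h else 0 := by
  have : Algebra.EssFiniteType O F := Algebra.EssFiniteType.of_isLocalization _ (nonZeroDivisors O)
  have : Algebra.EssFiniteType K F := Algebra.EssFiniteType.comp K O F
  have hb : ∀ i, ∃ b : Fin d → O, KaehlerDifferential.D K O (y i) =
      ∑ j, b j • KaehlerDifferential.D K O (x j) := by
    intro i
    have h1 : KaehlerDifferential.D K O (y i) ∈
        Submodule.span O (Set.range fun j => KaehlerDifferential.D K O (x j)) := by
      rw [span_D_eq_top hs hr]
      trivial
    obtain ⟨b, hb⟩ := (Submodule.mem_span_range_iff_exists_fun O).mp h1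
    exact ⟨b, hb.symm⟩
  choose b hb using hb
  have hli := linearIndependent_D hy
  obtain ⟨g, hg⟩ := (Fintype.linearCombination F
    fun i => KaehlerDifferential.D K F (algebraMap O F (y i))).exists_leftInverse_of_injective
    (by rw [LinearMap.ker_eq_bot]; exact linearIndependent_iff_injective_fintypeLinearCombination.mp hli)
  have hgi : ∀ i, g (KaehlerDifferential.D K F (algebraMap O F (y i))) = Pi.single i 1 := by
    intro i
    have := LinearMap.congr_fun hg (Pi.single i 1)
    simpa using this
  have hF : ∀ i, KaehlerDifferential.D K F (algebraMap O F (y i)) =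
      ∑ j, algebraMap O F (b i j) • KaehlerDifferential.D K F (algebraMap O F (x j)) := by
    intro i
    have := congrArg (KaehlerDifferential.map K K O F) (hb i)
    simpa [KaehlerDifferential.map_D] using this
  -- A left inverse `g` of the family `dy_i` over `F`, evaluated at the `dx_j`, is a right inverse
  -- of the Jacobian; `h` clears its denominators.
  obtain ⟨h, hc⟩ := IsLocalization.exist_integer_multiples_of_finite (nonZeroDivisors O)
    fun q : Fin d × Fin m => g (KaehlerDifferential.D K F (algebraMap O F (x q.1))) q.2
  choose c hc using hc
  refine ⟨b, fun j k => c (j, k), h, h.2, hb, ?_⟩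
  intro i k
  apply IsFractionRing.injective O F
  have h1 := congrFun (congrArg g (hF i)) k
  rw [hgi, map_sum] at h1
  simp only [map_smul, Finset.sum_apply, Pi.smul_apply, smul_eq_mul] at h1
  simp only [map_sum, map_mul, hc, Algebra.smul_def]
  have h2 : ∀ j, algebraMap O F (b i j) * (algebraMap O F h *
      g (KaehlerDifferential.D K F (algebraMap O F (x j))) k) = algebraMap O F h *
      (algebraMap O F (b i j) * g (KaehlerDifferential.D K F (algebraMap O F (x j))) k) :=
    fun j => by ring
  simp only [h2, ← Finset.mul_sum, ← h1]
  by_cases hik : i = k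
  · subst hik
    simp
  · rw [if_neg hik, Pi.single_eq_of_ne (Ne.symm hik)]
    simp

end GenericRank

/-! ### Derivations of complete local rings -/

section Derivations

variable {K : Type*} {A B : Type u} [Field K] [CommRing A] [IsLocalRing A] [CommRing B] [IsLocalRing B]
  {d m : ℕ} {k : K →+* A} {kB : K →+* B} {x : Fin d → A} {y : Fin m → B}

theorem IsCoord.exists_derivation [IsAdicComplete (maximalIdeal A) A] (h : IsCoord k x) :
    ∃ δ : Fin d → Derivation ℤ A A, (∀ j c, δ j (k c) = 0) ∧
      ∀ j i, δ j (x i) = if i = j then 1 else 0 := by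
  obtain ⟨Θ, hc, hX⟩ := exists_ringEquiv_mvPowerSeries h
  refine ⟨fun j => Derivation.mk' (AddMonoidHom.toIntLinearMap
    { toFun := fun a => Θ (MvPowerSeries.pderiv K j (Θ.symm a))
      map_zero' := by simp
      map_add' := by simp }) ?_, ?_, ?_⟩
  · intro a b
    simp [Derivation.leibniz]
  · intro j c
    change Θ (MvPowerSeries.pderiv K j (Θ.symm (k c))) = 0
    rw [← hc, Θ.symm_apply_apply, MvPowerSeries.pderiv_C, map_zero]
  · intro j i
    change Θ (MvPowerSeries.pderiv K j (Θ.symm (x i))) = _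
    rw [← hX, Θ.symm_apply_apply]
    by_cases hij : i = j
    · rw [if_pos hij, hij, MvPowerSeries.pderiv_X_self, map_one]
    · rw [if_neg hij, MvPowerSeries.pderiv_X_of_ne hij, map_zero]

theorem Derivation.mem_pow_of_mem_pow_succ [Algebra B A] [IsLocalHom (algebraMap B A)]
    (D : Derivation ℤ B A) (n : ℕ) {b : B} (hb : b ∈ maximalIdeal B ^ (n + 1)) :
    D b ∈ maximalIdeal A ^ n := by
  induction n generalizing b with
  | zero => simp
  | succ n ih =>
    rw [pow_succ] at hb
    refine Submodule.mul_induction_on hb ?_ ?_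
    · intro a ha c hc
      have ha' := maximalIdeal_pow_le_comap (algebraMap B A) (n + 1) ha
      have hc' : algebraMap B A c ∈ maximalIdeal A := (map_mem_nonunits_iff _ c).mpr hc
      rw [D.leibniz, Algebra.smul_def, Algebra.smul_def]
      refine add_mem (Ideal.mul_mem_right _ _ ha') ?_
      rw [pow_succ']
      exact Ideal.mul_mem_mul hc' (ih ha)
    · intro a c ha hc
      rw [map_add]
      exact add_mem ha hc

/-- The Leibniz rule makes `D` vanish on polynomials in `y`. Since `D` lowers the adic order by at
most one, `D b` lies in every power of the maximal ideal of `A`. -/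
theorem Derivation.eq_zero_of_coord [IsHausdorff (maximalIdeal A) A] [Algebra B A]
    [IsLocalHom (algebraMap B A)] (h : IsCoord kB y) (D : Derivation ℤ B A)
    (hk : ∀ c, D (kB c) = 0) (hy : ∀ i, D (y i) = 0) : D = 0 := by
  have hF : ∀ F : MvPolynomial (Fin m) K, D (F.eval₂Hom kB y) = 0 := by
    intro F
    induction F using MvPolynomial.induction_on with
    | C c => simpa using hk c
    | add F G hF hG => rw [map_add, map_add, hF, hG, add_zero]
    | mul_X F i hF => rw [map_mul, D.leibniz, hF]; simp [hy]
  ext b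
  refine IsHausdorff.haus (inferInstance : IsHausdorff (maximalIdeal A) A) _ fun n => ?_
  obtain ⟨F, hb⟩ := exists_eval_sub_mem_pow h.span h.residue (n + 1) b
  have := Derivation.mem_pow_of_mem_pow_succ D n hb
  rw [map_sub, hF, sub_zero] at this
  rw [SModEq.zero, smul_eq_mul, Ideal.mul_top]
  exact this

theorem Derivation.sum_apply {R S M ι : Type*} [CommRing R] [CommRing S] [Algebra R S]
    [AddCommGroup M] [Module R M] [Module S M] (s : Finset ι) (D : ι → Derivation R S M) (a : S) :
    (∑ i ∈ s, D i) a = ∑ i ∈ s, D i a := by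
  have := congrFun (map_sum (Derivation.coeFnAddMonoidHom (R := R) (A := S) (M := M)) D s) a
  rwa [Finset.sum_apply] at this

/-- The chain rule in complete local rings. -/
theorem derivation_map_eq_sum [IsHausdorff (maximalIdeal A) A] [Algebra B A]
    [IsLocalHom (algebraMap B A)] (h : IsCoord kB y) (hk : ∀ c, algebraMap B A (kB c) = k c)
    {δ' : Fin m → Derivation ℤ B B} (hδk : ∀ i c, δ' i (kB c) = 0)
    (hδy : ∀ i j, δ' i (y j) = if j = i then 1 else 0) (δ : Derivation ℤ A A)
    (hδ : ∀ c, δ (k c) = 0) (b : B) :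
    δ (algebraMap B A b) = ∑ i, algebraMap B A (δ' i b) * δ (algebraMap B A (y i)) := by
  have hD : δ.compAlgebraMap B - ∑ i, (LinearMap.toSpanSingleton B A
      (δ (algebraMap B A (y i)))).compDer (δ' i) = 0 := by
    refine Derivation.eq_zero_of_coord h _ ?_ ?_
    · intro c
      simp [Derivation.sum_apply, hk, hδ, hδk]
    · intro j
      simp [Derivation.sum_apply, hδy]
  have := Derivation.congr_fun hD b
  rw [Derivation.sub_apply, Derivation.zero_apply, sub_eq_zero] at this
  rw [show δ (algebraMap B A b) = δ.compAlgebraMap B b from rfl, this]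
  simp [Derivation.sum_apply, Algebra.smul_def]

theorem Jet.res_derivation {J : Jet k x} (h : IsCoord k x) {δ : Fin d → Derivation ℤ A A}
    (hδk : ∀ i c, δ i (k c) = 0) (hδx : ∀ i j, δ i (x j) = if j = i then 1 else 0) (i : Fin d)
    (a : A) : J.res (δ i a) = J.lin a i := by
  have h1 := J.sub_const_mem a
  rw [← h.span, Ideal.mem_span_range_iff_exists_fun] at h1
  obtain ⟨b, hb⟩ := h1
  have hx : ∀ j, J.res (x j) = 0 := fun j => (J.mem_iff _).mp (h.mem j)
  have h2 : a = k (J.res a) + ∑ j, b j * x j := by rw [hb]; ring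
  generalize J.res a = c at h2
  subst h2
  simp [hδk, Derivation.leibniz, hδx, hx, J.lin_const, J.lin_mul, J.lin_coord, Finset.sum_add_distrib,
    Pi.single_apply, Finset.sum_apply]

/-- If `f i` is an eigenvector of `e • D` with eigenvalue `t i`, so are the monomials in the
`f i`. -/
theorem derivation_prod_pow {A ι : Type*} [CommRing A] (D : Derivation ℤ A A) {e : A} {f t : ι → A}
    (hf : ∀ j, e * D (f j) = t j * f j) (s : Finset ι) (b : ι → ℕ) :
    e * D (∏ j ∈ s, f j ^ b j) = (∑ j ∈ s, b j * t j) * ∏ j ∈ s, f j ^ b j := by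
  have hpow : ∀ j (n : ℕ), e * D (f j ^ n) = n * t j * f j ^ n := by
    intro j n
    induction n with
    | zero => simp
    | succ n ih =>
      rw [pow_succ, D.leibniz, smul_eq_mul, smul_eq_mul, mul_add, mul_left_comm, hf,
        mul_left_comm e, ih]
      push_cast
      ring
  classical
  induction s using Finset.induction_on with
  | empty => simp
  | insert i s hi ih =>
    rw [Finset.prod_insert hi, Finset.sum_insert hi, D.leibniz, smul_eq_mul, smul_eq_mul, mul_add,
      mul_left_comm, ih, mul_left_comm e, hpow]
    ring

/-- Logarithmic derivations act diagonally on characters. The factor `e` is `x i` in the directions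
of the divisor and `1` in the others, and the residues of the eigenvalues are the entries of the
logarithmic vector. -/
theorem Chart.exists_eigenvalue {J : Jet k x} (h : IsCoord k x) {n : ℕ} {hn : n ≤ d}
    {S : AddSubmonoid (Fin d → ℤ)} {χ : S → A} (C : Chart J hn S χ)
    {δ : Fin d → Derivation ℤ A A} (hδk : ∀ i c, δ i (k c) = 0)
    (hδx : ∀ i j, δ i (x j) = if j = i then 1 else 0) (i : Fin d) :
    ∃ e : A, ∀ s : S, ∃ t : A, e * δ i (χ s) = t * χ s ∧ J.res t = C.logVec s i := by
  have key : ∀ (e : A) (t : Fin n → A),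
      (∀ j, e * δ i (x (Fin.castLE hn j)) = t j * x (Fin.castLE hn j)) → ∀ s : S,
      e * δ i (χ s) = (e * δ i (Additive.toMul (C.u s) : Aˣ) * ((Additive.toMul (C.u s))⁻¹ : Aˣ) +
        ∑ j, ((C.b s j).toNat : A) * t j) * χ s := by
    intro e t ht s
    have h1 := derivation_prod_pow (δ i) ht Finset.univ fun j => (C.b s j).toNat
    rw [C.eq_mul, Derivation.leibniz, smul_eq_mul, smul_eq_mul, mul_add, mul_left_comm, h1]
    set u := Additive.toMul (C.u s)
    have hu : ((u⁻¹ : Aˣ) : A) * u = 1 := u.inv_mul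
    linear_combination (-e * δ i u * ∏ j, x (Fin.castLE hn j) ^ (C.b s j).toNat) * hu
  have hcast : ∀ (s : S) (j : Fin n), (((C.b s j).toNat : ℕ) : K) = (C.b s j : K) := fun s j => by
    rw [← Int.cast_natCast, Int.toNat_of_nonneg (C.nonneg s j)]
  by_cases hi : (i : ℕ) < n
  · refine ⟨x i, fun s => ⟨_, key (x i) (fun j => if (j : ℕ) = i then 1 else 0) ?_ s, ?_⟩⟩
    · intro j
      rw [hδx]
      by_cases hj : (j : ℕ) = i
      · have : Fin.castLE hn j = i := Fin.ext hj
        rw [if_pos this, if_pos hj, this]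
        ring
      · have : Fin.castLE hn j ≠ i := fun h => hj (congrArg Fin.val h)
        simp [this, hj]
    · have h1 : C.logVec s i = (C.b s ⟨i, hi⟩ : K) := dif_pos hi
      have h2 : J.res (x i) = 0 := (J.mem_iff _).mp (h.mem i)
      rw [h1, map_add, map_mul, map_mul, h2, map_sum, zero_mul, zero_mul, zero_add,
        Finset.sum_eq_single ⟨i, hi⟩]
      · simp [hcast]
      · intro j _ hj
        have : ¬ (j : ℕ) = i := fun h => hj (Fin.ext h)
        simp [this]
      · simp
  · refine ⟨1, fun s => ⟨_, key 1 0 ?_ s, ?_⟩⟩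
    · intro j
      have : Fin.castLE hn j ≠ i := fun h => hi (by rw [← h]; exact j.2)
      simp [hδx, this]
    · have h1 : C.logVec s i = J.dlog (C.u s) i := dif_neg hi
      set u := Additive.toMul (C.u s)
      have h2 := J.lin_unit u
      have h3 : J.res (u : A) * J.res ((u⁻¹ : Aˣ) : A) = 1 := by
        rw [← map_mul, u.mul_inv, map_one]
      rw [h1, one_mul]
      simp only [Pi.zero_apply, mul_zero, Finset.sum_const_zero, add_zero, map_mul,
        Jet.res_derivation h hδk hδx, h2, Pi.smul_apply, smul_eq_mul]
      change _ = J.dlog (Additive.ofMul u) i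
      linear_combination J.dlog (Additive.ofMul u) i * h3

/-- A homomorphism of generically maximal rank between complete regular local rings which is
monomial with respect to charts is injective on the monomials. -/
theorem injective_of_jacobian [IsAdicComplete (maximalIdeal A) A]
    [IsAdicComplete (maximalIdeal B) B] (h : IsCoord k x) (h' : IsCoord kB y)
    {J' : Jet kB y} {l : ℕ} {hl : l ≤ m} {S' : AddSubmonoid (Fin m → ℤ)} {χ' : S' → B}
    (C' : Chart J' hl S' χ')
    (hC' : ∀ (ι : Type) (v : ι → Fin m → ℤ), LinearIndependent ℤ v →
        LinearIndependent K fun i => C'.logVec (v i))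
    [Algebra B A] [IsLocalHom (algebraMap B A)] (hk : ∀ c, algebraMap B A (kB c) = k c)
    (hJ : ∀ δ : Fin d → Derivation ℤ A A, (∀ j c, δ j (k c) = 0) →
      (∀ j i, δ j (x i) = if i = j then 1 else 0) → ∃ (c : Fin d → Fin m → A) (w : A), w ≠ 0 ∧
        ∀ i i', ∑ j, δ j (algebraMap B A (y i)) * c j i' = if i = i' then w else 0)
    {M : Type*} [AddCommGroup M] (γ : (Fin m → ℤ) →+ M)
    (hγ : ∀ s t : S', γ s = γ t → algebraMap B A (χ' s) = algebraMap B A (χ' t))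
    (hne : ∀ s, algebraMap B A (χ' s) ≠ 0) (s₀ : S')
    (hs₀ : ∀ t : Fin m → ℤ, ∃ N : ℕ, N • (s₀ : Fin m → ℤ) + t ∈ S') :
    Function.Injective γ := by
  have := h.isDomain
  rw [injective_iff_map_eq_zero]
  intro v hv
  -- For `v` in the kernel of `γ`, the characters of `N s₀ + v` and `N s₀` have the same image in
  -- `A`; it remains to see that their logarithmic vectors agree.
  obtain ⟨N, hN⟩ := hs₀ v
  have hst := hγ ⟨_, hN⟩ (N • s₀) (by simp [hv])
  set s : S' := ⟨_, hN⟩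
  set t : S' := N • s₀
  obtain ⟨δ, hδk, hδx⟩ := h.exists_derivation
  obtain ⟨δ', hδk', hδy'⟩ := h'.exists_derivation
  obtain ⟨c, w, hw, hc⟩ := hJ δ hδk hδx
  -- By the chain rule the vector of these images is annihilated by the Jacobian, which is
  -- invertible on one side up to the nonzero factor `w`. Injectivity of the map `B → A` is not
  -- needed for this.
  have hzero : ∀ i, algebraMap B A (δ' i (χ' s - χ' t)) = 0 := by
    intro i
    have h1 : ∀ j, ∑ i', algebraMap B A (δ' i' (χ' s - χ' t)) * δ j (algebraMap B A (y i')) = 0 := by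
      intro j
      rw [← derivation_map_eq_sum h' hk hδk' hδy' (δ j) (hδk j), map_sub, hst, sub_self, map_zero]
    have h2 : ∑ j, (∑ i', algebraMap B A (δ' i' (χ' s - χ' t)) * δ j (algebraMap B A (y i'))) *
        c j i = 0 := by simp only [h1, zero_mul, Finset.sum_const_zero]
    simp only [Finset.sum_mul] at h2
    rw [Finset.sum_comm] at h2
    simp only [mul_assoc, ← Finset.mul_sum, hc] at h2
    simpa [hw] using h2
  -- Map the two eigenvalue equations to `A`: their difference is `(a - b) χ' t`, so `a - b` maps to
  -- zero. It is then no unit, and the residues of the eigenvalues coincide.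
  have hlog : C'.logVec s = C'.logVec t := by
    ext i
    obtain ⟨e, he⟩ := C'.exists_eigenvalue h' hδk' hδy' i
    obtain ⟨a, ha, ha'⟩ := he s
    obtain ⟨b, hb, hb'⟩ := he t
    have h1 : algebraMap B A (a - b) * algebraMap B A (χ' t) = 0 := by
      have h2 := hzero i
      rw [map_sub, map_sub, sub_eq_zero] at h2
      have h3 := congrArg (algebraMap B A) ha
      have h4 := congrArg (algebraMap B A) hb
      rw [map_mul, map_mul, hst] at h3
      rw [map_mul, map_mul] at h4
      rw [map_sub, sub_mul, ← h3, ← h4, h2, sub_self]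
    have h2 : algebraMap B A (a - b) = 0 := (mul_eq_zero.mp h1).resolve_right (hne t)
    have h3 : J'.res (a - b) = 0 := by
      rw [← J'.mem_iff]
      intro hu
      exact not_isUnit_zero (h2 ▸ hu.map (algebraMap B A))
    rw [map_sub, sub_eq_zero, ha', hb'] at h3
    exact h3
  by_contra hv0
  have hli : LinearIndependent ℤ (fun _ : Unit => v) :=
    LinearIndependent.of_subsingleton () hv0
  refine (hC' Unit _ hli).ne_zero () ?_
  have h1 : (s : Fin m → ℤ) = t + v := rfl
  have h2 : C'.logVec s = C'.logVec t + C'.logVec v := by rw [h1, map_add]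
  rw [hlog] at h2
  simpa using h2

end Derivations

/-! ### From local toric models to the monomial normal form -/

section LocalAlgebra

variable {R S : Type u} [CommRing R] [IsLocalRing R] [CommRing S] [IsLocalRing S]

theorem isLocalHom_completionMap [IsNoetherianRing R] [IsNoetherianRing S] (f : R →+* S)
    [IsLocalHom f] : IsLocalHom (completionMap f) := by
  refine ((local_hom_TFAE (completionMap f)).out 0 2).mpr ?_
  rw [AdicCompletion.maximalIdeal_eq_map, AdicCompletion.maximalIdeal_eq_map, Ideal.map_map]
  have h1 : (completionMap f).comp (algebraMap R (Completion R)) =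
      (algebraMap S (Completion S)).comp f := RingHom.ext (completionMap_algebraMap f)
  rw [h1, ← Ideal.map_map]
  exact Ideal.map_mono (((local_hom_TFAE f).out 0 2).mp ‹IsLocalHom f›)

/-- Restricted to `O`, the derivation `δ` is `K`-linear and factors through the Kähler
differentials. -/
theorem derivation_eq_sum_of_D_eq {K O A : Type*} [CommRing K] [CommRing O] [CommRing A]
    [Algebra K O] [Algebra O A] {d : ℕ} {x b : Fin d → O} {f : O}
    (hf : KaehlerDifferential.D K O f = ∑ j, b j • KaehlerDifferential.D K O (x j))
    (δ : Derivation ℤ A A) (hδ : ∀ c : K, δ (algebraMap O A (algebraMap K O c)) = 0) :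
    δ (algebraMap O A f) = ∑ j, algebraMap O A (b j) * δ (algebraMap O A (x j)) := by
  let _ : Module K A := Module.compHom A ((algebraMap O A).comp (algebraMap K O))
  have : IsScalarTower K O A := ⟨fun c a z => by
    change (c • a) • z = algebraMap O A (algebraMap K O c) * (a • z)
    rw [Algebra.smul_def c a, mul_smul, Algebra.smul_def]⟩
  let D : Derivation K O A := Derivation.mk'
    { toFun := fun a => δ (algebraMap O A a)
      map_add' := by simp
      map_smul' := by
        intro c a
        change _ = algebraMap O A (algebraMap K O c) * _
        rw [Algebra.smul_def, map_mul, δ.leibniz, hδ, smul_zero, add_zero]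
        rfl } (by
      intro a b
      change δ (algebraMap O A (a * b)) = a • δ _ + b • δ _
      rw [map_mul, δ.leibniz]
      simp only [Algebra.smul_def, Algebra.algebraMap_self, RingHom.id_apply])
  have h1 := congrArg D.liftKaehlerDifferential hf
  simp only [map_sum, map_smul, Derivation.liftKaehlerDifferential_comp_D] at h1
  simp only [Algebra.smul_def] at h1
  exact h1

theorem algebraicIndependent_map {K R F ι : Type*} [CommRing K] [CommRing R] [CommRing F]
    [Algebra K R] [Algebra K F] {y : ι → R} (hy : AlgebraicIndependent K y) (f : R →+* F)
    (hfK : ∀ c, f (algebraMap K R c) = algebraMap K F c) (hf : Function.Injective f) :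
    AlgebraicIndependent K fun i => f (y i) :=
  hy.map' (f := { f with commutes' := hfK }) hf

/-- A homomorphism of completed local rings which is monomial with respect to charts is injective on
the monomials if the parameters of the source are algebraically independent functions on the
target. -/
theorem injective_of_algebraicIndependent {K O A B : Type u} (F : Type*) [Field K] [CharZero K]
    [CommRing O] [IsLocalRing O] [Algebra K O] [Algebra.EssFiniteType K O] [Field F] [Algebra O F]
    [IsFractionRing O F] [Algebra K F] [IsScalarTower K O F] [CommRing A] [IsLocalRing A]
    [CommRing B] [IsLocalRing B] [IsAdicComplete (maximalIdeal A) A]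
    [IsAdicComplete (maximalIdeal B) B] {d m : ℕ} {k : K →+* A} {kB : K →+* B} {x : Fin d → A}
    {y : Fin m → B} (g : O →+* A) (hg : Function.Injective g)
    (hgk : ∀ c, g (algebraMap K O c) = k c) {xO : Fin d → O} {yO : Fin m → O}
    (hgx : ∀ i, g (xO i) = x i) (hx : Ideal.span (Set.range xO) = maximalIdeal O)
    (hr : ∀ a : O, ∃ c : K, a - algebraMap K O c ∈ maximalIdeal O)
    (hy : AlgebraicIndependent K fun i => algebraMap O F (yO i))
    (h : IsCoord k x) (h' : IsCoord kB y)
    {J' : Jet kB y} {l : ℕ} {hl : l ≤ m} {S' : AddSubmonoid (Fin m → ℤ)} {χ' : S' → B}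
    (C' : Chart J' hl S' χ')
    (hC' : ∀ (ι : Type) (v : ι → Fin m → ℤ), LinearIndependent ℤ v →
        LinearIndependent K fun i => C'.logVec (v i))
    (Φ : B →+* A) [IsLocalHom Φ] (hk : ∀ c, Φ (kB c) = k c) (hΦy : ∀ i, Φ (y i) = g (yO i))
    {M : Type*} [AddCommGroup M] (γ : (Fin m → ℤ) →+ M)
    (hγ : ∀ s t : S', γ s = γ t → Φ (χ' s) = Φ (χ' t)) (hne : ∀ s, Φ (χ' s) ≠ 0) (s₀ : S')
    (hs₀ : ∀ t : Fin m → ℤ, ∃ N : ℕ, N • (s₀ : Fin m → ℤ) + t ∈ S') :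
    Function.Injective γ := by
  let _ := Φ.toAlgebra
  have hl : IsLocalHom (algebraMap B A) := ‹IsLocalHom Φ›
  refine injective_of_jacobian h h' C' hC' hk ?_ γ hγ hne s₀ hs₀
  intro δ hδk hδx
  let _ := g.toAlgebra
  obtain ⟨b, c, w, hw, hb, hc⟩ := exists_jacobian_right_inverse hx hr hy
  have := (IsFractionRing.injective O F).nontrivial
  refine ⟨fun j i => g (c j i), g w, ?_, ?_⟩
  · intro h0
    exact nonZeroDivisors.ne_zero hw (hg (h0.trans (map_zero _).symm))
  · intro i i'
    -- The formal partial derivatives take the values of the algebraic Jacobian matrix, because `δ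
    -- j` is dual to the parameters `xO`.
    have h1 : ∀ j, δ j (Φ (y i)) = g (b i j) := by
      intro j
      rw [hΦy]
      refine (derivation_eq_sum_of_D_eq (hb i) (δ j) fun c => ?_).trans ?_
      · exact (congrArg (δ j) (hgk c)).trans (hδk j c)
      · refine (Finset.sum_congr rfl fun j' _ => congrArg _
          ((congrArg (δ j) (hgx j')).trans (hδx j j'))).trans ?_
        simp
        rfl
    change ∑ j, δ j (Φ (y i)) * g (c j i') = _
    simp only [h1, ← map_mul, ← map_sum, hc]
    split_ifs
    · rfl
    · exact map_zero _

end LocalAlgebra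

section Forward

variable {K : Type u} [Field K] {X Y : Scheme.{u}} {sX : X ⟶ Spec (CommRingCat.of K)}
  {sY : Y ⟶ Spec (CommRingCat.of K)} {φ : X ⟶ Y} {d m : ℕ}

/-- A dominant quasi-compact morphism to the integral scheme `Y` is injective on sections over
opens, and on the integral scheme `X` a section with vanishing germ is zero. -/
theorem stalkMap_injective_of_isDominant (φ : X ⟶ Y) [IsIntegral X] [IsIntegral Y]
    [QuasiCompact φ] [IsDominant φ] (p : X) : Function.Injective (φ.stalkMap p) := by
  have := IsSchemeTheoreticallyDominant.of_isDominant φ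
  obtain ⟨U, hU, hpU, -⟩ := exists_isAffineOpen_mem_and_subset (U := ⊤) (x := φ p) trivial
  refine hU.stalkMap_injective φ p hpU fun g hg => ?_
  have h1 : X.presheaf.germ (φ ⁻¹ᵁ U) p hpU (φ.app U g) = 0 := by
    rw [← hg]
    exact (congrArg (fun f => f.hom g) (Scheme.Hom.germ_stalkMap φ U p hpU)).symm
  have h2 : φ.app U g = 0 :=
    germ_injective_of_isIntegral X p hpU (h1.trans (map_zero _).symm)
  have h3 : g = 0 := φ.app_injective U (h2.trans (map_zero _).symm)
  rw [h3, map_zero]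

theorem completedStalkMap_const (hφ : φ ≫ sY = sX) (p : X) (c : K) :
    completedStalkMap φ p (const sY (φ p) c) = const sX p c :=
  (completionMap_algebraMap (φ.stalkMap p).hom (baseMap sY (φ p) c)).trans
    (congrArg _ (stalkMap_baseMap sX sY hφ p c))

theorem completedIdeal_eq_span {D : ReducedDivisor X} {p : X} {ι : Type*} {s : Finset ι}
    {x : ι → X.presheaf.stalk p}
    (h : stalkIdeal X D.support p = Ideal.span {∏ j ∈ s, x j}) :
    completedIdeal X D.support p =
      Ideal.span {∏ j ∈ s, algebraMap (X.presheaf.stalk p) (completedStalk X p) (x j)} := by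
  rw [completedIdeal, h, Ideal.map_span, Set.image_singleton, map_prod]

/-- Algebraically independent germs pull back to algebraically independent functions under a
dominant morphism. -/
theorem algebraicIndependent_stalkMap [IsIntegral X] [IsIntegral Y] [QuasiCompact φ]
    [IsDominant φ] (hφ : φ ≫ sY = sX) {p : X} {y : Fin m → Y.presheaf.stalk (φ p)}
    (hy : IsCoord (baseMap sY (φ p)) y) :
    @AlgebraicIndependent _ K X.functionField (fun i =>
      algebraMap (X.presheaf.stalk p) X.functionField ((φ.stalkMap p).hom (y i))) _ _
        (baseMap sX (genericPoint X)).toAlgebra := by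
  let _ := (baseMap sY (φ p)).toAlgebra
  let _ := (baseMap sX (genericPoint X)).toAlgebra
  refine algebraicIndependent_map (IsCoord.algebraicIndependent hy)
    ((algebraMap (X.presheaf.stalk p) X.functionField).comp (φ.stalkMap p).hom) (fun c => ?_)
    ((IsFractionRing.injective (X.presheaf.stalk p) X.functionField).comp
      (stalkMap_injective_of_isDominant φ p))
  exact (congrArg (algebraMap (X.presheaf.stalk p) X.functionField)
    (stalkMap_baseMap sX sY hφ p c)).trans (congrArg (fun f => f c) (algebraMap_baseMap sX p))

/-- A morphism which is locally formally isomorphic to a toric morphism has the monomial normal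
form. -/
theorem IsToroidal.hasToroidalForm [IsAlgClosed K] [CharZero K] (hX : IsNonsingularVariety sX d)
    (hY : IsNonsingularVariety sY m) (hφ : φ ≫ sY = sX) [IsDominant φ] {DX : ReducedDivisor X}
    {DY : ReducedDivisor Y} (hDY : DY.IsSNC m) (hDX : DX.IsSNC d)
    (hD : DX.support = φ ⁻¹' DY.support) (ht : IsToroidal sX sY φ d m DX DY) {p : X}
    (hp : IsClosed ({p} : Set X)) {n l : ℕ} (hn : DX.IsNPoint n p) (hl : DY.IsNPoint l (φ p)) :
    HasToroidalForm sX φ d m DX DY p n l := by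
  have := hX.isIntegral
  have := hY.isIntegral
  have := hX.locallyOfFiniteType
  have := hY.locallyOfFiniteType
  have := hX.regular p
  have := hY.regular (φ p)
  have : QuasiCompact φ := by
    have := hY.isSeparated
    have : QuasiCompact (φ ≫ sY) := hφ ▸ hX.quasiCompact
    exact QuasiCompact.of_comp φ sY
  obtain ⟨σ, τ, p', ψ, ιp, ιq, hψ, hιp, hιq, hcomm⟩ := ht p hp
  obtain ⟨hnd, x, hx, hxI⟩ := hDX.exists_isCoord hX hp hn
  obtain ⟨hlm, y, hy, hyI⟩ := hDY.exists_isCoord hY (isClosed_singleton_map sX sY hφ hp) hl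
  have h : IsCoord (const sX p) fun i => algebraMap (X.presheaf.stalk p) (completedStalk X p) (x i) :=
    hx.completion
  have h' : IsCoord (const sY (φ p)) fun i =>
    algebraMap (Y.presheaf.stalk (φ p)) (completedStalk Y (φ p)) (y i) := hy.completion
  obtain ⟨J⟩ := h.nonempty_jet
  obtain ⟨J'⟩ := h'.nonempty_jet
  have hI := completedIdeal_eq_span hxI
  have hI' := completedIdeal_eq_span hyI
  obtain ⟨C, hC⟩ := exists_chart_of_isLocalModel hιp h J hnd hI
  obtain ⟨C', hC'⟩ := exists_chart_of_isLocalModel hιq h' J' hlm hI'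
  obtain ⟨γ, hγ, hγψ⟩ := hψ.exists_addMonoidHom
  have : IsLocalHom (completedStalkMap φ p) := isLocalHom_completionMap (φ.stalkMap p).hom
  have hΦ : ∀ s : τ.semigroup, completedStalkMap φ p
      (ιq.symm (formalCharacter K τ (ψ p') (Multiplicative.ofAdd s))) =
      ιp.symm (formalCharacter K σ p' (Multiplicative.ofAdd ⟨γ s, hγ s⟩)) := by
    intro s
    rw [RingEquiv.eq_symm_apply, hcomm, RingEquiv.apply_symm_apply, hγψ]
  have := h.isDomain
  have := h'.isDomain
  obtain ⟨s₀, hs₀⟩ := τ.exists_interior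
  -- Dominance is used here: the parameters of `Y` at `φ p` remain algebraically independent in the
  -- function field of `X`.
  have hinj : Function.Injective γ := by
    let _ := (baseMap sX p).toAlgebra
    let _ := (baseMap sX (genericPoint X)).toAlgebra
    have : IsScalarTower K (X.presheaf.stalk p) X.functionField :=
      IsScalarTower.of_algebraMap_eq' (algebraMap_baseMap sX p).symm
    have : Algebra.EssFiniteType K (X.presheaf.stalk p) := baseMap_essFiniteType sX p
    refine injective_of_algebraicIndependent X.functionField
      (algebraMap (X.presheaf.stalk p) (completedStalk X p)) algebraMap_completion_injective
      (fun c => rfl) (fun i => rfl) hx.span (exists_sub_baseMap_mem sX hp)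
      (algebraicIndependent_stalkMap hφ hy) h h' C' hC' (completedStalkMap φ p)
      (completedStalkMap_const hφ p)
      (fun i => completionMap_algebraMap (φ.stalkMap p).hom (y i)) γ ?_ ?_ s₀ hs₀
    · intro s t hst
      have : (⟨γ s, hγ s⟩ : σ.semigroup) = ⟨γ t, hγ t⟩ := Subtype.ext hst
      rw [hΦ, hΦ, this]
    · intro s
      rw [hΦ, C.eq_mul]
      exact mul_ne_zero (Units.ne_zero _)
        (Finset.prod_ne_zero_iff.mpr fun j _ => pow_ne_zero _ (h.prime _).ne_zero)
  -- As `D_X` is the preimage of `D_Y`, the ideal of `D_Y` pulls back into the ideal of `D_X`.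
  have hdvd : ∏ j : Fin n, algebraMap (X.presheaf.stalk p) (completedStalk X p)
      (x (Fin.castLE hnd j)) ∣ completedStalkMap φ p (∏ i : Fin l,
        algebraMap (Y.presheaf.stalk (φ p)) (completedStalk Y (φ p)) (y (Fin.castLE hlm i))) := by
    have h1 := completedIdeal_map_le φ p DY.support
    rw [← hD, hI, hI', Ideal.map_span, Set.image_singleton] at h1
    exact Ideal.span_singleton_le_span_singleton.mp h1
  obtain ⟨x', y', a, r, hrl, hrn, hr, α, hx', hy', hform⟩ := exists_normal_form h h' C C' hC hC'
    (completedStalkMap φ p) (completedStalkMap_const hφ p) γ hinj hγ hΦ s₀ hs₀ hdvd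
  exact ⟨hnd, hlm, x', y', a, r, hrl, hrn, hr, α,
    (ReducedDivisor.isPermissible_iff (x₀ := fun i => algebraMap (X.presheaf.stalk p)
      (completedStalk X p) (x i)) hI).mpr hx',
    (ReducedDivisor.isPermissible_iff (x₀ := fun i => algebraMap (Y.presheaf.stalk (φ p))
      (completedStalk Y (φ p)) (y i)) hI').mpr hy',
    hform⟩

end Forward

/-! ### Standard cones -/

section StandardCone

/-- The cone generated by the first `n` basis vectors. -/
def standardCone (d n : ℕ) : ToricCone d where
  cone := PointedCone.hull ℝ ((fun (v : Fin d → ℤ) (i : Fin d) => (v i : ℝ)) ''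
    ((Finset.univ.filter fun j : Fin d => (j : ℕ) < n).image fun j => Pi.single j 1 :
      Finset (Fin d → ℤ)))
  rational := ⟨_, rfl⟩
  strongly_convex := by
    have h : ∀ v ∈ PointedCone.hull ℝ ((fun (v : Fin d → ℤ) (i : Fin d) => (v i : ℝ)) ''
        ((Finset.univ.filter fun j : Fin d => (j : ℕ) < n).image fun j => Pi.single j 1 :
          Finset (Fin d → ℤ))), 0 ≤ v := by
      intro v hv
      induction hv using Submodule.span_induction with
      | mem v hv =>
        obtain ⟨w, hw, rfl⟩ := hv
        obtain ⟨j, -, rfl⟩ := Finset.mem_image.mp hw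
        intro i
        have : (0 : Fin d → ℤ) ≤ Pi.single j 1 := Pi.single_nonneg.mpr zero_le_one
        exact Int.cast_nonneg (this i)
      | zero => exact le_rfl
      | add v w _ _ hv hw => exact add_nonneg hv hw
      | smul c v _ hv => exact smul_nonneg c.2 hv
    intro v hv hv'
    exact le_antisymm (neg_nonneg.mp (h _ hv')) (h _ hv)

variable {d n : ℕ}

/-- The semigroup is `ℕ^n × ℤ^(d-n)`, so the toric variety is `𝔸^n × 𝔾_m^(d-n)`. -/
theorem mem_standardCone_semigroup (t : Fin d → ℤ) :
    t ∈ (standardCone d n).semigroup ↔ ∀ j : Fin d, (j : ℕ) < n → 0 ≤ t j := by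
  constructor
  · intro ht j hj
    have h1 : (fun i => (((Pi.single j 1 : Fin d → ℤ) i : ℤ) : ℝ)) ∈ (standardCone d n).cone :=
      PointedCone.subset_hull ⟨_, Finset.mem_coe.mpr (Finset.mem_image.mpr
        ⟨j, Finset.mem_filter.mpr ⟨Finset.mem_univ _, hj⟩, rfl⟩), rfl⟩
    have h2 := ht _ h1
    have h3 : (∑ i, (t i : ℝ) * (((Pi.single j 1 : Fin d → ℤ) i : ℤ) : ℝ)) = t j := by
      rw [Finset.sum_eq_single j]
      · simp
      · intro i _ hi
        simp [Pi.single_eq_of_ne hi]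
      · simp
    rw [h3] at h2
    exact_mod_cast h2
  · intro h v hv
    change v ∈ PointedCone.hull ℝ _ at hv
    induction hv using Submodule.span_induction with
    | mem v hv =>
      obtain ⟨w, hw, rfl⟩ := hv
      obtain ⟨j, hj, rfl⟩ := Finset.mem_image.mp hw
      have hj := (Finset.mem_filter.mp hj).2
      have h3 : (∑ i, (t i : ℝ) * (((Pi.single j 1 : Fin d → ℤ) i : ℤ) : ℝ)) = t j := by
        rw [Finset.sum_eq_single j]
        · simp
        · intro i _ hi
          simp [Pi.single_eq_of_ne hi]
        · simp
      rw [h3]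
      exact_mod_cast h j hj
    | zero => simp
    | add v w _ _ hv hw =>
      simp only [Pi.add_apply, mul_add, Finset.sum_add_distrib]
      exact add_nonneg hv hw
    | smul c v _ hv =>
      have : ∑ i, (t i : ℝ) * (c • v) i = (c : ℝ) * ∑ i, (t i : ℝ) * v i := by
        rw [Finset.mul_sum]
        refine Finset.sum_congr rfl fun i _ => ?_
        change (t i : ℝ) * ((c : ℝ) * v i) = _
        ring
      rw [this]
      exact mul_nonneg c.2 hv

/-- The basis vectors as elements of the semigroup of the standard cone. -/
def standardGen (d n : ℕ) (j : Fin d) : (standardCone d n).semigroup :=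
  ⟨Pi.single j 1, (mem_standardCone_semigroup _).mpr fun i _ =>
    (Pi.single_nonneg.mpr zero_le_one : (0 : Fin d → ℤ) ≤ Pi.single j 1) i⟩

theorem coe_sum_nsmul_standardGen (c : Fin d → ℕ) (i : Fin d) :
    ((∑ j, c j • standardGen d n j : (standardCone d n).semigroup) : Fin d → ℤ) i = c i := by
  rw [AddSubmonoid.coe_finsetSum, Finset.sum_apply, Finset.sum_eq_single i]
  · simp [standardGen]
  · intro j _ hj
    simp [standardGen, Pi.single_eq_of_ne (Ne.symm hj)]
  · simp

variable {Q : Type*} [CommMonoid Q]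

theorem map_ofAdd_sum_nsmul (f : Multiplicative (standardCone d n).semigroup →* Q)
    (c : Fin d → ℕ) : f (Multiplicative.ofAdd (∑ j, c j • standardGen d n j)) =
      ∏ j, f (Multiplicative.ofAdd (standardGen d n j)) ^ c j := by
  rw [ofAdd_sum, map_prod]
  simp only [ofAdd_nsmul, map_pow]

/-- Split `s` into its positive part `u` and negative part `v`, both sums of generators. Negative
entries occur only in positions at least `n`, so `v` has an inverse `w` in the semigroup, and the
values at `u` and `v` determine the value at `s`. -/
theorem standardCone_monoidHom_ext {f g : Multiplicative (standardCone d n).semigroup →* Q}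
    (h : ∀ j, f (Multiplicative.ofAdd (standardGen d n j)) =
      g (Multiplicative.ofAdd (standardGen d n j))) : f = g := by
  refine MonoidHom.ext fun s => ?_
  obtain ⟨s, rfl⟩ := Multiplicative.ofAdd.surjective s
  let u : (standardCone d n).semigroup := ∑ j, ((s : Fin d → ℤ) j).toNat • standardGen d n j
  let v : (standardCone d n).semigroup := ∑ j, (-(s : Fin d → ℤ) j).toNat • standardGen d n j
  have hsv : s + v = u := by
    refine Subtype.ext (funext fun i => ?_)
    rw [AddSubmonoid.coe_add, Pi.add_apply, coe_sum_nsmul_standardGen, coe_sum_nsmul_standardGen]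
    omega
  let w : (standardCone d n).semigroup := ⟨-v, (mem_standardCone_semigroup _).mpr fun j hj => by
    have := (mem_standardCone_semigroup _).mp s.2 j hj
    rw [Pi.neg_apply, coe_sum_nsmul_standardGen]
    omega⟩
  have hvw : v + w = 0 := Subtype.ext (add_neg_cancel (v : Fin d → ℤ))
  have hfv : f (Multiplicative.ofAdd v) = g (Multiplicative.ofAdd v) := by
    simp only [v, map_ofAdd_sum_nsmul, h]
  have hfu : f (Multiplicative.ofAdd u) = g (Multiplicative.ofAdd u) := by
    simp only [u, map_ofAdd_sum_nsmul, h]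
  have hu : ∀ f : Multiplicative (standardCone d n).semigroup →* Q,
      f (Multiplicative.ofAdd s) = f (Multiplicative.ofAdd u) * f (Multiplicative.ofAdd w) := by
    intro f
    rw [← hsv, ← map_mul, ← ofAdd_add, add_assoc, hvw, add_zero]
  have hfw : f (Multiplicative.ofAdd w) = g (Multiplicative.ofAdd w) := by
    have h1 : ∀ f : Multiplicative (standardCone d n).semigroup →* Q,
        f (Multiplicative.ofAdd v) * f (Multiplicative.ofAdd w) = 1 := by
      intro f
      rw [← map_mul, ← ofAdd_add, hvw, ofAdd_zero, map_one]
    calc f (Multiplicative.ofAdd w) =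
        f (Multiplicative.ofAdd w) * (g (Multiplicative.ofAdd v) * g (Multiplicative.ofAdd w)) := by
          rw [h1, mul_one]
      _ = f (Multiplicative.ofAdd v) * f (Multiplicative.ofAdd w) * g (Multiplicative.ofAdd w) := by
          rw [hfv, ← mul_assoc, mul_comm (f (Multiplicative.ofAdd w))]
      _ = _ := by rw [h1, one_mul]
  rw [hu f, hu g, hfu, hfw]

theorem exists_standardCone_monoidHom (w : Fin d → Q) (hw : ∀ j : Fin d, n ≤ (j : ℕ) → IsUnit (w j)) :
    ∃ f : Multiplicative (standardCone d n).semigroup →* Q,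
      ∀ j, f (Multiplicative.ofAdd (standardGen d n j)) = w j := by
  let F : (Fin d → ℤ) → Q := fun s => ∏ j : Fin d, if h : n ≤ (j : ℕ) then
    (((hw j h).unit ^ (s j) : Qˣ) : Q) else w j ^ (s j).toNat
  refine ⟨{ toFun := fun s => F (Multiplicative.toAdd s : (standardCone d n).semigroup),
            map_one' := ?_, map_mul' := ?_ }, ?_⟩
  · refine Finset.prod_eq_one fun j _ => ?_
    split_ifs <;> simp
  · intro s t
    rw [← Finset.prod_mul_distrib]
    refine Finset.prod_congr rfl fun j _ => ?_
    have hadd : ((Multiplicative.toAdd (s * t) : (standardCone d n).semigroup) : Fin d → ℤ) j =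
      ((Multiplicative.toAdd s : (standardCone d n).semigroup) : Fin d → ℤ) j +
      ((Multiplicative.toAdd t : (standardCone d n).semigroup) : Fin d → ℤ) j := rfl
    rw [hadd]
    split_ifs with h
    · rw [zpow_add, Units.val_mul]
    · rw [← pow_add, Int.toNat_add]
      · exact (mem_standardCone_semigroup _).mp (Multiplicative.toAdd s).2 j (not_le.mp h)
      · exact (mem_standardCone_semigroup _).mp (Multiplicative.toAdd t).2 j (not_le.mp h)
  · intro j
    change F (Pi.single j 1) = w j
    refine (Finset.prod_eq_single j ?_ ?_).trans ?_
    · intro i _ hi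
      split_ifs <;> simp [Pi.single_eq_of_ne hi]
    · simp
    · split_ifs <;> simp

end StandardCone

/-! ### Points of the standard toric varieties -/

section StandardPoints

variable {K : Type u} [Field K] {d n : ℕ}

theorem algHom_standardCone_character {Q : Type*} [CommRing Q] [Algebra K Q] (w : Fin d → Q)
    (hw : ∀ j : Fin d, n ≤ (j : ℕ) → IsUnit (w j)) :
    ∃ f : SemigroupAlgebra K (standardCone d n) →ₐ[K] Q,
      ∀ j, f (character _ (standardGen d n j)) = w j := by
  obtain ⟨f, hf⟩ := exists_standardCone_monoidHom w hw
  refine ⟨AddMonoidAlgebra.lift K _ _ f, fun j => ?_⟩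
  rw [character, AddMonoidAlgebra.lift_single, one_smul, hf]

/-- The kernel of a `K`-point of the standard affine toric variety is generated by the coordinates
up to constants. -/
theorem ker_eq_span_standardGen (ev : SemigroupAlgebra K (standardCone d n) →ₐ[K] K) :
    RingHom.ker ev = Ideal.span (Set.range fun j => character _ (standardGen d n j) -
      algebraMap K _ (ev (character _ (standardGen d n j)))) := by
  set I := Ideal.span (Set.range fun j => character _ (standardGen d n j) -
      algebraMap K (SemigroupAlgebra K (standardCone d n))
        (ev (character _ (standardGen d n j))))
  have hmem : ∀ f, f - algebraMap K _ (ev f) ∈ RingHom.ker ev := fun f => by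
    rw [RingHom.mem_ker, map_sub, AlgHom.commutes]
    exact sub_self _
  have hI : ∀ j, character _ (standardGen d n j) - algebraMap K _
      (ev (character _ (standardGen d n j))) ∈ I := fun j => Ideal.subset_span ⟨j, rfl⟩
  apply le_antisymm
  · have hne : RingHom.ker ev ≠ ⊤ := RingHom.ker_ne_top _
    rw [asIdeal_eq_span _ (RingHom.ker ev) hne (fun s => ev (character _ s)) fun s => hmem _,
      Ideal.span_le]
    rintro _ ⟨s, rfl⟩
    -- Modulo `I`, a character and its value at the point define two monoid homomorphisms which
    -- agree on the basis vectors, hence everywhere.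
    let f : SemigroupAlgebra K (standardCone d n) →+* _ ⧸ I := Ideal.Quotient.mk I
    let g : SemigroupAlgebra K (standardCone d n) →+* _ ⧸ I :=
      f.comp ((algebraMap K _).comp (ev : SemigroupAlgebra K (standardCone d n) →+* K))
    have h1 : (f : _ →* _ ⧸ I).comp (AddMonoidAlgebra.of K (standardCone d n).semigroup) =
        (g : _ →* _ ⧸ I).comp (AddMonoidAlgebra.of K (standardCone d n).semigroup) :=
      standardCone_monoidHom_ext fun j => Ideal.Quotient.eq.mpr (hI j)
    exact Ideal.Quotient.eq.mp (DFunLike.congr_fun h1 (Multiplicative.ofAdd s))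
  · rw [Ideal.span_le]
    rintro _ ⟨j, rfl⟩
    exact hmem _

theorem toricStructure_baseMap {σ : ToricCone d} (p : toricVariety K σ) (c : K) :
    baseMap (toricStructure K σ) p c = specGerm _ p (algebraMap K (SemigroupAlgebra K σ) c) := by
  have h : (Scheme.ΓSpecIso (CommRingCat.of K)).inv ≫ (toricStructure K σ).appTop =
      CommRingCat.ofHom (algebraMap K (SemigroupAlgebra K σ)) ≫
        (Scheme.ΓSpecIso (CommRingCat.of (SemigroupAlgebra K σ))).inv :=
    (Scheme.ΓSpecIso_inv_naturality _).symm
  rw [baseMap, ← Category.assoc, h]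
  rfl

/-- At a `K`-point of a standard affine toric variety, the basis characters minus their values are
coordinates. -/
theorem isCoord_standardCone {p : toricVariety K (standardCone d n)}
    (ev : SemigroupAlgebra K (standardCone d n) →ₐ[K] K)
    (hp : p.asIdeal = RingHom.ker ev) :
    IsCoord (baseMap (toricStructure K (standardCone d n)) p) fun j =>
      specGerm _ p (character _ (standardGen d n j) -
        algebraMap K _ (ev (character _ (standardGen d n j)))) := by
  set R := CommRingCat.of (SemigroupAlgebra K (standardCone d n))
  set z : Fin d → SemigroupAlgebra K (standardCone d n) := fun j =>
    character _ (standardGen d n j) - algebraMap K _ (ev (character _ (standardGen d n j)))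
  have hspan : p.asIdeal = Ideal.span (Set.range z) := hp.trans (ker_eq_span_standardGen ev)
  have hmem : ∀ f : SemigroupAlgebra K (standardCone d n), f ∈ p.asIdeal ↔ ev f = 0 := fun f => by
    rw [hp]
    exact RingHom.mem_ker
  refine ⟨?_, ?_, ?_⟩
  · rw [maximalIdeal_specStalk, hspan, Ideal.map_span, ← Set.range_comp]
    rfl
  · intro a
    obtain ⟨r, s, hs, hrs⟩ := exists_mul_specGerm R p a
    refine ⟨ev r / ev s, ?_⟩
    have hs' : ev s ≠ 0 := fun h => hs ((hmem s).mpr h)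
    have h1 : (a - baseMap (toricStructure K (standardCone d n)) p (ev r / ev s)) *
        specGerm R p s ∈ maximalIdeal _ := by
      rw [sub_mul, hrs, toricStructure_baseMap, ← map_mul, ← map_sub,
        specGerm_mem_maximalIdeal_iff, hmem, map_sub, map_mul, AlgHom.commutes]
      change ev r - ev r / ev s * ev s = 0
      rw [div_mul_cancel₀ _ hs', sub_self]
    exact (Ideal.IsPrime.mem_or_mem inferInstance h1).resolve_right fun h =>
      hs ((specGerm_mem_maximalIdeal_iff R p s).mp h)
  · intro N F hF
    -- Independence is tested by a homomorphism `h` to `K[X]/(X)^N` that sends the `j`-th character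
    -- to `X_j` plus its value at the point. For `j ≥ n` this is a nonzero constant plus a
    -- nilpotent, hence a unit, as required.
    let I := (MvPolynomial.idealOfVars (Fin d) K) ^ N
    let Q := MvPolynomial (Fin d) K ⧸ I
    let w : Fin d → Q := fun j => Ideal.Quotient.mk I (MvPolynomial.X j) +
      algebraMap K Q (ev (character _ (standardGen d n j)))
    have hnil : ∀ q ∈ (MvPolynomial.idealOfVars (Fin d) K).map (Ideal.Quotient.mk I),
        IsNilpotent q := by
      intro q hq
      refine ⟨N, ?_⟩
      have := Ideal.pow_mem_pow hq N
      rwa [← Ideal.map_pow, Ideal.map_quotient_self, Ideal.mem_bot] at this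
    have hX : ∀ j, Ideal.Quotient.mk I (MvPolynomial.X j) ∈
        (MvPolynomial.idealOfVars (Fin d) K).map (Ideal.Quotient.mk I) := fun j =>
      Ideal.mem_map_of_mem _ (Ideal.subset_span ⟨j, rfl⟩)
    obtain ⟨h, hh⟩ := algHom_standardCone_character (K := K) (n := n) w (by
      intro j hj
      refine IsNilpotent.isUnit_add_right_of_commute (hnil _ (hX j)) ?_ (Commute.all _ _)
      refine IsUnit.map (algebraMap K Q) (IsUnit.mk0 _ ?_)
      let s : (standardCone d n).semigroup := ⟨-Pi.single j 1,
        (mem_standardCone_semigroup _).mpr fun i hi => by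
          rw [Pi.neg_apply, Pi.single_eq_of_ne (fun h => by omega), neg_zero]⟩
      have h1 : character (K := K) _ (standardGen d n j) * character _ s = 1 := by
        rw [character, character, AddMonoidAlgebra.single_mul_single, one_mul]
        have : standardGen d n j + s = 0 := Subtype.ext (add_neg_cancel (Pi.single j 1))
        rw [this]
        rfl
      have h2 := congrArg ev h1
      rw [map_mul, map_one] at h2
      exact left_ne_zero_of_mul_eq_one h2)
    have hz : ∀ j, h (z j) = Ideal.Quotient.mk I (MvPolynomial.X j) := fun j => by
      rw [map_sub, hh, AlgHom.commutes, add_sub_cancel_right]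
    have hP : p.asIdeal.map h ≤
        (MvPolynomial.idealOfVars (Fin d) K).map (Ideal.Quotient.mk I) := by
      rw [hspan, Ideal.map_span, Ideal.span_le]
      rintro _ ⟨_, ⟨j, rfl⟩, rfl⟩
      exact (hz j).symm ▸ hX j
    let f := F.eval₂Hom (algebraMap K (SemigroupAlgebra K (standardCone d n))) z
    have hf : F.eval₂Hom (baseMap (toricStructure K (standardCone d n)) p)
        (fun j => specGerm R p (z j)) = specGerm R p f := by
      have : MvPolynomial.eval₂Hom (baseMap (toricStructure K (standardCone d n)) p)
          (fun j => specGerm R p (z j)) = (specGerm R p).comp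
            (MvPolynomial.eval₂Hom (algebraMap K (SemigroupAlgebra K (standardCone d n))) z) :=
        MvPolynomial.ringHom_ext (fun c => by
          rw [MvPolynomial.coe_eval₂Hom, RingHom.comp_apply, MvPolynomial.coe_eval₂Hom,
            MvPolynomial.eval₂_C, MvPolynomial.eval₂_C]
          exact toricStructure_baseMap p c) (by simp)
      exact DFunLike.congr_fun this F
    have hF' : specGerm R p f ∈ (p.asIdeal ^ N).map (specGerm R p) := by
      rw [← hf, Ideal.map_pow, ← maximalIdeal_specStalk]
      exact hF
    let _ := (specGerm R p).toAlgebra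
    have := isLocalization_specGerm R p
    have : p.asIdeal.IsPrime := isPrime_asIdeal R p
    -- Some multiple `s * f` with `s` outside of the maximal ideal lies in its `N`-th power, which
    -- `h` kills. Since `h s` is a unit, `h f = 0`, and `h f` is the class of `F`.
    obtain ⟨s, hs, hsf⟩ := (IsLocalization.algebraMap_mem_map_algebraMap_iff
      p.asIdeal.primeCompl _ _ _).mp hF'
    have h1 : h s * h f = 0 := by
      have h2 := Ideal.mem_map_of_mem h hsf
      rw [Ideal.map_pow] at h2
      have h3 := Ideal.pow_right_mono hP N h2
      rw [← Ideal.map_pow, Ideal.map_quotient_self, Ideal.mem_bot] at h3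
      rw [← map_mul]
      exact h3
    have hsu : IsUnit (h s) := by
      have h2 : h s = h (s - algebraMap K _ (ev s)) + algebraMap K Q (ev s) := by
        rw [map_sub, AlgHom.commutes, sub_add_cancel]
      rw [h2]
      refine IsNilpotent.isUnit_add_right_of_commute (hnil _ (hP (Ideal.mem_map_of_mem h ?_))) ?_
        (Commute.all _ _)
      · rw [hmem, map_sub, AlgHom.commutes]
        exact sub_self _
      · exact IsUnit.map (algebraMap K Q) (IsUnit.mk0 _ fun h0 => hs ((hmem s).mpr h0))
    have h4 : h f = 0 := (hsu.mul_right_eq_zero).mp h1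
    have h5 : h f = Ideal.Quotient.mk I F := by
      have : (h : _ →+* Q).comp (MvPolynomial.eval₂Hom
          (algebraMap K (SemigroupAlgebra K (standardCone d n))) z) = Ideal.Quotient.mk I :=
        MvPolynomial.ringHom_ext (fun c => by simp; rfl) (fun j => by simp [hz])
      exact DFunLike.congr_fun this F
    exact Ideal.Quotient.eq_zero_iff_mem.mp (h5 ▸ h4)

end StandardPoints

/-! ### Toric morphisms from lattice homomorphisms -/

section ToricMorphism

variable {K : Type u} [Field K] {d m : ℕ} {σ : ToricCone d} {τ : ToricCone m}

/-- The homomorphism of semigroup algebras induced by a homomorphism of lattices. -/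
def semigroupAlgebraMap (K : Type u) [Field K] (γ : (Fin m → ℤ) →+ (Fin d → ℤ))
    (hγ : ∀ s : τ.semigroup, γ s ∈ σ.semigroup) : SemigroupAlgebra K τ →ₐ[K] SemigroupAlgebra K σ :=
  AddMonoidAlgebra.mapDomainAlgHom K K ((γ.comp τ.semigroup.subtype).codRestrict σ.semigroup hγ)

variable {γ : (Fin m → ℤ) →+ (Fin d → ℤ)} {hγ : ∀ s : τ.semigroup, γ s ∈ σ.semigroup}

theorem semigroupAlgebraMap_single (s : τ.semigroup) (c : K) :
    semigroupAlgebraMap K γ hγ (AddMonoidAlgebra.single s c) =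
      AddMonoidAlgebra.single ⟨γ s, hγ s⟩ c :=
  AddMonoidAlgebra.mapDomain_single

/-- The toric morphism induced by a homomorphism of lattices. -/
def toricMorphism (K : Type u) [Field K] (γ : (Fin m → ℤ) →+ (Fin d → ℤ))
    (hγ : ∀ s : τ.semigroup, γ s ∈ σ.semigroup) : toricVariety K σ ⟶ toricVariety K τ :=
  Spec.map (CommRingCat.ofHom (semigroupAlgebraMap K γ hγ).toRingHom)

theorem isToric_toricMorphism : IsToric (toricMorphism K γ hγ) := by
  refine ⟨AddMonoidAlgebra.mapDomainBialgHom K γ, ?_⟩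
  rw [toricMorphism, torusInclusion, torusInclusion, ← Spec.map_comp, ← Spec.map_comp]
  congr 1
  have h : (AddMonoidAlgebra.mapDomainAlgHom K K σ.semigroup.subtype).comp
      (semigroupAlgebraMap K γ hγ) = (AddMonoidAlgebra.mapDomainAlgHom K K γ).comp
        (AddMonoidAlgebra.mapDomainAlgHom K K τ.semigroup.subtype) := by
    refine AddMonoidAlgebra.algHom_ext (fun s => ?_) (Subsingleton.elim _ _)
    simp only [AlgHom.comp_apply, semigroupAlgebraMap_single,
      AddMonoidAlgebra.mapDomainAlgHom_apply, AddMonoidAlgebra.mapDomain_single]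
    rfl
  exact CommRingCat.hom_ext (RingHom.ext fun f => DFunLike.congr_fun h f)

theorem toricMorphism_toricStructure :
    toricMorphism K γ hγ ≫ toricStructure K τ = toricStructure K σ := by
  rw [toricMorphism, toricStructure, toricStructure, ← Spec.map_comp]
  congr 1
  exact CommRingCat.hom_ext (RingHom.ext fun c => (semigroupAlgebraMap K γ hγ).commutes c)

theorem completedStalkMap_toricMorphism (p : toricVariety K σ) (s : τ.semigroup) :
    completedStalkMap (toricMorphism K γ hγ) p
      (formalCharacter K τ (toricMorphism K γ hγ p) (Multiplicative.ofAdd s)) =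
        formalCharacter K σ p (Multiplicative.ofAdd ⟨γ s, hγ s⟩) := by
  refine (completionMap_algebraMap ((toricMorphism K γ hγ).stalkMap p).hom _).trans
    (congrArg _ ?_)
  refine (stalkMap_specGerm (CommRingCat.ofHom (semigroupAlgebraMap K γ hγ).toRingHom)
    (character τ s)).trans ?_
  exact congrArg _ (semigroupAlgebraMap_single s 1)

end ToricMorphism

/-! ### Standard toric varieties as local models -/

section StandardModel

variable {K : Type u} [Field K] {d n : ℕ}

theorem exists_ringEquiv_of_coord {A A' : Type*} [CommRing A] [IsLocalRing A]
    [CommRing A'] [IsLocalRing A'] [IsAdicComplete (maximalIdeal A) A]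
    [IsAdicComplete (maximalIdeal A') A'] {k : K →+* A} {k' : K →+* A'} {x : Fin d → A}
    {x' : Fin d → A'} (h : IsCoord k x) (h' : IsCoord k' x') :
    ∃ ι : A ≃+* A', (∀ c, ι (k c) = k' c) ∧ ∀ i, ι (x i) = x' i := by
  obtain ⟨Θ, hc, hX⟩ := exists_ringEquiv_mvPowerSeries h
  obtain ⟨Θ', hc', hX'⟩ := exists_ringEquiv_mvPowerSeries h'
  refine ⟨Θ.symm.trans Θ', fun c => ?_, fun i => ?_⟩
  · rw [RingEquiv.trans_apply, ← hc, Θ.symm_apply_apply, hc']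
  · rw [RingEquiv.trans_apply, ← hX, Θ.symm_apply_apply, hX']

variable {p : toricVariety K (standardCone d n)}
  {ev : SemigroupAlgebra K (standardCone d n) →ₐ[K] K}

theorem isNoetherianRing_toricStalk {σ : ToricCone d} (p : toricVariety K σ) :
    IsNoetherianRing ((toricVariety K σ).presheaf.stalk p) :=
  isNoetherianRing_specStalk (CommRingCat.of (SemigroupAlgebra K σ)) p

theorem isCoord_completion_standardCone (hp : p.asIdeal = RingHom.ker ev) :
    IsCoord (const (toricStructure K (standardCone d n)) p) fun j =>
      formalCharacter K _ p (Multiplicative.ofAdd (standardGen d n j)) -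
        const (toricStructure K (standardCone d n)) p (ev (character _ (standardGen d n j))) := by
  have := isNoetherianRing_toricStalk p
  have h := (isCoord_standardCone ev hp).completion
  have e : ∀ j, formalCharacter K _ p (Multiplicative.ofAdd (standardGen d n j)) -
      const (toricStructure K (standardCone d n)) p (ev (character _ (standardGen d n j))) =
      algebraMap ((toricVariety K (standardCone d n)).presheaf.stalk p) (completedStalk _ p)
        (specGerm _ p (character _ (standardGen d n j) -
          algebraMap K _ (ev (character _ (standardGen d n j))))) := fun j => by
    rw [map_sub, map_sub, const_eq, RingHom.comp_apply, toricStructure_baseMap]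
    rfl
  simp only [e]
  exact h

/-- The sum of the first `n` basis vectors is interior to the dual cone, so the boundary ideal is
the radical of the product of their characters. By `h0` these characters are formal parameters, and
a product of distinct parameters is already radical. -/
theorem completedIdeal_standardCone (hn : n ≤ d) (hp : p.asIdeal = RingHom.ker ev)
    (h0 : ∀ j : Fin n, ev (character _ (standardGen d n (Fin.castLE hn j))) = 0) :
    completedIdeal _ (toricBoundary K (standardCone d n)) p = Ideal.span {∏ j : Fin n,
      formalCharacter K _ p (Multiplicative.ofAdd (standardGen d n (Fin.castLE hn j)))} := by
  have := isNoetherianRing_toricStalk p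
  have h := isCoord_completion_standardCone hp
  have hz : ∀ j : Fin n, formalCharacter K _ p (Multiplicative.ofAdd
      (standardGen d n (Fin.castLE hn j))) = formalCharacter K _ p (Multiplicative.ofAdd
      (standardGen d n (Fin.castLE hn j))) - const (toricStructure K (standardCone d n)) p
        (ev (character _ (standardGen d n (Fin.castLE hn j)))) := fun j => by
    rw [h0, map_zero, sub_zero]
  let s₀ : (standardCone d n).semigroup := ∑ j : Fin n, standardGen d n (Fin.castLE hn j)
  have hs₀ : ∀ t : Fin d → ℤ, ∃ N : ℕ, N • (s₀ : Fin d → ℤ) + t ∈ (standardCone d n).semigroup := by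
    intro t
    refine ⟨∑ i, (t i).natAbs, (mem_standardCone_semigroup _).mpr fun i hi => ?_⟩
    have h1 : (s₀ : Fin d → ℤ) i = 1 := by
      rw [AddSubmonoid.coe_finsetSum, Finset.sum_apply, Finset.sum_eq_single ⟨i, hi⟩]
      · exact Pi.single_eq_same _ _
      · intro j _ hj
        refine Pi.single_eq_of_ne (fun h => hj (Fin.ext ?_)) _
        exact (congrArg Fin.val h).symm
      · simp
    have h2 : (t i).natAbs ≤ ∑ i, (t i).natAbs :=
      Finset.single_le_sum (f := fun i => (t i).natAbs) (fun _ _ => Nat.zero_le _)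
        (Finset.mem_univ i)
    rw [Pi.add_apply, Pi.smul_apply, h1, nsmul_eq_mul, mul_one]
    omega
  have hs : formalCharacter K _ p (Multiplicative.ofAdd s₀) = ∏ j : Fin n,
      formalCharacter K _ p (Multiplicative.ofAdd (standardGen d n (Fin.castLE hn j))) := by
    rw [ofAdd_sum, map_prod]
  rw [← hs, completedIdeal, stalkIdeal_toricBoundary _ hs₀]
  apply le_antisymm
  · rw [Ideal.map_le_iff_le_comap]
    rintro a ⟨N, ha⟩
    have h1 := Ideal.mem_map_of_mem (algebraMap _ (completedStalk _ p)) ha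
    rw [Ideal.map_span, Set.image_singleton, Ideal.mem_span_singleton, map_pow] at h1
    change formalCharacter K _ p (Multiplicative.ofAdd s₀) ∣ _ at h1
    rw [Ideal.mem_comap, Ideal.mem_span_singleton]
    rw [hs] at h1 ⊢
    have := h.isDomain
    refine prod_dvd_of_pow_mem (fun j => ?_) (fun i j hij => ?_) h1
    · rw [hz]
      exact h.prime _
    · rw [hz i, hz j]
      exact h.not_dvd fun h => hij (Fin.castLE_injective hn h)
  · rw [Ideal.span_singleton_le_iff_mem]
    exact Ideal.mem_map_of_mem _ (Ideal.le_radical (Ideal.mem_span_singleton_self _))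

/-- A nonsingular variety with an SNC divisor has the standard affine toric varieties as local
models. -/
theorem exists_isLocalModel {X : Scheme.{u}} {sX : X ⟶ Spec (CommRingCat.of K)}
    {D : ReducedDivisor X} {p₀ : X} [IsNoetherianRing (X.presheaf.stalk p₀)]
    {x : Fin d → completedStalk X p₀} (h : IsCoord (const sX p₀) x) (hn : n ≤ d)
    (hI : completedIdeal X D.support p₀ = Ideal.span {∏ j : Fin n, x (Fin.castLE hn j)})
    (hp : p.asIdeal = RingHom.ker ev)
    (h0 : ∀ j : Fin n, ev (character _ (standardGen d n (Fin.castLE hn j))) = 0) :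
    ∃ ι : completedStalk X p₀ ≃+* completedStalk (toricVariety K (standardCone d n)) p,
      IsLocalModel sX D p₀ (standardCone d n) p ι ∧
      ∀ j, ι (x j) = formalCharacter K _ p (Multiplicative.ofAdd (standardGen d n j)) -
        const (toricStructure K (standardCone d n)) p (ev (character _ (standardGen d n j))) := by
  have := isNoetherianRing_toricStalk p
  obtain ⟨ι, hιk, hιx⟩ := exists_ringEquiv_of_coord h (isCoord_completion_standardCone hp)
  refine ⟨ι, ⟨?_, hιk, ?_⟩, hιx⟩
  · refine (PrimeSpectrum.isClosed_singleton_iff_isMaximal p).mpr ?_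
    rw [hp]
    exact RingHom.ker_isMaximal_of_surjective _ fun c => ⟨algebraMap K _ c, ev.commutes c⟩
  · rw [hI, completedIdeal_standardCone hn hp h0, Ideal.map_span, Set.image_singleton, map_prod]
    congr 2
    refine Finset.prod_congr rfl fun j _ => ?_
    rw [RingEquiv.coe_toRingHom, hιx, h0, map_zero, sub_zero]

end StandardModel

/-! ### From the monomial normal form to local toric models -/

section Rows

variable {d m n l r : ℕ} (hn : n ≤ d) (hrn : r ≤ n) (hr : n + m ≤ d + r)
  (a : Matrix (Fin l) (Fin n) ℕ)

/-- The exponents of the `i`-th function of the monomial normal form. -/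
def rowGen (i : Fin m) : (standardCone d n).semigroup :=
  (if h : (i : ℕ) < l then ∑ j, a ⟨i, h⟩ j • standardGen d n (Fin.castLE hn j) else 0) +
    if r ≤ (i : ℕ) then standardGen d n ⟨n - r + i, by omega⟩ else 0

theorem map_rowGen {Q : Type*} [CommMonoid Q] (f : Multiplicative (standardCone d n).semigroup →* Q)
    (i : Fin m) : f (Multiplicative.ofAdd (rowGen hn hrn hr a i)) =
      (if h : (i : ℕ) < l then
        ∏ j, f (Multiplicative.ofAdd (standardGen d n (Fin.castLE hn j))) ^ a ⟨i, h⟩ j else 1) *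
      if r ≤ (i : ℕ) then
        f (Multiplicative.ofAdd (standardGen d n ⟨n - r + i, by omega⟩)) else 1 := by
  rw [rowGen, ofAdd_add, map_mul]
  congr 1
  · split_ifs
    · rw [ofAdd_sum, map_prod]
      simp only [ofAdd_nsmul, map_pow]
    · rw [ofAdd_zero, map_one]
  · split_ifs
    · rfl
    · rw [ofAdd_zero, map_one]

/-- The homomorphism of lattices of the monomial normal form. -/
def rowHom : (Fin m → ℤ) →+ (Fin d → ℤ) :=
  (Fintype.linearCombination ℤ fun i => (rowGen hn hrn hr a i : Fin d → ℤ)).toAddMonoidHom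

theorem rowHom_single (i : Fin m) :
    rowHom hn hrn hr a (Pi.single i 1) = (rowGen hn hrn hr a i : Fin d → ℤ) := by
  refine (Fintype.linearCombination_apply_single ℤ _ i 1).trans ?_
  rw [one_smul]

/-- Only the entries of `s` with index `i ≥ l` can be negative, and the row of such an `i` is a unit
vector in position `n - r + i ≥ n`, invisible to the first `n` coordinates. -/
theorem rowHom_mem (hrl : r ≤ l) (s : (standardCone m l).semigroup) :
    rowHom hn hrn hr a s ∈ (standardCone d n).semigroup := by
  rw [mem_standardCone_semigroup]
  intro j hj
  have h1 : rowHom hn hrn hr a s j =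
      ∑ i, (s : Fin m → ℤ) i * (rowGen hn hrn hr a i : Fin d → ℤ) j := by
    refine (congrFun (Fintype.linearCombination_apply ℤ
      (fun i => (rowGen hn hrn hr a i : Fin d → ℤ)) (s : Fin m → ℤ)) j).trans ?_
    rw [Finset.sum_apply]
    rfl
  rw [h1]
  refine Finset.sum_nonneg fun i _ => ?_
  by_cases hi : (i : ℕ) < l
  · exact mul_nonneg ((mem_standardCone_semigroup _).mp s.2 i hi)
      ((mem_standardCone_semigroup _).mp (rowGen hn hrn hr a i).2 j hj)
  · have h2 : (rowGen hn hrn hr a i : Fin d → ℤ) j = 0 := by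
      rw [rowGen, dif_neg hi, if_pos (by omega), zero_add]
      exact Pi.single_eq_of_ne (fun h => by simp [h] at hj; omega) _
    rw [h2, mul_zero]

end Rows

section Backward

variable {K : Type u} [Field K] {X Y : Scheme.{u}} {sX : X ⟶ Spec (CommRingCat.of K)}
  {sY : Y ⟶ Spec (CommRingCat.of K)} {φ : X ⟶ Y} {d m : ℕ}

/-- A morphism with the monomial normal form is locally formally isomorphic to a toric morphism. -/
theorem HasToroidalForm.exists_toric {DX : ReducedDivisor X} {DY : ReducedDivisor Y} {p : X}
    {n l : ℕ} (hφ : φ ≫ sY = sX)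
    [IsNoetherianRing (X.presheaf.stalk p)] [IsNoetherianRing (Y.presheaf.stalk (φ p))]
    {x₀ : Fin d → completedStalk X p} (hx₀ : IsCoord (const sX p) x₀)
    {y₀ : Fin m → completedStalk Y (φ p)} (hy₀ : IsCoord (const sY (φ p)) y₀)
    (h : HasToroidalForm sX φ d m DX DY p n l) :
    ∃ (σ : ToricCone d) (τ : ToricCone m) (p' : toricVariety K σ)
      (ψ : toricVariety K σ ⟶ toricVariety K τ)
      (ιp : completedStalk X p ≃+* completedStalk (toricVariety K σ) p')
      (ιq : completedStalk Y (φ p) ≃+* completedStalk (toricVariety K τ) (ψ p')),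
      IsToric ψ ∧ IsLocalModel sX DX p σ p' ιp ∧ IsLocalModel sY DY (φ p) τ (ψ p') ιq ∧
      ∀ f : completedStalk Y (φ p),
        ιp (completedStalkMap φ p f) = completedStalkMap ψ p' (ιq f) := by
  obtain ⟨hn, hl, x, y, a, r, hrl, hrn, hr, α, hx, hy, h1, h2, h3, hα, -, -, -, hrow⟩ := h
  have hxc : IsCoord (const sX p) x := hx₀.of_span (by
    rw [AdicCompletion.maximalIdeal_eq_map]
    exact hx.span_eq)
  have hyc : IsCoord (const sY (φ p)) y := hy₀.of_span (by
    rw [AdicCompletion.maximalIdeal_eq_map]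
    exact hy.span_eq)
  -- The coordinates of the closed point: zero along the divisor and the constants `α` where they
  -- occur. The other torus coordinates must not vanish; `1` is chosen, so that `x_k` corresponds to
  -- the character minus `1`.
  let β : Fin d → K := fun k => if (k : ℕ) < n then 0 else if (k : ℕ) < n + (l - r) then α k else 1
  obtain ⟨ev, hev⟩ := algHom_standardCone_character (K := K) (n := n) β (by
    intro k hk
    refine IsUnit.mk0 _ ?_
    simp only [β, if_neg (not_lt.mpr hk)]
    split_ifs with h
    · exact hα k hk h
    · exact one_ne_zero)
  let p' : toricVariety K (standardCone d n) := ⟨RingHom.ker ev, RingHom.ker_isPrime _⟩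
  let γ := rowHom hn hrn hr a
  have hγ : ∀ s : (standardCone m l).semigroup, γ s ∈ (standardCone d n).semigroup :=
    rowHom_mem hn hrn hr a hrl
  let ψ : toricVariety K (standardCone d n) ⟶ toricVariety K (standardCone m l) :=
    toricMorphism K γ hγ
  let ev' : SemigroupAlgebra K (standardCone m l) →ₐ[K] K := ev.comp (semigroupAlgebraMap K γ hγ)
  have hγi : ∀ i, (⟨γ (standardGen m l i), hγ _⟩ : (standardCone d n).semigroup) =
      rowGen hn hrn hr a i := fun i => Subtype.ext (rowHom_single hn hrn hr a i)
  have hev' : ∀ i, ev' (character _ (standardGen m l i)) =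
      (if h : (i : ℕ) < l then ∏ j, β (Fin.castLE hn j) ^ a ⟨i, h⟩ j else 1) *
      if r ≤ (i : ℕ) then β ⟨n - r + i, by omega⟩ else 1 := by
    intro i
    have e1 : ev' (character _ (standardGen m l i)) =
        ev (character _ (rowGen hn hrn hr a i)) := by
      rw [← hγi]
      exact congrArg ev (semigroupAlgebraMap_single _ 1)
    have e2 := map_rowGen hn hrn hr a
      ((ev : SemigroupAlgebra K (standardCone d n) →* K).comp (AddMonoidAlgebra.of K _)) i
    simp only [← hev]
    exact e1.trans e2
  have hβ0 : ∀ j : Fin n, β (Fin.castLE hn j) = 0 := fun j => if_pos j.2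
  -- Positivity of the row sums puts the image point on the first `l` coordinate hyperplanes, as the
  -- local model of an `l`-point requires.
  have hev0 : ∀ i : Fin m, (i : ℕ) < l → ev' (character _ (standardGen m l i)) = 0 := by
    intro i hi
    rw [hev', dif_pos hi]
    obtain ⟨j, -, hj⟩ := Finset.exists_ne_zero_of_sum_ne_zero (hrow ⟨i, hi⟩).ne'
    rw [Finset.prod_eq_zero (Finset.mem_univ j) (by rw [hβ0, zero_pow hj]), zero_mul]
  have hev1 : ∀ i : Fin m, l ≤ (i : ℕ) → ev' (character _ (standardGen m l i)) = 1 := by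
    intro i hi
    rw [hev', dif_neg (not_lt.mpr hi), if_pos (hrl.trans hi), one_mul]
    simp only [β]
    rw [if_neg (by omega), if_neg (by omega)]
  have hp' : p'.asIdeal = RingHom.ker ev := rfl
  have hq' : (ψ p').asIdeal = RingHom.ker ev' := rfl
  obtain ⟨ιp, hιp, hιpx⟩ := exists_isLocalModel hxc hn hx.local_equation hp'
    fun j => (hev _).trans (hβ0 j)
  obtain ⟨ιq, hιq, hιqy⟩ := exists_isLocalModel hyc hl hy.local_equation hq'
    fun i => hev0 (Fin.castLE hl i) i.2
  refine ⟨standardCone d n, standardCone m l, p', ψ, ιp, ιq, isToric_toricMorphism, hιp, hιq, ?_⟩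
  have := isNoetherianRing_toricStalk p'
  have := isNoetherianRing_toricStalk (ψ p')
  have : IsLocalHom (completedStalkMap φ p) := isLocalHom_completionMap (φ.stalkMap p).hom
  have : IsLocalHom (completedStalkMap ψ p') := isLocalHom_completionMap (ψ.stalkMap p').hom
  have hψc : ∀ c, completedStalkMap ψ p' (const (toricStructure K (standardCone m l)) (ψ p') c) =
      const (toricStructure K (standardCone d n)) p' c :=
    completedStalkMap_const toricMorphism_toricStructure p'
  let χ := formalCharacter K (standardCone d n) p'
  have hxj : ∀ j : Fin n, ιp (x (Fin.castLE hn j)) =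
      χ (Multiplicative.ofAdd (standardGen d n (Fin.castLE hn j))) := fun j => by
    rw [hιpx, hev, hβ0, map_zero, sub_zero]
  have hy' : ∀ i, completedStalkMap ψ p' (ιq (y i)) =
      χ (Multiplicative.ofAdd (rowGen hn hrn hr a i)) -
        const (toricStructure K (standardCone d n)) p' (ev' (character _ (standardGen m l i))) := by
    intro i
    rw [hιqy, map_sub, hψc, completedStalkMap_toricMorphism, hγi]
  have key : ∀ i, ιp (completedStalkMap φ p (y i)) = completedStalkMap ψ p' (ιq (y i)) := by
    intro i
    rw [hy', map_rowGen]
    by_cases hil : (i : ℕ) < l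
    · rw [hev0 i hil, map_zero, sub_zero, dif_pos hil]
      by_cases hir : (i : ℕ) < r
      · have e := h1 ⟨i, hir⟩
        rw [if_neg (not_le.mpr hir), mul_one]
        refine (congrArg ιp e).trans ?_
        simp only [map_prod, map_pow, hxj]
        rfl
      · have e := h2 ⟨i, hil⟩ (not_lt.mp hir)
        rw [if_pos (not_lt.mp hir)]
        refine (congrArg ιp e).trans ?_
        simp only [map_mul, map_add, map_prod, map_pow, hxj, hιpx, hιp.map_const, hev]
        congr 1
        have e2 : β ⟨n - r + i, by omega⟩ = α ⟨n - r + i, by omega⟩ := by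
          simp only [β]
          rw [if_neg (by omega), if_pos (by omega)]
        rw [e2, sub_add_cancel]
    · have hil := not_lt.mp hil
      rw [hev1 i hil, dif_neg (not_lt.mpr hil), if_pos (hrl.trans hil), one_mul, h3 i hil, hιpx,
        hev]
      have e2 : β ⟨n - r + i, by omega⟩ = 1 := by
        simp only [β]
        rw [if_neg (by omega), if_neg (by omega)]
      rw [e2]
  -- Two local homomorphisms that agree on constants and on parameters are equal.
  have hext : (ιp : _ →+* completedStalk _ p').comp (completedStalkMap φ p) =
      (completedStalkMap ψ p').comp (ιq : _ →+* completedStalk _ (ψ p')) := by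
    refine ringHom_ext_of_coord hyc.span hyc.residue _ _ (fun c => ?_) key
    change ιp (completedStalkMap φ p (const sY (φ p) c)) =
      completedStalkMap ψ p' (ιq (const sY (φ p) c))
    rw [completedStalkMap_const hφ, hιp.map_const, hιq.map_const, hψc]
  exact fun f => DFunLike.congr_fun hext f

end Backward

/-! ### Points at which the morphism is smooth -/

section Smooth

/-- Tangent vectors lift along formally smooth homomorphisms. -/
theorem exists_dualNumber_lift {K R S : Type*} [Field K] [CommRing R] [CommRing S]
    {f : R →+* S} (hf : f.FormallySmooth) (ρ : S →+* K) (g : R →+* DualNumber K)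
    (hg : ∀ r, (g r).fst = ρ (f r)) :
    ∃ g' : S →+* DualNumber K, (∀ r, g' (f r) = g r) ∧ ∀ s, (g' s).fst = ρ s := by
  let _ := f.toAlgebra
  have : Algebra.FormallySmooth R S := hf
  let _ := g.toAlgebra
  let _ := (ρ.comp f).toAlgebra
  let π : DualNumber K →ₐ[R] K :=
    { (TrivSqZeroExt.fstHom K K K).toRingHom with commutes' := hg }
  let ρ' : S →ₐ[R] K := { ρ with commutes' := fun _ => rfl }
  have hπ : Function.Surjective π := fun c => ⟨TrivSqZeroExt.inl c, rfl⟩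
  -- The augmentation `K[ε] → K` has a kernel of square zero, so formal smoothness lifts `ρ` along
  -- it.
  have hker : IsNilpotent (RingHom.ker (π : DualNumber K →+* K)) :=
    ⟨2, TrivSqZeroExt.kerIdeal_sq K K⟩
  let g' := Algebra.FormallySmooth.liftOfSurjective ρ' π hπ hker
  exact ⟨g', fun r => g'.commutes r, fun s =>
    Algebra.FormallySmooth.liftOfSurjective_apply ρ' π hπ hker s⟩

/-- The homomorphism to the dual numbers given by a partial derivative. -/
def Jet.toDualNumber {K A : Type*} [Field K] [CommRing A] [IsLocalRing A] {d : ℕ} {k : K →+* A}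
    {x : Fin d → A} (J : Jet k x) (i : Fin d) : A →+* DualNumber K where
  toFun a := TrivSqZeroExt.inl (J.res a) + TrivSqZeroExt.inr (J.lin a i)
  map_one' := by
    have h := congrFun (J.lin_const 1) i
    rw [map_one] at h
    refine TrivSqZeroExt.ext ?_ ?_ <;> simp [h]
  map_mul' a b := by
    have h := congrFun (J.lin_mul a b) i
    refine TrivSqZeroExt.ext ?_ ?_ <;> simp [h, mul_comm]
  map_zero' := by simp
  map_add' a b := by
    refine TrivSqZeroExt.ext ?_ ?_ <;> simp

theorem Jet.fst_toDualNumber {K A : Type*} [Field K] [CommRing A] [IsLocalRing A] {d : ℕ}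
    {k : K →+* A} {x : Fin d → A} (J : Jet k x) (i : Fin d) (a : A) :
    (J.toDualNumber i a).fst = J.res a := by
  simp [Jet.toDualNumber]

theorem Jet.snd_toDualNumber {K A : Type*} [Field K] [CommRing A] [IsLocalRing A] {d : ℕ}
    {k : K →+* A} {x : Fin d → A} (J : Jet k x) (i : Fin d) (a : A) :
    (J.toDualNumber i a).snd = J.lin a i := by
  simp [Jet.toDualNumber]

variable {K R S : Type u} [Field K] [CommRing R] [IsLocalRing R] [IsNoetherianRing R]
  [CommRing S] [IsLocalRing S] [IsNoetherianRing S] {d m : ℕ}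

/-- The differential of a formally smooth local homomorphism is injective. -/
theorem linearIndependent_lin_of_formallySmooth {kR : K →+* R} {kS : K →+* S} {f : R →+* S}
    [IsLocalHom f] (hf : f.FormallySmooth) (hk : ∀ c, f (kR c) = kS c) {y : Fin m → R}
    (hy : IsCoord kR y) {x : Fin d → Completion S}
    (hx : IsCoord ((algebraMap S (Completion S)).comp kS) x)
    (J : Jet ((algebraMap S (Completion S)).comp kS) x) :
    LinearIndependent K fun i => J.lin (algebraMap S (Completion S) (f (y i))) := by
  obtain ⟨J'⟩ := hy.completion.nonempty_jet
  have hm : ∀ s ∈ maximalIdeal S, J.res (algebraMap S (Completion S) s) = 0 := fun s hs => by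
    rw [← J.mem_iff, ← pow_one (maximalIdeal (Completion S)), algebraMap_mem_pow_iff, pow_one]
    exact hs
  have := isLocalHom_completionMap f
  have hkc : ∀ c, completionMap f (((algebraMap R (Completion R)).comp kR) c) =
      ((algebraMap S (Completion S)).comp kS) c := fun c => by
    rw [RingHom.comp_apply, completionMap_algebraMap, hk]
    rfl
  rw [Fintype.linearIndependent_iff]
  intro c hc i
  -- Formal smoothness extends the tangent vector `∂/∂y_i` of `R` to a tangent vector `g` of `S`.
  obtain ⟨g, hg, hg'⟩ := exists_dualNumber_lift hf (J.res.comp (algebraMap S (Completion S)))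
    ((J'.toDualNumber i).comp (algebraMap R (Completion R))) fun r => by
      rw [RingHom.comp_apply, RingHom.comp_apply, ← completionMap_algebraMap, J.res_map J' _ hkc,
        J'.fst_toDualNumber]
  let r := ∑ j, kR (c j) * y j
  -- The assumed relation says that `f r` has zero linear part. Tangent vectors kill the square of
  -- the maximal ideal, so `∂/∂y_i` vanishes on `r`, that is, `c i = 0`.
  have hr : f r ∈ maximalIdeal S ^ 2 := by
    rw [← algebraMap_mem_pow_iff]
    refine J.mem_sq_of_lin_eq_zero hx ?_ ?_
    · rw [← pow_one (maximalIdeal (Completion S)), algebraMap_mem_pow_iff, pow_one]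
      refine (map_mem_nonunits_iff f _).mpr (sum_mem fun j _ => Ideal.mul_mem_left _ _ (hy.mem j))
    · rw [← hc]
      simp only [r, map_sum, map_mul, hk]
      exact Finset.sum_congr rfl fun j _ => J.lin_const_mul _ _
  have hsq : ∀ s ∈ maximalIdeal S ^ 2, g s = 0 := by
    intro s hs
    rw [pow_two] at hs
    refine Submodule.mul_induction_on hs (fun a ha b hb => ?_) fun a b ha hb => ?_
    · have ha' : (g a).fst = 0 := (hg' a).trans (hm a ha)
      have hb' : (g b).fst = 0 := (hg' b).trans (hm b hb)
      rw [map_mul]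
      ext <;> simp [ha', hb']
    · rw [map_add, ha, hb, add_zero]
  have h1 : (J'.lin (algebraMap R (Completion R) r)) i = 0 := by
    rw [← J'.snd_toDualNumber]
    exact congrArg TrivSqZeroExt.snd ((hg r).symm.trans (hsq _ hr))
  have h2 : J'.lin (algebraMap R (Completion R) r) = ∑ j, c j • Pi.single j 1 := by
    simp only [r, map_sum, map_mul]
    refine Finset.sum_congr rfl fun j _ => ?_
    rw [← J'.lin_coord j]
    exact J'.lin_const_mul _ _
  rw [h2, Finset.sum_apply, Finset.sum_eq_single i (by
    intro j _ hj; simp [Pi.single_eq_of_ne hj.symm]) (by simp)] at h1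
  simpa using h1

variable {X Y : Scheme.{u}} {sX : X ⟶ Spec (CommRingCat.of K)}
  {sY : Y ⟶ Spec (CommRingCat.of K)} {φ : X ⟶ Y}

theorem IsSmoothAt.formallySmooth_stalkMap {p : X} (h : IsSmoothAt φ p) :
    (φ.stalkMap p).hom.FormallySmooth := by
  obtain ⟨U, hp, hU⟩ := h
  let q : U.toScheme := ⟨p, hp⟩
  have h1 : q ∈ (U.ι ≫ φ).smoothLocus :=
    (U.ι ≫ φ).smoothLocus_eq_top.ge trivial
  have h2 := Scheme.Hom.mem_smoothLocus.mp h1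
  refine (RingHom.FormallySmooth.respectsIso.cancel_right_isIso (φ.stalkMap (U.ι q))
    (U.ι.stalkMap q)).mp ?_
  rwa [← CommRingCat.hom_comp, ← Scheme.Hom.stalkMap_comp U.ι φ q]

/-- The normal form at a point outside of the divisors at which the morphism is smooth. -/
theorem hasToroidalForm_of_isSmoothAt (hφ : φ ≫ sY = sX) {DX : ReducedDivisor X}
    {DY : ReducedDivisor Y} {p : X} [IsNoetherianRing (X.presheaf.stalk p)]
    [IsNoetherianRing (Y.presheaf.stalk (φ p))] {x : Fin d → X.presheaf.stalk p}
    {y : Fin m → Y.presheaf.stalk (φ p)} (hx : IsCoord (baseMap sX p) x)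
    (hy : IsCoord (baseMap sY (φ p)) y)
    (hX : stalkIdeal X DX.support p = ⊤) (hY : stalkIdeal Y DY.support (φ p) = ⊤)
    (hs : IsSmoothAt φ p) : HasToroidalForm sX φ d m DX DY p 0 0 := by
  have h : IsCoord (const sX p) fun i => algebraMap (X.presheaf.stalk p) (completedStalk X p) (x i) :=
    hx.completion
  have h' : IsCoord (const sY (φ p)) fun i =>
    algebraMap (Y.presheaf.stalk (φ p)) (completedStalk Y (φ p)) (y i) := hy.completion
  obtain ⟨J⟩ := h.nonempty_jet
  -- By smoothness the pullbacks of the `y i` have independent linear parts and extend to parameters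
  -- `x'`. For `n = l = r = 0` the normal form then reads `y_i = x_i`.
  obtain ⟨hmd, x', hx', hxy⟩ := exists_coord_extend h J
    (fun i => algebraMap (X.presheaf.stalk p) (completedStalk X p) ((φ.stalkMap p).hom (y i)))
    (fun i => by
      rw [← pow_one (maximalIdeal (completedStalk X p)), algebraMap_mem_pow_iff, pow_one]
      exact (map_mem_nonunits_iff (φ.stalkMap p).hom _).mpr (hy.mem i))
    (linearIndependent_lin_of_formallySmooth hs.formallySmooth_stalkMap
      (stalkMap_baseMap sX sY hφ p) hy h J)
  have hspan : ∀ {A : Type u} [CommRing A] {d : ℕ} (z : Fin d → A),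
      (⊤ : Ideal A) = Ideal.span {∏ j : Fin 0, z (Fin.castLE d.zero_le j)} := by
    intro A _ d z
    rw [Finset.univ_eq_empty, Finset.prod_empty, Ideal.span_singleton_one]
  refine ⟨d.zero_le, m.zero_le, x', fun i => algebraMap _ _ (y i), 0, 0, le_rfl, le_rfl,
    by omega, 0, ⟨?_, ?_⟩, ⟨?_, ?_⟩, fun i => i.elim0, fun i => i.elim0, fun i _ => ?_, ?_, ?_, ?_,
    fun j => j.elim0, fun j => j.elim0⟩
  · rw [hx', AdicCompletion.maximalIdeal_eq_map]
  · rw [completedIdeal, hX, Ideal.map_top, hspan]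
  · rw [h'.span, AdicCompletion.maximalIdeal_eq_map]
  · rw [completedIdeal, hY, Ideal.map_top]
    exact hspan fun i => algebraMap (Y.presheaf.stalk (φ p)) (completedStalk Y (φ p)) (y i)
  · refine (completionMap_algebraMap (φ.stalkMap p).hom (y i)).trans ((hxy i).symm.trans ?_)
    congr 1
    ext
    simp
  · intro k _ hk
    omega
  · simp [Matrix.rank_zero]
  · simp [Matrix.rank_zero]

/-- A closed point off the divisor is a `0`-point, where the local equation is an empty product. -/
theorem ReducedDivisor.stalkIdeal_eq_top [IsAlgClosed K] [CharZero K] (D : ReducedDivisor X)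
    (hX : IsNonsingularVariety sX d) (hD : D.IsSNC d) {p : X} (hp : IsClosed ({p} : Set X))
    (hpD : p ∉ D.support) : stalkIdeal X D.support p = ⊤ := by
  have hn : D.IsNPoint 0 p := by
    rw [ReducedDivisor.IsNPoint, Set.ncard_eq_zero (D.components.finite_toSet.subset
      fun W hW => hW.1)]
    exact Set.eq_empty_of_forall_notMem fun W hW => hpD (D.mem_support.mpr ⟨W, hW⟩)
  obtain ⟨_, x, -, h⟩ := hD.exists_isCoord hX hp hn
  rw [h, Finset.univ_eq_empty, Finset.prod_empty, Ideal.span_singleton_one]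

end Smooth

end Toroidal

end

/-! ### The equivalence -/

theorem mainTheorem3 {K : Type u} [Field K] [IsAlgClosed K] [CharZero K] (d m : ℕ)
    {X Y : Scheme.{u}} (sX : X ⟶ Spec (CommRingCat.of K)) (sY : Y ⟶ Spec (CommRingCat.of K))
    (hX : Toroidal.IsNonsingularVariety sX d) (hY : Toroidal.IsNonsingularVariety sY m)
    (φ : X ⟶ Y) (hφ : φ ≫ sY = sX) (hdom : IsDominant φ)
    (DX : Toroidal.ReducedDivisor X) (DY : Toroidal.ReducedDivisor Y)
    (hDY : DY.IsSNC m) (hDX : DX.IsSNC d) (hD : DX.support = φ ⁻¹' DY.support)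
    (hsm : ∀ p : X, p ∉ DX.support → Toroidal.IsSmoothAt φ p) :
    Toroidal.IsToroidal sX sY φ d m DX DY ↔
      ∀ p : X, IsClosed ({p} : Set X) → p ∈ DX.support → ∀ n l : ℕ,
        DX.IsNPoint n p → DY.IsNPoint l (φ p) →
          Toroidal.HasToroidalForm sX φ d m DX DY p n l := by
  constructor
  · intro ht p hp _ n l hn hl
    exact ht.hasToroidalForm hX hY hφ hDY hDX hD hp hn hl
  · intro h p hp
    have := hX.locallyOfFiniteType
    have := hY.locallyOfFiniteType
    have := hX.regular p
    have := hY.regular (φ p)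
    have hq := Toroidal.isClosed_singleton_map sX sY hφ hp
    -- With `rfl`, `n` is taken to be the number of components through the point.
    obtain ⟨_, x, hx, hxI⟩ := hDX.exists_isCoord hX hp rfl
    obtain ⟨_, y, hy, hyI⟩ := hDY.exists_isCoord hY hq rfl
    by_cases hpD : p ∈ DX.support
    · exact (h p hp hpD _ _ rfl rfl).exists_toric hφ hx.completion hy.completion
    -- Off the divisor the hypothesis gives no normal form; smoothness supplies it, and the same
    -- construction of a toric model applies.
    · have hqD : φ p ∉ DY.support := fun hq => hpD (hD ▸ hq)
      refine (Toroidal.hasToroidalForm_of_isSmoothAt hφ hx hy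
        (DX.stalkIdeal_eq_top hX hDX hp hpD) (DY.stalkIdeal_eq_top hY hDY hq hqD)
        (hsm p hpD)).exists_toric hφ hx.completion hy.completion
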